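/- For $f:\{0,1\}^n\to\{0,1\}$ and $m\in\mathbb N$ let $f^{m}(x_1,\dots,x_m)=f(x_1)\,|\,f(x_2)\,|\cdots|\,f(x_m)$ be the $m$-wise direct product (an $m$-bit string) and $f^{\oplus m}(x_1,\dots,x_m)=f(x_1)\oplus\cdots\oplus f(x_m)$ the $m$-wise XOR, where $x_i\in\{0,1\}^n$. Algorithms are programs of a probabilistic unit-cost random access machine (with addition and truncated subtraction, random access to the input bits and to a tape of fair coin tosses); such a program receives an $m$-tuple of $n$-bit strings together with $n$ and $m$. It has running time $t$ on these inputs if it halts within $t$ steps on each of them, whatever the coin tosses, and the fraction of the inputs on which it computes $g$ is the probability, over a uniformly random input and its coin tosses, that it outputs the value of $g$ at that input. There are an algorithm $A$ (a computable function from pairs of a program and a natural number to programs), a polynomial $p$ in two variables with natural number coefficients and a constant $c>0$ such that the following holds. Let $k\in\mathbb N$ and let $0<\epsilon<1$ be such that $\epsilon>2^{-k}$. Let $n,t\in\mathbb N$, let $f:\{0,1\}^n\to\{0,1\}$, and let $C'$ be an algorithm that has running time $t$ on $k$-tuples of $n$-bit strings and computes $f^{\oplus k}$ on at least a $\frac12+\epsilon$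 fraction of the inputs. Then, given $C'$ and $\lceil 1/\epsilon\rceil$, the algorithm $A$ outputs an algorithm $C$ that has running time $t'\le p(k,1/\epsilon)\cdot t$ on $2k$-tuples of $n$-bit strings and computes $f^{2k}$ on at least a $c\left(\frac{\epsilon^2}{k}+\epsilon^4\right)$ fraction of the inputs. -/

import Mathlib

/-! ### Probabilistic random access machines

The machine model is the unit-cost RAM with addition and (truncated) subtraction as its only
arithmetic operations, together with an input tape, a tape of fair coin tosses and a write-only
output tape. -/

/-- Instructions. Cell `a` of the memory holds a natural number, written `[a]` below. -/
inductive Instr : Type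
  /-- `[d] := c` -/
  | const (d c : ℕ)
  /-- `[d] := [a] + [b]` -/
  | add (d a b : ℕ)
  /-- `[d] := [a] - [b]` (truncated at zero) -/
  | sub (d a b : ℕ)
  /-- `[d] := [[a]]` -/
  | load (d a : ℕ)
  /-- `[[a]] := [b]` -/
  | store (a b : ℕ)
  /-- `[d] :=` bit number `[a]` of the input -/
  | input (d a : ℕ)
  /-- `[d] :=` coin toss number `[a]` (the same number always gives the same toss) -/
  | coin (d a : ℕ)
  /-- append a bit to the output: `false` if `[a] = 0`, and `true` otherwise -/
  | print (a : ℕ)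
  /-- continue with instruction number `l` if `[a] = 0`, with the next instruction otherwise -/
  | jz (a l : ℕ)

/-- Instructions as a sum of tuples of numbers; this is used only to encode programs as numbers. -/
def Instr.equivSum : Instr ≃
    (ℕ × ℕ) ⊕ (ℕ × ℕ × ℕ) ⊕ (ℕ × ℕ × ℕ) ⊕ (ℕ × ℕ) ⊕ (ℕ × ℕ) ⊕ (ℕ × ℕ) ⊕ (ℕ × ℕ) ⊕ ℕ ⊕ (ℕ × ℕ) where
  toFun
    | .const d c => .inl (d, c)
    | .add d a b => .inr (.inl (d, a, b))
    | .sub d a b => .inr (.inr (.inl (d, a, b)))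
    | .load d a => .inr (.inr (.inr (.inl (d, a))))
    | .store a b => .inr (.inr (.inr (.inr (.inl (a, b)))))
    | .input d a => .inr (.inr (.inr (.inr (.inr (.inl (d, a))))))
    | .coin d a => .inr (.inr (.inr (.inr (.inr (.inr (.inl (d, a)))))))
    | .print a => .inr (.inr (.inr (.inr (.inr (.inr (.inr (.inl a)))))))
    | .jz a l => .inr (.inr (.inr (.inr (.inr (.inr (.inr (.inr (a, l))))))))
  invFun
    | .inl (d, c) => .const d c
    | .inr (.inl (d, a, b)) => .add d a b
    | .inr (.inr (.inl (d, a, b))) => .sub d a b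
    | .inr (.inr (.inr (.inl (d, a)))) => .load d a
    | .inr (.inr (.inr (.inr (.inl (a, b))))) => .store a b
    | .inr (.inr (.inr (.inr (.inr (.inl (d, a)))))) => .input d a
    | .inr (.inr (.inr (.inr (.inr (.inr (.inl (d, a))))))) => .coin d a
    | .inr (.inr (.inr (.inr (.inr (.inr (.inr (.inl a))))))) => .print a
    | .inr (.inr (.inr (.inr (.inr (.inr (.inr (.inr (a, l)))))))) => .jz a l
  left_inv i := by cases i <;> rfl
  right_inv s := by
    rcases s with s | s | s | s | s | s | s | s | s <;> rfl

instance : Primcodable Instr := Primcodable.ofEquiv _ Instr.equivSum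

/-- An algorithm: a program, that is, a finite list of instructions. -/
abbrev Prog : Type := List Instr

/-- A configuration: program counter, memory, and the output written so far. -/
structure Config : Type where
  pc : ℕ
  mem : ℕ → ℕ
  out : List Bool

/-- Write `v` into cell `d` and go on to the next instruction. -/
def Config.set (s : Config) (d v : ℕ) : Config :=
  { s with pc := s.pc + 1, mem := Function.update s.mem d v }

/-- The effect of one instruction, for the input `inp` and the coin tosses `ω`. -/
def Instr.exec (inp ω : ℕ → Bool) (s : Config) : Instr → Config
  | .const d c => s.set d c
  | .add d a b => s.set d (s.mem a + s.mem b)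
  | .sub d a b => s.set d (s.mem a - s.mem b)
  | .load d a => s.set d (s.mem (s.mem a))
  | .store a b => s.set (s.mem a) (s.mem b)
  | .input d a => s.set d (inp (s.mem a)).toNat
  | .coin d a => s.set d (ω (s.mem a)).toNat
  | .print a => { s with pc := s.pc + 1, out := s.out ++ [decide (s.mem a ≠ 0)] }
  | .jz a l => { s with pc := if s.mem a = 0 then l else s.pc + 1 }

namespace Prog

/-- The program has halted when the program counter has left the program. -/
def Halted (P : Prog) (s : Config) : Prop := P.length ≤ s.pc

/-- One step of the computation; a halted configuration does not change any more. -/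
def step (P : Prog) (inp ω : ℕ → Bool) (s : Config) : Config :=
  match P[s.pc]? with
  | some i => i.exec inp ω s
  | none => s

/-- An `m`-tuple of `n`-bit strings as an input tape: bit `n * i + j` is bit `j` of the `i`-th
string, and all positions from `n * m` on hold `false`. -/
def tape {n m : ℕ} (x : Fin m → Fin n → Bool) (p : ℕ) : Bool :=
  if h : p < m * n then
    x (finProdFinEquiv.symm ⟨p, h⟩).1 (finProdFinEquiv.symm ⟨p, h⟩).2
  else false

/-- The initial configuration on an `m`-tuple of `n`-bit strings: cells `0` and `1` hold the
format `n`, `m` of the input, all other cells hold zero, and nothing has been output. -/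
def init (n m : ℕ) : Config where
  pc := 0
  mem := fun a => if a = 0 then n else if a = 1 then m else 0
  out := []

/-- The configuration after `T` steps on input `x` with coin tosses `ω`. -/
def run (P : Prog) {n m : ℕ} (x : Fin m → Fin n → Bool) (ω : ℕ → Bool) (T : ℕ) : Config :=
  (P.step (tape x) ω)^[T] (init n m)

/-- `P` has running time (at most) `t` on `m`-tuples of `n`-bit strings: it halts within `t` steps
on every such tuple, whatever the coin tosses. -/
def RunsInTime (P : Prog) (n m t : ℕ) : Prop :=
  ∀ (x : Fin m → Fin n → Bool) (ω : ℕ → Bool), P.Halted (P.run x ω t)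

/-- On input `x` and with coin tosses `ω`, the program `P` halts with output `y`. -/
def Returns (P : Prog) {n m : ℕ} (x : Fin m → Fin n → Bool) (ω : ℕ → Bool) (y : List Bool) :
    Prop :=
  ∃ T : ℕ, P.Halted (P.run x ω T) ∧ (P.run x ω T).out = y

end Prog

/-- The law of an infinite sequence of independent fair coin tosses. -/
noncomputable def coinMeasure : MeasureTheory.Measure (ℕ → Bool) :=
  MeasureTheory.Measure.infinitePi fun _ : ℕ => (PMF.uniformOfFintype Bool).toMeasure

/-- The fraction of the inputs on which `P` computes `g`: the probability, over a uniformly random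
`m`-tuple `x` of `n`-bit strings and over the coin tosses of `P`, that `P` outputs `g x`. -/
noncomputable def Prog.successFraction (P : Prog) {n m : ℕ}
    (g : (Fin m → Fin n → Bool) → List Bool) : ℝ :=
  (∑ x : Fin m → Fin n → Bool, coinMeasure.real {ω | P.Returns x ω (g x)}) /
    (Fintype.card (Fin m → Fin n → Bool) : ℝ)

/-- The `m`-wise direct product `f(x₁) | f(x₂) | ... | f(xₘ)`. -/
def directProduct {n : ℕ} (f : (Fin n → Bool) → Bool) (m : ℕ) (x : Fin m → Fin n → Bool) :
    List Bool :=
  List.ofFn fun i => f (x i)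

/-- The `m`-wise XOR `f(x₁) ⊕ f(x₂) ⊕ ... ⊕ f(xₘ)`, as a one-bit string. -/
def xorProduct {n : ℕ} (f : (Fin n → Bool) → Bool) (m : ℕ) (x : Fin m → Fin n → Bool) :
    List Bool :=
  [(directProduct f m x).foldr xor false]

/-! ### Structured programs -/

namespace Ram

/-! Fix a 2k-tuple x, put v_i = f(x_i), and fix the coin tosses of the given program C'. For a set r
of k of the 2k positions let F(r) = ±1 be the sign of the bit that C' outputs on the blocks in r,
and let F vanish on all other sets. Where C' is right, F(r) is the value at r of the character of
the cube given by v. The blocks in r form a uniformly random k-tuple, so the correlation δ of F with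
this character on the middle slice has mean at least 2ε over x and the coin tosses
(`le_mean_correlation`). It remains to recover v from queries to F, which is a list decoding
problem.

The middle slice has density μ of order 1/√k. The Fourier coefficient of F at v on the whole cube is
μδ, and its square is of order δ²/k (`weight_ext`, `le_middle_sq`). An attempt samples a string z
with probability close to the squared coefficient at z: it draws a number u and fixes the bits of z
one by one, in the manner of Goldreich and Levin, guided by estimates of the total weight of all
extensions of a prefix. For a prefix of length l this weight is the mean of F(q)χ(q)F(q')χ(q') over
random q, q' that agree from position l on and are independent below l (`weight_add`, `weight_top`),
so it can be estimated from samples. The string is accepted only if a fresh estimate of its own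
weight reaches a threshold. If δ ≥ ε, an attempt yields v with probability at least δ²/(8k)
(`le_coin_attempt_of_correlation`).

Up to k attempts are made. Characters on the middle slice are almost orthogonal, except that
complementary strings give the same character up to sign (`abs_krawtchouk_le_of_ne`). Hence, if kε²
≥ 512, the strings with correlation at least ε/16 in absolute value have squared correlations of sum
at most 4 (`sum_sq_le`), and an attempt accepts anything at all with probability at most 5/k
(`coin_attempt_ne_none_le`). A wrong acceptance therefore seldom spoils the later attempts, and v is
found with probability of order δ² (`le_coin_search`). If kε² < 512, the rate δ²/k is already good
enough, because ε⁴ is then at most 512ε²/k. In both cases the probability is at least κδ² for δ ≥ ε,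
hence at least κε(δ - ε) for every δ. The latter is linear in δ, and averaging gives κε²
(`exists_rate`, `le_successFraction_mainCode`).

On the machine, C' is translated instruction by instruction and receives the even-numbered tosses,
the same ones in every query, so that F does not change; the search uses the odd-numbered ones
(`coin_map_interleave`). The translation is primitive recursive (`computable_main`), and the running
time is dominated by the simulations of C' (`runTime_le`). -/

/-- A piece of program, as a function of the position at which it is placed. -/
abbrev Code : Type := ℕ → List Instr

/-- Straight-line code. -/
def block (l : List Instr) : Code := fun _ => l

/-- Sequential composition. -/
def seq (c d : Code) : Code := fun p => c p ++ d (p + (c p).length)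

/-- Repeat `c` as long as cell `r` is not zero. Cell `2` has to hold zero. -/
def loop (r : ℕ) (c : Code) : Code := fun p =>
  .jz r (p + 1 + (c (p + 1)).length + 1) :: (c (p + 1) ++ [.jz 2 p])

/-- Run `c` if cell `r` is not zero, and `d` otherwise. Cell `2` has to hold zero. -/
def cond (r : ℕ) (c d : Code) : Code := fun p =>
  .jz r (p + 1 + (c (p + 1)).length + 1) :: (c (p + 1) ++
    .jz 2 (p + 1 + (c (p + 1)).length + 1 + (d (p + 1 + (c (p + 1)).length + 1)).length) ::
      d (p + 1 + (c (p + 1)).length + 1))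

/-- The list `l` occurs in `P` from position `p` on. -/
def Occurs (P : Prog) (p : ℕ) (l : List Instr) : Prop :=
  ∀ i (h : i < l.length), P[p + i]? = some l[i]

theorem occurs_append {P : Prog} {p : ℕ} {l l' : List Instr} :
    Occurs P p (l ++ l') ↔ Occurs P p l ∧ Occurs P (p + l.length) l' := by
  constructor
  · intro h
    refine ⟨fun i hi => ?_, fun i hi => ?_⟩
    · have := h i (by simp; omega)
      rwa [List.getElem_append_left hi] at this
    · have := h (l.length + i) (by simp; omega)
      rw [List.getElem_append_right (by omega)] at this
      simpa [add_assoc] using this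
  · rintro ⟨h, h'⟩ i hi
    by_cases hl : i < l.length
    · rw [List.getElem_append_left hl]
      exact h i hl
    · rw [List.getElem_append_right (by omega)]
      have := h' (i - l.length) (by simp at hi; omega)
      rwa [show p + l.length + (i - l.length) = p + i by omega] at this

theorem occurs_cons {P : Prog} {p : ℕ} {i : Instr} {l : List Instr} :
    Occurs P p (i :: l) ↔ P[p]? = some i ∧ Occurs P (p + 1) l := by
  have h := occurs_append (P := P) (p := p) (l := [i]) (l' := l)
  have h1 : Occurs P p [i] ↔ P[p]? = some i := by
    constructor
    · intro h
      simpa using h 0 (by simp)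
    · intro h j hj
      have : j = 0 := by simp at hj; omega
      subst this
      simpa using h
  simpa [h1] using h

theorem Occurs.self (P : Prog) : Occurs P 0 P := fun i h => by simp [h]

/-! ### Execution of code fragments with time bounds -/

variable {inp ω : ℕ → Bool}

/-- Instructions that neither jump nor print. -/
def Plain : Instr → Prop
  | .print _ => False
  | .jz _ _ => False
  | _ => True

/-- The effect of a plain instruction on the memory. -/
def eff (inp ω : ℕ → Bool) : Instr → (ℕ → ℕ) → ℕ → ℕ
  | .const d c, m => Function.update m d c
  | .add d a b, m => Function.update m d (m a + m b)
  | .sub d a b, m => Function.update m d (m a - m b)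
  | .load d a, m => Function.update m d (m (m a))
  | .store a b, m => Function.update m (m a) (m b)
  | .input d a, m => Function.update m d (inp (m a)).toNat
  | .coin d a, m => Function.update m d (ω (m a)).toNat
  | .print _, m => m
  | .jz _ _, m => m

/-- The effect of straight-line code on the memory. -/
def effs (inp ω : ℕ → Bool) (l : List Instr) (m : ℕ → ℕ) : ℕ → ℕ :=
  l.foldl (fun m i => eff inp ω i m) m

@[simp] theorem effs_nil (m : ℕ → ℕ) : effs inp ω [] m = m := rfl

@[simp] theorem effs_cons (i : Instr) (l : List Instr) (m : ℕ → ℕ) :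
    effs inp ω (i :: l) m = effs inp ω l (eff inp ω i m) := rfl

@[simp] theorem effs_append (l l' : List Instr) (m : ℕ → ℕ) :
    effs inp ω (l ++ l') m = effs inp ω l' (effs inp ω l m) := List.foldl_append

theorem exec_of_plain {i : Instr} (h : Plain i) (p : ℕ) (m : ℕ → ℕ) (o : List Bool) :
    i.exec inp ω ⟨p, m, o⟩ = ⟨p + 1, eff inp ω i m, o⟩ := by
  cases i <;> first | rfl | exact h.elim

theorem step_eq {P : Prog} {p : ℕ} {i : Instr} (h : P[p]? = some i) (m : ℕ → ℕ) (o : List Bool) :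
    P.step inp ω ⟨p, m, o⟩ = i.exec inp ω ⟨p, m, o⟩ := by
  simp [Prog.step, h]

/-- Started with memory `m` and output `o`, the code `c` comes to its end within `T` steps, and
memory and output then satisfy `Q`. -/
def Exec (inp ω : ℕ → Bool) (c : Code) (T : ℕ) (m : ℕ → ℕ) (o : List Bool)
    (Q : (ℕ → ℕ) → List Bool → Prop) : Prop :=
  ∀ (P : Prog) (p : ℕ), Occurs P p (c p) → ∃ t ≤ T, ∃ m' o',
    (P.step inp ω)^[t] ⟨p, m, o⟩ = ⟨p + (c p).length, m', o'⟩ ∧ Q m' o'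

variable {c d : Code} {T T' : ℕ} {m : ℕ → ℕ} {o : List Bool} {Q R : (ℕ → ℕ) → List Bool → Prop}

theorem Exec.mono (h : Exec inp ω c T m o Q) (hT : T ≤ T') (hQ : ∀ m o, Q m o → R m o) :
    Exec inp ω c T' m o R := by
  intro P p hp
  obtain ⟨t, ht, m', o', h1, h2⟩ := h P p hp
  exact ⟨t, ht.trans hT, m', o', h1, hQ _ _ h2⟩

theorem Exec.le (h : Exec inp ω c T m o Q) (hT : T ≤ T') : Exec inp ω c T' m o Q :=
  h.mono hT fun _ _ h => h

theorem Exec.block {l : List Instr} (hl : ∀ i ∈ l, Plain i) (hT : l.length ≤ T)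
    (hQ : Q (effs inp ω l m) o) :
    Exec inp ω (block l) T m o Q := by
  refine Exec.le (T := l.length) ?_ hT
  intro P p hp
  refine ⟨l.length, le_rfl, _, _, ?_, hQ⟩
  change Occurs P p l at hp
  change _ = Config.mk (p + l.length) _ _
  clear hT hQ
  induction l generalizing p m with
  | nil => rfl
  | cons i l ih =>
    rw [occurs_cons] at hp
    rw [List.length_cons, Function.iterate_succ_apply, step_eq hp.1,
      exec_of_plain (hl i (by simp)), ih (fun j hj => hl j (by simp [hj])) _ hp.2]
    simp [add_assoc, add_comm 1]

theorem Exec.print (a : ℕ) (hQ : Q m (o ++ [decide (m a ≠ 0)])) :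
    Exec inp ω (Ram.block [.print a]) 1 m o Q := by
  intro P p hp
  refine ⟨1, le_rfl, _, _, ?_, hQ⟩
  have := hp 0 (by simp [Ram.block])
  simp [Ram.block] at this
  rw [Function.iterate_one, step_eq this]
  rfl

theorem Exec.seq (h : Exec inp ω c T m o fun m' o' => Exec inp ω d T' m' o' Q) :
    Exec inp ω (seq c d) (T + T') m o Q := by
  intro P p hp
  obtain ⟨hc, hd⟩ := occurs_append.1 hp
  obtain ⟨t, ht, m', o', h1, h2⟩ := h P p hc
  obtain ⟨t', ht', m'', o'', h3, h4⟩ := h2 P _ hd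
  refine ⟨t' + t, by omega, m'', o'', ?_, h4⟩
  rw [Function.iterate_add_apply, h1, h3]
  simp [Ram.seq, add_assoc]

/-- The two extra steps are the test and the jump over `d`. That jump is unconditional only because
cell `2` holds zero, so this is demanded after `c` and not after `d`. -/
theorem Exec.cond (r : ℕ) (hc : m r ≠ 0 → Exec inp ω c T m o fun m' o' => m' 2 = 0 ∧ Q m' o')
    (hd : m r = 0 → Exec inp ω d T m o Q) :
    Exec inp ω (cond r c d) (T + 2) m o Q := by
  intro P p hp
  unfold Ram.cond at hp
  rw [occurs_cons, occurs_append, occurs_cons] at hp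
  obtain ⟨h0, h1, h2, h3⟩ := hp
  by_cases h : m r = 0
  · obtain ⟨t, ht, m', o', h4, h5⟩ := hd h P _ h3
    refine ⟨t + 1, by omega, m', o', ?_, h5⟩
    rw [Function.iterate_succ_apply, step_eq h0]
    simp only [Instr.exec, h, if_true, h4]
    simp [Ram.cond]
    omega
  · obtain ⟨t, ht, m', o', h4, h5, h6⟩ := hc h P _ h1
    refine ⟨1 + (t + 1), by omega, m', o', ?_, h6⟩
    rw [Function.iterate_add_apply, Function.iterate_one, Function.iterate_succ_apply, step_eq h0]
    simp only [Instr.exec, h, if_false, h4]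
    rw [step_eq h2]
    simp [Instr.exec, h5, Ram.cond]
    omega

/-- A loop with invariant `I`, whose first argument bounds the number of rounds to come. -/
theorem Exec.loop_of_le (r : ℕ) (I : ℕ → (ℕ → ℕ) → List Bool → Prop)
    (hI : ∀ j m o, I (j + 1) m o →
      m r ≠ 0 ∧ Exec inp ω c T m o fun m' o' => m' 2 = 0 ∧ ∃ j' ≤ j, I j' m' o')
    (h0 : ∀ m o, I 0 m o → m r = 0 ∧ Q m o) (j : ℕ) (h : I j m o) :
    Exec inp ω (loop r c) (j * (T + 2) + 1) m o Q := by
  intro P p hp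
  have hp' := hp
  unfold Ram.loop at hp'
  rw [occurs_cons, occurs_append, occurs_cons] at hp'
  obtain ⟨h1, h2, h3, -⟩ := hp'
  induction j using Nat.strong_induction_on generalizing m o with
  | _ j ih =>
    obtain _ | j := j
    · obtain ⟨h4, h5⟩ := h0 m o h
      refine ⟨1, by simp, m, o, ?_, h5⟩
      rw [Function.iterate_one, step_eq h1]
      simp [Instr.exec, h4, Ram.loop]
      omega
    · obtain ⟨h4, h5⟩ := hI j m o h
      obtain ⟨t, ht, m', o', h6, h7, j', hj', h8⟩ := h5 P _ h2
      obtain ⟨t', ht', m'', o'', h9, h10⟩ := ih j' (by omega) h8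
      have := Nat.mul_le_mul_right (T + 2) hj'
      -- One step for the test, `t` for the body and one for the jump back.
      refine ⟨t' + (1 + (t + 1)), by rw [Nat.succ_mul]; omega, m'', o'', ?_, h10⟩
      rw [Function.iterate_add_apply, Function.iterate_add_apply, Function.iterate_one,
        Function.iterate_succ_apply, step_eq h1]
      simp only [Instr.exec, h4, if_false, h6]
      rw [step_eq h3]
      simp only [Instr.exec, h7, if_true, h9]

/-- A loop with invariant `I`, whose first argument is the number of rounds to come. -/
theorem Exec.loop (r : ℕ) (I : ℕ → (ℕ → ℕ) → List Bool → Prop)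
    (hI : ∀ j m o, I (j + 1) m o →
      m r ≠ 0 ∧ Exec inp ω c T m o fun m' o' => m' 2 = 0 ∧ I j m' o')
    (h0 : ∀ m o, I 0 m o → m r = 0 ∧ Q m o) (j : ℕ) (h : I j m o) :
    Exec inp ω (loop r c) (j * (T + 2) + 1) m o Q :=
  Exec.loop_of_le r I (fun j m o h => ⟨(hI j m o h).1, (hI j m o h).2.mono le_rfl
    fun _ _ h' => ⟨h'.1, j, le_rfl, h'.2⟩⟩) h0 j h

/-- At the end of the code the program counter equals the length of the program, where
configurations no longer change. Hence the upper bound for the time may be used as if it were the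
exact time. -/
theorem Exec.halts {n k : ℕ} {x : Fin k → Fin n → Bool}
    (h : Exec (Prog.tape x) ω c T (Prog.init n k).mem [] Q) {t : ℕ} (ht : T ≤ t) :
    Prog.Halted (c 0) (Prog.run (c 0) x ω t) ∧
      ∃ m, Q m (Prog.run (c 0) x ω t).out := by
  obtain ⟨t', ht', m', o', h1, h2⟩ := h (c 0) 0 (Occurs.self _)
  have hfix : ∀ s : ℕ, (Prog.step (c 0) (Prog.tape x) ω)^[s] ⟨0 + (c 0).length, m', o'⟩ =
      ⟨0 + (c 0).length, m', o'⟩ := fun s =>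
    Function.iterate_fixed (by simp [Prog.step]) s
  have : Prog.run (c 0) x ω t = ⟨0 + (c 0).length, m', o'⟩ := by
    rw [Prog.run, show t = (t - t') + t' by omega, Function.iterate_add_apply]
    change (Prog.step (c 0) (Prog.tape x) ω)^[t - t']
      ((Prog.step (c 0) (Prog.tape x) ω)^[t'] ⟨0, (Prog.init n k).mem, []⟩) = _
    rw [h1, hfix]
  rw [this]
  exact ⟨by simp [Prog.Halted], m', h2⟩

end Ram

/-! ### Simulation of a given program -/

namespace Ram

/-- Cell `r := ` cell `a` of the simulated machine, whose memory starts at address `[5]`. -/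
def fetch (r a : ℕ) : List Instr := [.const r a, .add r r 5, .load r r]

/-- Write `[9]` to address `[8]`, and update the upper bound `[6]` of the memory in use. -/
def write : List Instr := [.store 8 9, .add 8 8 3, .sub 10 8 6, .add 6 6 10]

/-- Cell `d` of the simulated machine `:= [9]`. -/
def put (d : ℕ) : List Instr := .const 8 d :: .add 8 8 5 :: write

/-- One round of the search for the block that contains the input position `[9]`. -/
def inputRound : Code :=
  seq (block [.sub 10 0 9])
    (seq (cond 10 (block [.load 10 8, .add 10 10 9, .input 11 10, .add 8 12 2])
      (block [.sub 9 9 0, .add 8 8 3])) (block [.sub 10 12 8]))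

/-- The translation of an instruction, where `tgt` translates the targets of jumps. -/
def transl (tgt : ℕ → ℕ) : Instr → Code
  | .const d c => block (.const 9 c :: put d)
  | .add d a b => block (fetch 9 a ++ fetch 10 b ++ .add 9 9 10 :: put d)
  | .sub d a b => block (fetch 9 a ++ fetch 10 b ++ .sub 9 9 10 :: put d)
  | .load d a => block (fetch 9 a ++ .add 9 9 5 :: .load 9 9 :: put d)
  | .store a b => block (fetch 9 b ++ fetch 8 a ++ .add 8 8 5 :: write)
  | .input d a => seq (block (fetch 9 a ++ [.add 8 13 2, .const 11 0, .sub 10 12 8]))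
      (seq (loop 10 inputRound) (block (.add 9 11 2 :: put d)))
  | .coin d a => block (fetch 9 a ++ .add 9 9 9 :: .coin 9 9 :: put d)
  | .print a => block (fetch 9 a ++ [.sub 10 3 9, .sub 7 3 10])
  | .jz a l => block (fetch 9 a ++ [.jz 9 (tgt l)])

/-- The length of the translation of an instruction. -/
def size (i : Instr) : ℕ := (transl id i 0).length

/-- Lengths do not depend on the jump targets. So all positions can be computed before the targets
are known, and the translation of jumps is not circular. -/
theorem length_transl (tgt : ℕ → ℕ) (i : Instr) (p : ℕ) : (transl tgt i p).length = size i := by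
  cases i <;> simp [size, transl, block, seq, loop, inputRound, cond, fetch, put, write]

/-- The position of the `j`-th instruction in the translation of `C`. -/
def pos (C : Prog) (j : ℕ) : ℕ := ((List.range j).map fun j => (C[j]?).elim 0 size).sum

/-- The translation of a program. -/
def translate (C : Prog) : Code := fun p =>
  (List.range C.length).flatMap fun j =>
    (C[j]?).elim [] fun i => transl (fun l => p + pos C l) i (p + pos C j)

theorem pos_succ (C : Prog) (j : ℕ) : pos C (j + 1) = pos C j + (C[j]?).elim 0 size := by
  simp [pos, List.range_succ]

/-- A jump of the simulated program may leave it at any position beyond its end; all of these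
correspond to the one end of the translated code. -/
theorem pos_of_le {C : Prog} {j : ℕ} (h : C.length ≤ j) : pos C j = pos C C.length := by
  induction j, h using Nat.le_induction with
  | base => rfl
  | succ j h ih => rw [pos_succ, ih]; simp [h]

theorem length_translate_aux (C : Prog) (p j : ℕ) :
    ((List.range j).flatMap fun j =>
      (C[j]?).elim [] fun i => transl (fun l => p + pos C l) i (p + pos C j)).length = pos C j := by
  induction j with
  | zero => rfl
  | succ j ih =>
    rw [List.range_succ, List.flatMap_append, List.length_append, ih, pos_succ]
    rcases hC : C[j]? with _ | i <;> simp [hC, length_transl]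

theorem length_translate (C : Prog) (p : ℕ) : (translate C p).length = pos C C.length :=
  length_translate_aux C p _

theorem occurs_transl {C P : Prog} {p j : ℕ} {i : Instr} (h : Occurs P p (translate C p))
    (hj : C[j]? = some i) : Occurs P (p + pos C j) (transl (fun l => p + pos C l) i (p + pos C j)) := by
  have key : ∀ n, j < n → Occurs P p ((List.range n).flatMap fun j =>
      (C[j]?).elim [] fun i => transl (fun l => p + pos C l) i (p + pos C j)) →
      Occurs P (p + pos C j) (transl (fun l => p + pos C l) i (p + pos C j)) := by
    intro n hn h
    induction n with
    | zero => omega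
    | succ n ih =>
      rw [List.range_succ, List.flatMap_append, occurs_append, length_translate_aux] at h
      by_cases hjn : j < n
      · exact ih hjn h.1
      · obtain rfl : j = n := by omega
        simpa [hj] using h.2
  exact key _ (List.getElem?_eq_some_iff.1 hj).1 h

/-! ### The simulation invariant -/

variable {inp ω : ℕ → Bool}

/-- The memory `m` represents the configuration `s` of the simulated machine, whose memory starts at
address `B`; outside of this memory and of the cells `6` to `11`, it coincides with `m₀`. -/
structure Rep (B : ℕ) (m₀ : ℕ → ℕ) (s : Config) (m : ℕ → ℕ) : Prop where
  frame : ∀ a < B, a < 6 ∨ 12 ≤ a → m a = m₀ a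
  mem : ∀ a, m (B + a) = s.mem a
  le_top : B ≤ m 6
  top : ∀ a, m 6 ≤ a → m a = 0
  out : m 7 = (s.out.getLast?.getD false).toNat

/-- What the simulation needs to know about the memory. -/
structure Base (B : ℕ) (m₀ : ℕ → ℕ) : Prop where
  le : 14 ≤ B
  zero : m₀ 2 = 0
  one : m₀ 3 = 1
  base : m₀ 5 = B

variable {B : ℕ} {m₀ m : ℕ → ℕ} {s : Config}

theorem Rep.scratch (h : Rep B m₀ s m) (hB : 14 ≤ B) {r : ℕ} (hr : 8 ≤ r) (hr' : r < 12) (v : ℕ) :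
    Rep B m₀ s (Function.update m r v) where
  frame a ha ha' := by rw [Function.update_of_ne (by omega)]; exact h.frame a ha ha'
  mem a := by rw [Function.update_of_ne (by omega)]; exact h.mem a
  le_top := by rw [Function.update_of_ne (by omega)]; exact h.le_top
  top a ha := by
    have := h.le_top
    rw [Function.update_of_ne (by omega)] at ha
    rw [Function.update_of_ne (by omega)]; exact h.top a ha
  out := by rw [Function.update_of_ne (by omega)]; exact h.out

theorem Rep.setPc (h : Rep B m₀ s m) (p : ℕ) : Rep B m₀ { s with pc := p } m := { h with }

theorem effs_fetch (h : Rep B m₀ s m) (hb : Base B m₀) {r : ℕ} (hr : 8 ≤ r) (hr' : r < 12)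
    (a : ℕ) : effs inp ω (fetch r a) m = Function.update m r (s.mem a) := by
  have h5 : m 5 = B := by rw [h.frame 5 (by have := hb.le; omega) (by omega), hb.base]
  have := hb.le
  have h5r : (5 : ℕ) ≠ r := by omega
  have hB : B + a ≠ r := by omega
  simp [fetch, eff, Function.update_of_ne h5r, h5, Function.update_of_ne hB, add_comm a, h.mem]

theorem Rep.write (h : Rep B m₀ s m) (hb : Base B m₀) {d : ℕ} (hd : m 8 = B + d) :
    Rep B m₀ (s.set d (m 9)) (effs inp ω write m) := by
  have h3 : m 3 = 1 := by rw [h.frame 3 (by have := hb.le; omega) (by omega), hb.one]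
  have := hb.le
  have := h.le_top
  have n3 : 3 ≠ B + d := by omega
  have n6 : 6 ≠ B + d := by omega
  have n8 : 8 ≠ B + d := by omega
  -- With truncated subtraction, adding `[8] - [6]` to `[6]` gives the maximum of the two, so that
  -- cell `6` stays an upper bound of the memory in use.
  have e : effs inp ω Ram.write m =
      Function.update (Function.update (Function.update (Function.update m (B + d) (m 9))
        8 (B + d + 1)) 10 (B + d + 1 - m 6)) 6 (m 6 + (B + d + 1 - m 6)) := by
    simp [Ram.write, eff, hd, h3, Function.update_of_ne n3, Function.update_of_ne n6,
      Function.update_of_ne n8]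
  rw [e]
  constructor
  · intro a ha ha'
    simp only [Function.update_apply]
    rw [if_neg (by omega), if_neg (by omega), if_neg (by omega), if_neg (by omega), h.frame a ha ha']
  · intro a
    simp only [Function.update_apply]
    rw [if_neg (by omega), if_neg (by omega), if_neg (by omega), h.mem]
    simp [Config.set, Function.update_apply]
  · simp
    omega
  · intro a ha
    simp at ha
    simp only [Function.update_apply]
    rw [if_neg (by omega), if_neg (by omega), if_neg (by omega), if_neg (by omega), h.top a (by omega)]
  · have n7 : 7 ≠ B + d := by omega
    simp [Config.set, Function.update_of_ne n7, h.out]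

theorem Rep.put (h : Rep B m₀ s m) (hb : Base B m₀) (d : ℕ) :
    Rep B m₀ (s.set d (m 9)) (effs inp ω (put d) m) := by
  have h5 : m 5 = B := by rw [h.frame 5 (by have := hb.le; omega) (by omega), hb.base]
  simp only [Ram.put, effs_cons, eff]
  have := ((h.scratch hb.le (r := 8) (by omega) (by omega) d).scratch hb.le (r := 8)
    (by omega) (by omega) (d + B)).write (inp := inp) (ω := ω) hb (d := d) (by simp [add_comm])
  simpa [h5] using this

/-- What the simulation needs to know about the input: `[13]` is the address of an array of `k`
numbers `off i` that ends before address `[12]`, and input bit `n * i + q` of the simulated machine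
is input bit `off i + q`. -/
structure Offsets (inp inp' : ℕ → Bool) (n k : ℕ) (B : ℕ) (m₀ : ℕ → ℕ) where
  off : ℕ → ℕ
  le : 14 ≤ m₀ 13
  upper : m₀ 12 = m₀ 13 + k
  upper_le : m₀ 12 ≤ B
  arr : ∀ i < k, m₀ (m₀ 13 + i) = off i
  len : m₀ 0 = n
  input : ∀ i < k, ∀ q < n, inp' (n * i + q) = inp (off i + q)
  input_of_le : ∀ p, n * k ≤ p → inp' p = false

variable {inp' : ℕ → Bool} {n k : ℕ} {o : List Bool}

/-- The position is divided by `n` through repeated subtraction, while `[8]` moves along the array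
of offsets. Once the block is found, `[8]` is set to the end of the array; this makes the counter
`[10]` vanish and leaves the loop early. -/
theorem exec_inputRound {j p : ℕ} (h : Rep B m₀ s m) (hb : Base B m₀)
    (ho : Offsets inp inp' n k B m₀) (h8 : m 8 + (j + 1) = m 12) (hj : j < k)
    (hp : m 9 + n * (k - (j + 1)) = p) (h11 : m 11 = 0) :
    Exec inp ω inputRound 8 m o fun m' o' => o' = o ∧ Rep B m₀ s m' ∧
      ((m' 10 = 0 ∧ m' 11 = (inp' p).toNat) ∨
        (m' 10 = j ∧ m' 8 + j = m' 12 ∧ m' 9 + n * (k - j) = p ∧ m' 11 = 0)) := by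
  have := hb.le
  have := ho.le
  have := ho.upper
  have := ho.upper_le
  have e0 : m 0 = n := by rw [h.frame 0 (by omega) (by omega), ho.len]
  have e2 : m 2 = 0 := by rw [h.frame 2 (by omega) (by omega), hb.zero]
  have e3 : m 3 = 1 := by rw [h.frame 3 (by omega) (by omega), hb.one]
  have e12 : m 12 = m₀ 13 + k := by rw [h.frame 12 (by omega) (by omega), ho.upper]
  refine Exec.seq (T := 1) (T' := 7) (Exec.block (by simp [Plain]) (by simp) ?_)
  refine Exec.seq (T := 6) (T' := 1) (Exec.cond 10 (T := 4) ?_ ?_)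
  · intro h10
    refine Exec.block (by simp [Plain]) (by simp) ⟨?_, Exec.block (by simp [Plain]) (by simp) ?_⟩
    · simp [eff, e2]
    · have hlt : m 9 < n := by simpa [eff, e0, Nat.sub_eq_zero_iff_le] using h10
      have e8 : m 8 = m₀ 13 + (k - (j + 1)) := by omega
      have harr : m (m 8) = ho.off (k - (j + 1)) := by
        rw [e8, h.frame _ (by omega) (by omega), ho.arr _ (by omega)]
      have hne : m 8 ≠ 10 := by omega
      refine ⟨rfl, ?_, Or.inl ⟨?_, ?_⟩⟩
      · simp only [effs_cons, effs_nil, eff]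
        repeat' refine Rep.scratch ?_ hb.le (by omega) (by omega) _
        exact h
      · simp [eff, e2]
      · rw [← hp, add_comm, ho.input _ (by omega) _ hlt]
        simp [eff, Function.update_of_ne hne, harr]
  · intro h10
    refine Exec.block (by simp [Plain]) (by simp) (Exec.block (by simp [Plain]) (by simp) ?_)
    have hle : n ≤ m 9 := by simpa [eff, e0, Nat.sub_eq_zero_iff_le] using h10
    refine ⟨rfl, ?_, Or.inr ⟨?_, ?_, ?_, ?_⟩⟩
    · simp only [effs_cons, effs_nil, eff]
      repeat' refine Rep.scratch ?_ hb.le (by omega) (by omega) _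
      exact h
    · simp [eff, e3]; omega
    · simp [eff, e3]; omega
    · simp [eff, e0]
      rw [show k - j = k - (j + 1) + 1 by omega, Nat.mul_succ]
      omega
    · simp [eff, h11]

theorem exec_inputLoop {p : ℕ} (h : Rep B m₀ s m) (hb : Base B m₀)
    (ho : Offsets inp inp' n k B m₀) (h8 : m 8 = m 13) (h9 : m 9 = p) (h10 : m 10 = k)
    (h11 : m 11 = 0) :
    Exec inp ω (loop 10 inputRound) (k * 10 + 1) m o fun m' o' => o' = o ∧ Rep B m₀ s m' ∧
      m' 11 = (inp' p).toNat := by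
  have := hb.le
  have := ho.le
  have := ho.upper
  have := ho.upper_le
  refine Exec.loop_of_le (T := 8) 10 (fun j m' o' => o' = o ∧ Rep B m₀ s m' ∧
      ((j = 0 ∧ m' 10 = 0 ∧ m' 11 = (inp' p).toNat) ∨ (j ≤ k ∧ m' 10 = j ∧
        m' 8 + j = m' 12 ∧ m' 9 + n * (k - j) = p ∧ m' 11 = 0))) ?_ ?_ k ?_
  · rintro j m' o' ⟨rfl, hr, ⟨hj, -⟩ | ⟨hj, h10, h8, h9, h11⟩⟩
    · omega
    · refine ⟨by omega, (exec_inputRound hr hb ho h8 hj h9 h11).mono le_rfl ?_⟩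
      rintro m'' o'' ⟨ho', hr', hc⟩
      refine ⟨by rw [hr'.frame 2 (by omega) (by omega), hb.zero], ?_⟩
      rcases hc with ⟨h10', h11'⟩ | ⟨h10', h8', h9', h11'⟩
      · exact ⟨0, by omega, ho', hr', Or.inl ⟨rfl, h10', h11'⟩⟩
      · exact ⟨j, le_rfl, ho', hr', Or.inr ⟨by omega, h10', h8', h9', h11'⟩⟩
  · rintro m' o' ⟨rfl, hr, ⟨-, h10, h11⟩ | ⟨-, h10, h8, h9, h11⟩⟩
    · exact ⟨h10, rfl, hr, h11⟩
    · refine ⟨h10, rfl, hr, ?_⟩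
      -- All `k` blocks have been passed, so the position lies beyond the input. The tape holds
      -- `false` there, which is also the initial value of `[11]`.
      rw [h11, ho.input_of_le p (by simp at h9; omega)]
      rfl
  · have e12 : m 12 = m₀ 13 + k := by rw [h.frame 12 (by omega) (by omega), ho.upper]
    have e13 : m 13 = m₀ 13 := h.frame 13 (by omega) (by omega)
    exact ⟨rfl, h, Or.inr ⟨le_rfl, h10, by omega, by simp [h9], h11⟩⟩

/-- Toss `c` of the simulated program is toss `2 * c` of the host, which leaves the odd tosses to
the search. Only the reading of an input bit costs more than a constant. Jumps are treated in
`Rep.step`, since they do not end at the end of their code. -/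
theorem exec_transl (tgt : ℕ → ℕ) {i : Instr} (hi : ∀ a l, i ≠ .jz a l) (h : Rep B m₀ s m)
    (hb : Base B m₀) (ho : Offsets inp inp' n k B m₀) :
    Exec inp ω (transl tgt i) (10 * k + 15) m o fun m' o' => o' = o ∧
      Rep B m₀ (i.exec inp' (fun c => ω (2 * c)) s) m' := by
  have := hb.le
  have := ho.le
  have := ho.upper
  have := ho.upper_le
  have e2 : m 2 = 0 := by rw [h.frame 2 (by omega) (by omega), hb.zero]
  have e3 : m 3 = 1 := by rw [h.frame 3 (by omega) (by omega), hb.one]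
  have e5 : m 5 = B := by rw [h.frame 5 (by omega) (by omega), hb.base]
  have sc : ∀ {m r} v, Rep B m₀ s m → 8 ≤ r → r < 12 → Rep B m₀ s (Function.update m r v) :=
    fun v h hr hr' => h.scratch hb.le hr hr' v
  have F : ∀ {m r a}, Rep B m₀ s m → 8 ≤ r → r < 12 →
    effs inp ω (fetch r a) m = Function.update m r (s.mem a) :=
    fun h hr hr' => effs_fetch h hb hr hr' _
  cases i with
  | const d c =>
    simp only [transl]
    refine Exec.block (by simp [Plain, put, write]) (by simp [put, write]) ⟨rfl, ?_⟩
    simpa [eff, Instr.exec] using (sc c h (r := 9) (by omega) (by omega)).put hb d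
  | add d a b =>
    simp only [transl]
    refine Exec.block (by simp [Plain, put, write, fetch]) (by simp [put, write, fetch])
      ⟨rfl, ?_⟩
    have h1 := sc (s.mem a) h (r := 9) (by omega) (by omega)
    have h2 := sc (s.mem b) h1 (r := 10) (by omega) (by omega)
    rw [effs_append, effs_append, effs_cons, F h (by omega) (by omega), F h1 (by omega) (by omega)]
    simpa [eff, Instr.exec] using (sc (s.mem a + s.mem b) h2 (r := 9) (by omega) (by omega)).put hb d
  | sub d a b =>
    simp only [transl]
    refine Exec.block (by simp [Plain, put, write, fetch]) (by simp [put, write, fetch])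
      ⟨rfl, ?_⟩
    have h1 := sc (s.mem a) h (r := 9) (by omega) (by omega)
    have h2 := sc (s.mem b) h1 (r := 10) (by omega) (by omega)
    rw [effs_append, effs_append, effs_cons, F h (by omega) (by omega), F h1 (by omega) (by omega)]
    simpa [eff, Instr.exec] using (sc (s.mem a - s.mem b) h2 (r := 9) (by omega) (by omega)).put hb d
  | load d a =>
    simp only [transl]
    refine Exec.block (by simp [Plain, put, write, fetch]) (by simp [put, write, fetch])
      ⟨rfl, ?_⟩
    rw [effs_append, effs_cons, effs_cons, F h (by omega) (by omega)]
    have n9 : B + s.mem a ≠ 9 := by omega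
    have := (sc (s.mem (s.mem a)) h (r := 9) (by omega) (by omega)).put (inp := inp) (ω := ω) hb d
    simpa [eff, Instr.exec, e5, add_comm _ B, h.mem, Function.update_of_ne n9] using this
  | store a b =>
    simp only [transl]
    refine Exec.block (by simp [Plain, write, fetch]) (by simp [write, fetch]) ⟨rfl, ?_⟩
    have h1 := sc (s.mem b) h (r := 9) (by omega) (by omega)
    have h2 := sc (B + s.mem a) h1 (r := 8) (by omega) (by omega)
    rw [effs_append, effs_append, effs_cons, F h (by omega) (by omega), F h1 (by omega) (by omega)]
    have := h2.write (inp := inp) (ω := ω) hb (d := s.mem a) (by simp)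
    simpa [eff, Instr.exec, e5, add_comm _ B] using this
  | coin d a =>
    simp only [transl]
    refine Exec.block (by simp [Plain, put, write, fetch]) (by simp [put, write, fetch])
      ⟨rfl, ?_⟩
    rw [effs_append, effs_cons, effs_cons, F h (by omega) (by omega)]
    have := (sc (ω (2 * s.mem a)).toNat h (r := 9) (by omega) (by omega)).put (inp := inp)
      (ω := ω) hb d
    simpa [eff, Instr.exec, two_mul] using this
  | print a =>
    simp only [transl]
    refine Exec.block (by simp [Plain, fetch]) (by simp [fetch]) ⟨rfl, ?_⟩
    rw [effs_append, F h (by omega) (by omega)]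
    -- The truncated difference `1 - (1 - a)` turns `a` into a bit. Only the last printed bit is
    -- kept, which suffices for the value of an xor.
    have h1 := sc (1 - s.mem a) (sc (s.mem a) h (r := 9) (by omega) (by omega)) (r := 10)
      (by omega) (by omega)
    simp [eff, e3]
    constructor
    · intro a ha ha'
      rw [Function.update_of_ne (by omega)]; exact h1.frame a ha ha'
    · intro a
      rw [Function.update_of_ne (by omega)]; exact h1.mem a
    · exact h1.le_top
    · intro a ha
      have := h1.le_top
      rw [Function.update_of_ne (by omega)] at ha
      rw [Function.update_of_ne (by omega)]
      exact h1.top a ha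
    · simp [Instr.exec]
      by_cases hz : s.mem a = 0
      · simp [hz]
      · simp [hz]; omega
  | jz a l => exact absurd rfl (hi a l)
  | input d a =>
    simp only [transl]
    refine Exec.le (T := 6 + (k * 10 + 1 + 7)) ?_ (by omega)
    refine Exec.seq (Exec.block (by simp [Plain, fetch]) (by simp [fetch]) ?_)
    rw [effs_append, F h (by omega) (by omega)]
    have e12 : m 12 = m₀ 13 + k := by rw [h.frame 12 (by omega) (by omega), ho.upper]
    have e13 : m 13 = m₀ 13 := h.frame 13 (by omega) (by omega)
    refine Exec.seq ((exec_inputLoop (s := s) (p := s.mem a) ?_ hb ho ?_ ?_ ?_ ?_).mono le_rfl ?_)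
    · simp only [effs_cons, effs_nil, eff]
      repeat' refine Rep.scratch ?_ hb.le (by omega) (by omega) _
      exact h
    · simp [eff, e2]
    · simp [eff]
    · simp [eff, e2, e12, e13]
    · simp [eff]
    · rintro m' o' ⟨rfl, h', h11⟩
      refine Exec.block (by simp [Plain, put, write]) (by simp [put, write]) ⟨rfl, ?_⟩
      have e2' : m' 2 = 0 := by rw [h'.frame 2 (by omega) (by omega), hb.zero]
      have := (sc (inp' (s.mem a)).toNat h' (r := 9) (by omega) (by omega)).put (inp := inp)
        (ω := ω) hb d
      simpa [eff, Instr.exec, e2', h11] using this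

theorem Rep.step {P C : Prog} {p : ℕ} (hP : Occurs P p (translate C p)) (hs : ¬ C.Halted s)
    (h : Rep B m₀ s m) (hb : Base B m₀) (ho : Offsets inp inp' n k B m₀) :
    ∃ T ≤ 10 * k + 15, ∃ m',
      (P.step inp ω)^[T] ⟨p + pos C s.pc, m, o⟩ =
        ⟨p + pos C (C.step inp' (fun c => ω (2 * c)) s).pc, m', o⟩ ∧
      Rep B m₀ (C.step inp' (fun c => ω (2 * c)) s) m' := by
  simp only [Prog.Halted, not_le] at hs
  obtain ⟨i, hi⟩ : ∃ i, C[s.pc]? = some i := ⟨_, List.getElem?_eq_getElem hs⟩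
  have hocc := occurs_transl hP hi
  have hstep : C.step inp' (fun c => ω (2 * c)) s = i.exec inp' (fun c => ω (2 * c)) s := by
    simp [Prog.step, hi]
  rw [hstep]
  by_cases hjz : ∃ a l, i = .jz a l
  · obtain ⟨a, l, rfl⟩ := hjz
    simp only [transl, block] at hocc
    rw [occurs_append] at hocc
    obtain ⟨T, hT, m', o', h1, rfl, rfl⟩ := Exec.block (inp := inp) (ω := ω)
      (l := fetch 9 a) (m := m) (o := o) (Q := fun m' o' => o' = o ∧ m' = effs inp ω (fetch 9 a) m)
      (by simp [Plain, fetch]) le_rfl ⟨rfl, rfl⟩ P _ hocc.1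
    simp only [fetch, List.length_cons, List.length_nil] at hT
    have h2 := hocc.2 0 (by simp)
    rw [effs_fetch h hb (by omega) (by omega)] at h1
    refine ⟨1 + T, by omega, _, ?_, (h.scratch hb.le (r := 9) (by omega) (by omega)
      (s.mem a)).setPc _⟩
    rw [Function.iterate_add_apply, h1, Function.iterate_one]
    change P.step inp ω ⟨p + pos C s.pc + (fetch 9 a).length + 0, _, _⟩ = _
    rw [step_eq h2]
    -- Whether or not the jump is taken, the host arrives at the translated position of the next
    -- instruction.
    simp only [Instr.exec, List.getElem_cons_zero, Function.update_self, Config.mk.injEq, and_true]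
    by_cases hz : s.mem a = 0
    · simp [hz]
    · simp [hz, pos_succ, hi, size, transl, block, fetch, add_assoc]
  · push Not at hjz
    obtain ⟨T, hT, m', o', h1, rfl, h2⟩ := exec_transl (o := o) (ω := ω)
      (fun l => p + pos C l) hjz h hb ho P _ hocc
    refine ⟨T, hT, m', ?_, h2⟩
    rw [h1, length_transl]
    have : (i.exec inp' (fun c => ω (2 * c)) s).pc = s.pc + 1 := by
      cases i <;> first | rfl | exact absurd rfl (hjz _ _)
    rw [this, pos_succ, hi]
    simp [add_assoc]

theorem Rep.iterate {P C : Prog} {p : ℕ} (hP : Occurs P p (translate C p)) (t : ℕ)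
    (ht : C.Halted ((C.step inp' fun c => ω (2 * c))^[t] s)) (h : Rep B m₀ s m) (hb : Base B m₀)
    (ho : Offsets inp inp' n k B m₀) :
    ∃ T ≤ t * (10 * k + 15), ∃ m',
      (P.step inp ω)^[T] ⟨p + pos C s.pc, m, o⟩ = ⟨p + pos C C.length, m', o⟩ ∧
      Rep B m₀ ((C.step inp' fun c => ω (2 * c))^[t] s) m' := by
  induction t generalizing s m with
  | zero => exact ⟨0, by simp, m, by rw [← pos_of_le ht]; rfl, h⟩
  | succ t ih =>
    rw [Function.iterate_succ_apply] at ht ⊢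
    -- A halted configuration costs the host no steps, so `t` need only be an upper bound.
    by_cases hs : C.Halted s
    · have : C.step inp' (fun c => ω (2 * c)) s = s := by
        have : C[s.pc]? = none := List.getElem?_eq_none hs
        simp [Prog.step, this]
      rw [this] at ht ⊢
      obtain ⟨T, hT, r⟩ := ih ht h
      exact ⟨T, hT.trans (Nat.mul_le_mul_right _ (by omega)), r⟩
    · obtain ⟨T, hT, m', h1, h2⟩ := h.step (o := o) (ω := ω) hP hs hb ho
      obtain ⟨T', hT', m'', h3, h4⟩ := ih ht h2
      refine ⟨T' + T, by rw [Nat.succ_mul]; omega, m'', ?_, h4⟩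
      rw [Function.iterate_add_apply, h1, h3]

/-- Run `C` on a fresh memory: its input is described by the array of offsets from address `[13]`
on, its output bit is delivered in cell `7`, and the memory in use ends below address `[5]`. -/
def simulate (C : Prog) : Code :=
  seq (block [.store 5 0, .add 8 5 3, .store 8 4, .add 6 8 3, .const 7 0])
    (seq (translate C) (block [.add 5 6 2]))

/-- Afterwards the base `[5]` is raised to the top `[6]` of the memory in use. The next simulation
thus finds fresh zeros above its base, and no memory ever has to be cleared. -/
theorem exec_simulate {C : Prog} {t : ℕ} (hb : Base B m) (ho : Offsets inp inp' n k B m)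
    (h4 : m 4 = k) (hm : ∀ a, B ≤ a → m a = 0)
    (ht : C.Halted ((C.step inp' fun c => ω (2 * c))^[t] (Prog.init n k))) :
    Exec inp ω (simulate C) (t * (10 * k + 15) + 6) m o fun m' o' => o' = o ∧
      (∀ a < B, a < 5 ∨ 12 ≤ a → m' a = m a) ∧ B ≤ m' 5 ∧ (∀ a, m' 5 ≤ a → m' a = 0) ∧
      m' 7 = ((((C.step inp' fun c => ω (2 * c))^[t]
        (Prog.init n k)).out.getLast?).getD false).toNat := by
  have := hb.le
  have := ho.le
  have := ho.upper
  have := ho.upper_le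
  refine Exec.le (T := 5 + (t * (10 * k + 15) + 1)) ?_ (by omega)
  refine Exec.seq (Exec.block (by simp [Plain]) (by simp) ?_)
  have hrep : Rep B m (Prog.init n k)
      (effs inp ω [.store 5 0, .add 8 5 3, .store 8 4, .add 6 8 3, .const 7 0] m) := by
    have e : effs inp ω [.store 5 0, .add 8 5 3, .store 8 4, .add 6 8 3, .const 7 0] m =
        Function.update (Function.update (Function.update (Function.update (Function.update m B n)
          8 (B + 1)) (B + 1) k) 6 (B + 2)) 7 0 := by
      have n3 : 3 ≠ B := by omega
      have n3' : 3 ≠ B + 1 := by omega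
      have n8' : 8 ≠ B + 1 := by omega
      have n4 : 4 ≠ B := by omega
      have n5 : 5 ≠ B := by omega
      simp [eff, hb.base, hb.one, ho.len, h4, Function.update_of_ne n3, Function.update_of_ne n4,
        Function.update_of_ne n5, Function.update_of_ne n3', Function.update_of_ne n8']
    rw [e]
    constructor
    · intro a ha ha'
      simp only [Function.update_apply]
      rw [if_neg (by omega), if_neg (by omega), if_neg (by omega), if_neg (by omega),
        if_neg (by omega)]
    · intro a
      simp only [Function.update_apply, Prog.init]
      rw [if_neg (by omega), if_neg (by omega)]
      by_cases h0 : a = 0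
      · subst h0
        rw [if_neg (by omega), if_neg (by omega), if_pos (by omega), if_pos rfl]
      · by_cases h1 : a = 1
        · subst h1; simp
        · rw [if_neg (by omega), if_neg (by omega), if_neg (by omega), if_neg h0, if_neg h1,
            hm _ (by omega)]
    · simp
    · intro a ha
      simp at ha
      simp only [Function.update_apply]
      rw [if_neg (by omega), if_neg (by omega), if_neg (by omega), if_neg (by omega),
        if_neg (by omega), hm _ (by omega)]
    · simp [Prog.init]
  refine Exec.seq (T' := 1) ?_
  intro P p hp
  obtain ⟨T, hT, m', h1, h2⟩ := hrep.iterate (o := o) hp t ht hb ho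
  refine ⟨T, hT, m', o, ?_, ?_⟩
  · rw [length_translate]
    simpa [Prog.init, pos] using h1
  · have e2 : m' 2 = 0 := by rw [h2.frame 2 (by omega) (by omega), hb.zero]
    refine Exec.block (by simp [Plain]) (by simp) ⟨rfl, ?_, ?_, ?_, ?_⟩
    · intro a ha ha'
      simp only [effs_cons, effs_nil, eff]
      rw [Function.update_of_ne (by omega), h2.frame a ha (by omega)]
    · simpa [eff, e2] using h2.le_top
    · intro a ha
      have := h2.le_top
      simp [eff, e2] at ha ⊢
      rw [Function.update_of_ne (by omega), h2.top a ha]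
    · simpa [eff] using h2.out

end Ram

/-! ### Queries -/

namespace Ram

/-- One round of the loop that reads a subset from the coin tosses: cell `15` holds the number of
rounds to come, `16` the address of the current bit of `z`, `17` the current offset, `18` and `19`
the two coin addresses, `20` the end of the array of offsets, `23` the number of rounds in which
address `18` is to be used, and `24` a parity. -/
def queryRound : Code :=
  seq (cond 23 (block [.coin 22 18, .sub 23 23 3]) (block [.coin 22 19]))
    (seq (cond 22 (seq (block [.store 20 17, .add 20 20 3, .load 22 16])
        (cond 22 (block [.sub 24 3 24]) (block []))) (block []))
      (block [.add 16 16 3, .add 17 17 0, .add 18 18 3, .add 18 18 3, .add 19 19 3, .add 19 19 3,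
        .sub 15 15 3]))

/-- Read a subset from the coin tosses; if it has the right size, run `C` on it. -/
def query (C : Prog) : Code :=
  seq (block [.add 15 1 2, .add 16 14 2, .const 17 0, .add 20 13 2, .add 23 29 2])
    (seq (loop 15 queryRound)
      (seq (block [.sub 22 12 20, .sub 21 20 12, .add 21 21 22])
        (cond 21 (block []) (seq (simulate C) (seq (block [.add 25 25 3])
          (cond 7 (block [.sub 24 3 24]) (block [])))))))

/-- The part of the memory that queries do not change: `z` is a string of length `M`. -/
structure Static (n k M : ℕ) (z : ℕ → Bool) (m : ℕ → ℕ) : Prop where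
  len : m 0 = n
  num : m 1 = M
  zero : m 2 = 0
  one : m 3 = 1
  half : m 4 = k
  upper : m 12 = 64 + M + k
  arr : m 13 = 64 + M
  vec : m 14 = 64
  le_base : 64 + M + M ≤ m 5
  free : ∀ a, m 5 ≤ a → m a = 0
  bits : ∀ i < M, m (64 + i) = (z i).toNat

variable {inp ω : ℕ → Bool} {n k M : ℕ} {z q : ℕ → Bool} {m m' : ℕ → ℕ} {o : List Bool}

theorem Static.congr (h : Static n k M z m) (h' : ∀ a, a < 6 ∨ (12 ≤ a ∧ a < 15) ∨
    (64 ≤ a ∧ a < 64 + M) ∨ m 5 ≤ a → m' a = m a) : Static n k M z m' where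
  len := (h' 0 (by omega)).trans h.len
  num := (h' 1 (by omega)).trans h.num
  zero := (h' 2 (by omega)).trans h.zero
  one := (h' 3 (by omega)).trans h.one
  half := (h' 4 (by omega)).trans h.half
  upper := (h' 12 (by omega)).trans h.upper
  arr := (h' 13 (by omega)).trans h.arr
  vec := (h' 14 (by omega)).trans h.vec
  le_base := by rw [h' 5 (by omega)]; exact h.le_base
  free a ha := by
    rw [h' 5 (by omega)] at ha
    exact (h' a (by omega)).trans (h.free a ha)
  bits i hi := (h' _ (by omega)).trans (h.bits i hi)

/-- The parity of the number of indices below `i` for which `f` is true. -/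
def xorSum (f : ℕ → Bool) : ℕ → Bool
  | 0 => false
  | i + 1 => xor (xorSum f i) (f i)

/-- The elements below `i` of a subset, in ascending order. -/
def members (q : ℕ → Bool) (i : ℕ) : List ℕ := (List.range i).filter q

theorem members_succ (q : ℕ → Bool) (i : ℕ) :
    members q (i + 1) = members q i ++ if q i then [i] else [] := by
  simp [members, List.range_succ, List.filter_append, List.filter_cons]

theorem length_members_le (q : ℕ → Bool) (i : ℕ) : (members q i).length ≤ i := by
  simpa [members] using List.length_filter_le q (List.range i)

/-- The input tape of a simulated machine that is run on the blocks of length `n` selected by `q`. -/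
def select (inp : ℕ → Bool) (n k M : ℕ) (q : ℕ → Bool) (p : ℕ) : Bool :=
  if p < n * k then inp (n * (members q M).getD (p / n) 0 + p % n) else false

theorem exec_readBit (h2 : m 2 = 0) (h3 : m 3 = 1) :
    Exec inp ω (cond 23 (block [.coin 22 18, .sub 23 23 3]) (block [.coin 22 19])) 4 m o
      fun m' o' => o' = o ∧ m' = Function.update (Function.update m 22
        (if 0 < m 23 then ω (m 18) else ω (m 19)).toNat) 23 (m 23 - 1) := by
  refine Exec.cond 23 (T := 2) (fun h => ?_) fun h => ?_
  · refine Exec.block (by simp [Plain]) (by simp) ⟨by simp [eff, h2], rfl, ?_⟩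
    simp [eff, h3, Nat.pos_of_ne_zero h]
  · refine Exec.block (by simp [Plain]) (by simp) ⟨rfl, ?_⟩
    funext a
    by_cases ha : a = 23
    · simp [eff, h, ha]
    · simp [eff, h, Function.update_of_ne ha]

/-- Used both for the bits of `z` at the selected positions and for the answer of the simulated
program. -/
theorem exec_flip {r : ℕ} {b p : Bool} (h2 : m 2 = 0) (h3 : m 3 = 1) (hr : m r = b.toNat)
    (h24 : m 24 = p.toNat) :
    Exec inp ω (cond r (block [.sub 24 3 24]) (block [])) 3 m o
      fun m' o' => o' = o ∧ m' = Function.update m 24 (xor p b).toNat := by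
  refine Exec.cond r (T := 1) (fun h => ?_) fun h => ?_
  · refine Exec.block (by simp [Plain]) (by simp) ⟨by simp [eff, h2], rfl, ?_⟩
    cases b
    · simp_all
    · cases p <;> simp [eff, h3, h24]
  · refine Exec.block (by simp) (by simp) ⟨rfl, ?_⟩
    cases b
    · simp [← h24]
    · simp_all

/-- The loop invariant: the first `i` bits of `q` have been read. -/
structure Reading (n k M : ℕ) (z q : ℕ → Bool) (c₁ c₂ l : ℕ) (p : Bool) (m₀ : ℕ → ℕ) (i : ℕ)
    (m : ℕ → ℕ) : Prop where
  static : Static n k M z m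
  frame : ∀ a < 64, 25 ≤ a → m a = m₀ a
  round : m 15 = M - i
  bit : m 16 = 64 + i
  offset : m 17 = n * i
  fst : m 18 = c₁ + 2 * i
  snd : m 19 = c₂ + 2 * i
  switch : m 23 = l - i
  parity : m 24 = (xor p (xorSum (fun i => q i && z i) i)).toNat
  upper : m 20 = 64 + M + (members q i).length
  entry : ∀ j v, (members q i)[j]? = some v → m (64 + M + j) = n * v

/-- Both coin addresses advance in every round, whichever of them is read. So bit `i` depends on
toss number `i` of one of two sequences, and two subsets can share their bits from level `l` on. The
step is 2 because the own tosses have odd addresses. -/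
theorem exec_queryRound {c₁ c₂ l i : ℕ} {p : Bool} {m₀ : ℕ → ℕ}
    (hq : ∀ i, q i = if i < l then ω (c₁ + 2 * i) else ω (c₂ + 2 * i)) (hi : i < M)
    (h : Reading n k M z q c₁ c₂ l p m₀ i m) :
    Exec inp ω queryRound 21 m o fun m' o' =>
      o' = o ∧ Reading n k M z q c₁ c₂ l p m₀ (i + 1) m' := by
  have hs := h.static
  have hlen := length_members_le q i
  have hb := hs.le_base
  refine Exec.seq (T := 4) (T' := 17) ((exec_readBit hs.zero hs.one).mono le_rfl ?_)
  rintro m₁ o₁ ⟨rfl, hm₁⟩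
  have hbit : (if 0 < m 23 then ω (m 18) else ω (m 19)) = q i := by
    rw [h.switch, h.fst, h.snd, hq]
    simp
  rw [hbit] at hm₁
  refine Exec.seq (T := 10) (T' := 7) (Exec.mono (T := 10)
    (Q := fun m₂ o₂ => o₂ = o₁ ∧ (∀ a, a < 6 ∨ (12 ≤ a ∧ a < 20) ∨ (25 ≤ a ∧ a < 64 + M) ∨
      m 5 ≤ a → m₂ a = m a) ∧ m₂ 23 = l - (i + 1) ∧
      m₂ 24 = (xor p (xorSum (fun i => q i && z i) (i + 1))).toNat ∧
      m₂ 20 = 64 + M + (members q (i + 1)).length ∧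
      ∀ j v, (members q (i + 1))[j]? = some v → m₂ (64 + M + j) = n * v) ?_ le_rfl ?_)
  · refine Exec.cond 22 (T := 8) (fun h1 => ?_) fun h1 => ?_
    · have hqi : q i = true := by
        cases hc : q i
        · simp [hm₁, hc] at h1
        · rfl
      refine Exec.seq (T := 3) (T' := 5) (Exec.block (by simp [Plain]) (by simp) ?_)
      -- The array of offsets lies above the registers and above `z`, so an entry can be appended
      -- without disturbing them.
      have n22 : 64 + M + (members q i).length ≠ 22 := by omega
      have n23 : 64 + M + (members q i).length ≠ 23 := by omega
      have hz : m (64 + i) = (z i).toNat := hs.bits i hi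
      set m₂ := effs inp ω [Instr.store 20 17, Instr.add 20 20 3, Instr.load 22 16] m₁ with hm₂
      have e : m₂ = Function.update (Function.update (Function.update m₁
          (64 + M + (members q i).length) (n * i)) 20 (64 + M + (members q i).length + 1)) 22
          (z i).toNat := by
        have n3 : 3 ≠ 64 + M + (members q i).length := by omega
        have n16 : 16 ≠ 64 + M + (members q i).length := by omega
        have n20 : 20 ≠ 64 + M + (members q i).length := by omega
        have n20' : 64 + i ≠ 20 := by omega
        have n22' : 64 + i ≠ 22 := by omega
        have n23' : 64 + i ≠ 23 := by omega
        have n24 : 64 + i ≠ 64 + M + (members q i).length := by omega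
        simp [hm₂, eff, hm₁, h.upper, h.offset, h.bit, hs.one, Function.update_of_ne n3,
          Function.update_of_ne n16, Function.update_of_ne n20, Function.update_of_ne n20',
          Function.update_of_ne n22', Function.update_of_ne n23', Function.update_of_ne n24, hz]
      refine (exec_flip (b := z i) (p := xor p (xorSum (fun i => q i && z i) i)) ?_ ?_ ?_ ?_).mono
        (by omega) ?_
      · have n2 : 2 ≠ 64 + M + (members q i).length := by omega
        simp [e, hm₁, Function.update_of_ne n2, hs.zero]
      · have n3 : 3 ≠ 64 + M + (members q i).length := by omega
        simp [e, hm₁, Function.update_of_ne n3, hs.one]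
      · simp [e]
      · have n24 : 24 ≠ 64 + M + (members q i).length := by omega
        simp [e, hm₁, Function.update_of_ne n24, h.parity]
      · rintro m₃ o₃ ⟨rfl, rfl⟩
        have fr : ∀ a, a < 6 ∨ (12 ≤ a ∧ a < 20) ∨ (25 ≤ a ∧ a < 64 + M + (members q i).length) ∨
            m 5 ≤ a → (Function.update m₂ 24 (xor (xor p (xorSum (fun i => q i && z i) i))
              (z i)).toNat) a = m a := by
          intro a ha
          rw [e, hm₁]
          repeat rw [Function.update_of_ne (by omega)]
        refine ⟨?_, rfl, fun a ha => fr a (by omega), ?_, ?_, ?_, ?_⟩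
        · rw [fr 2 (by omega), hs.zero]
        · have n23 : 23 ≠ 64 + M + (members q i).length := by omega
          simp [e, hm₁, Function.update_of_ne n23, h.switch]
          omega
        · simp [xorSum, hqi]
        · simp [e, members_succ, hqi]
          omega
        · intro j v hjv
          rw [members_succ, if_pos hqi] at hjv
          by_cases hj : j < (members q i).length
          · rw [List.getElem?_append_left hj] at hjv
            rw [fr _ (by omega), h.entry j v hjv]
          · rw [List.getElem?_append_right (by omega), List.getElem?_singleton] at hjv
            split_ifs at hjv with hj'
            obtain rfl : j = (members q i).length := by omega
            obtain rfl : i = v := by simpa using hjv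
            rw [e]
            repeat rw [Function.update_of_ne (by omega)]
            rw [Function.update_self]
    · have hqi : q i = false := by
        cases hc : q i
        · rfl
        · simp [hm₁, hc] at h1
      refine Exec.block (by simp) (by simp) ⟨rfl, ?_, ?_, ?_, ?_, ?_⟩
      · intro a ha
        rw [effs_nil, hm₁]
        repeat rw [Function.update_of_ne (by omega)]
      · simp [hm₁, h.switch]
        omega
      · simp [hm₁, xorSum, hqi, h.parity]
      · simp [hm₁, members_succ, hqi, h.upper]
      · intro j v hjv
        rw [members_succ, hqi] at hjv
        simp at hjv
        rw [effs_nil, hm₁]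
        repeat rw [Function.update_of_ne (by omega)]
        exact h.entry j v hjv
  · rintro m₂ o₂ ⟨rfl, fr, h23, h24, h20, hent⟩
    have e0 : m₂ 0 = n := (fr 0 (by omega)).trans hs.len
    have e3 : m₂ 3 = 1 := (fr 3 (by omega)).trans hs.one
    have e15 := (fr 15 (by omega)).trans h.round
    have e16 := (fr 16 (by omega)).trans h.bit
    have e17 := (fr 17 (by omega)).trans h.offset
    have e18 := (fr 18 (by omega)).trans h.fst
    have e19 := (fr 19 (by omega)).trans h.snd
    refine Exec.block (by simp [Plain]) (by simp) ⟨rfl, ?_⟩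
    have fr' : ∀ a, a < 15 ∨ 20 ≤ a → effs inp ω [Instr.add 16 16 3, Instr.add 17 17 0,
        Instr.add 18 18 3, Instr.add 18 18 3, Instr.add 19 19 3, Instr.add 19 19 3,
        Instr.sub 15 15 3] m₂ a = m₂ a := by
      intro a ha
      simp only [effs_cons, effs_nil, eff]
      repeat rw [Function.update_of_ne (by omega : a ≠ _)]
    constructor
    · exact hs.congr fun a ha => (fr' a (by omega)).trans (fr a (by omega))
    · intro a ha ha'
      rw [fr' a (by omega), fr a (by omega), h.frame a ha ha']
    · simp [eff, e3, e15]; omega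
    · simp [eff, e3, e16]; omega
    · simp [eff, e0, e17]; ring
    · simp [eff, e3, e18]; ring
    · simp [eff, e3, e19]; ring
    · rw [fr' _ (by omega), h23]
    · rw [fr' _ (by omega), h24]
    · rw [fr' _ (by omega), h20]
    · intro j v hjv
      rw [fr' _ (by omega), hent j v hjv]

end Ram

/-! ### Estimates -/

namespace Ram

/-- Draw two subsets that agree from level `[29]` on, and compare the two answers with `z`: count
the agreements in cell `26` and the disagreements in cell `27`. -/
def sample (C : Prog) : Code :=
  seq (block [.const 24 0, .const 25 0, .add 18 30 2, .add 19 30 2])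
    (seq (query C) (seq (block [.add 18 30 1, .add 18 18 1, .add 19 30 2])
      (seq (query C) (seq (block [.add 30 30 1, .add 30 30 1, .add 30 30 1, .add 30 30 1,
          .sub 21 25 3])
        (cond 21 (cond 24 (block [.add 27 27 3]) (block [.add 26 26 3])) (block []))))))

/-- Estimate the weight of a prefix of `z` by the mean of `[31]` samples. -/
def estimate (C : Prog) : Code :=
  seq (block [.const 26 0, .const 27 0, .add 28 31 2])
    (seq (loop 28 (seq (sample C) (block [.sub 28 28 3]))) (block [.sub 33 26 27]))

/-- The bit that `C` returns on the selected blocks. -/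
def answer (C : Prog) (t : ℕ) (inp ω : ℕ → Bool) (n k M : ℕ) (q : ℕ → Bool) : Bool :=
  ((C.step (select inp n k M q) fun c => ω (2 * c))^[t] (Prog.init n k)).out.getLast?.getD false

/-- The correlation of the answer for `q` with the parity given by `z`. -/
def corr (C : Prog) (t : ℕ) (inp ω : ℕ → Bool) (n k M : ℕ) (z q : ℕ → Bool) : ℤ :=
  if (members q M).length = k then
    if xor (xorSum (fun i => q i && z i) M) (answer C t inp ω n k M q) then -1 else 1
  else 0

/-- The `c`-th own coin toss. -/
def own (ω : ℕ → Bool) (c : ℕ) : Bool := ω (2 * c + 1)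

/-- The value of a sample at level `l` that uses the own coin tosses from number `c` on. -/
def sampleVal (C : Prog) (t : ℕ) (inp ω : ℕ → Bool) (n k M l : ℕ) (z : ℕ → Bool) (c : ℕ) : ℤ :=
  corr C t inp ω n k M z (fun i => own ω (c + i)) *
    corr C t inp ω n k M z fun i => if i < l then own ω (c + M + i) else own ω (c + i)

/-- The estimate at level `l` from `N` samples. -/
def est (C : Prog) (t : ℕ) (inp ω : ℕ → Bool) (n k M N l : ℕ) (z : ℕ → Bool) (c : ℕ) : ℕ :=
  (∑ j ∈ Finset.range N, sampleVal C t inp ω n k M l z (c + 2 * M * j)).toNat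

/-! ### Samples depend only on a prefix of the string -/

theorem xorSum_xor (f g : ℕ → Bool) (i : ℕ) :
    xor (xorSum f i) (xorSum g i) = xorSum (fun i => xor (f i) (g i)) i := by
  induction i with
  | zero => rfl
  | succ i ih =>
    simp only [xorSum, ← ih]
    generalize xorSum f i = a, xorSum g i = b, f i = a', g i = b'
    revert a b a' b'
    decide

/-- The two subsets agree from `l` on, so the bits of `z` from there on enter both parities in the
same way and cancel in the product. -/
theorem sampleVal_congr {C : Prog} {t : ℕ} {inp ω : ℕ → Bool} {n k M l : ℕ} {z z' : ℕ → Bool}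
    (h : ∀ i < l, z i = z' i) (c : ℕ) :
    sampleVal C t inp ω n k M l z c = sampleVal C t inp ω n k M l z' c := by
  have key : ∀ q q' : ℕ → Bool, (∀ i, l ≤ i → q i = q' i) →
      corr C t inp ω n k M z q * corr C t inp ω n k M z q' =
        corr C t inp ω n k M z' q * corr C t inp ω n k M z' q' := by
    intro q q' hq
    have hx : xor (xorSum (fun i => q i && z i) M) (xorSum (fun i => q' i && z i) M) =
        xor (xorSum (fun i => q i && z' i) M) (xorSum (fun i => q' i && z' i) M) := by
      rw [xorSum_xor, xorSum_xor]
      congr 1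
      funext i
      by_cases hi : i < l
      · rw [h i hi]
      · rw [hq i (by omega)]
        simp
    unfold corr
    revert hx
    generalize xorSum (fun i => q i && z i) M = a, xorSum (fun i => q' i && z i) M = b,
      xorSum (fun i => q i && z' i) M = a', xorSum (fun i => q' i && z' i) M = b',
      answer C t inp ω n k M q = d, answer C t inp ω n k M q' = d'
    split_ifs <;> revert a b a' b' d d' <;> decide
  exact key _ _ fun i hi => by simp [not_lt.2 hi]

theorem est_congr {C : Prog} {t : ℕ} {inp ω : ℕ → Bool} {n k M N l : ℕ} {z z' : ℕ → Bool}
    (h : ∀ i < l, z i = z' i) (c : ℕ) :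
    est C t inp ω n k M N l z c = est C t inp ω n k M N l z' c := by
  simp only [est, sampleVal_congr h]

variable {C : Prog} {t : ℕ} {inp ω : ℕ → Bool} {n k M : ℕ} {z q : ℕ → Bool} {m m' : ℕ → ℕ}
  {o : List Bool}

theorem select_mul_add {i p : ℕ} (hi : i < k) (hp : p < n) :
    select inp n k M q (n * i + p) = inp (n * (members q M).getD i 0 + p) := by
  have hn : 0 < n := by omega
  have : n * i + p < n * k := by
    calc n * i + p < n * (i + 1) := by rw [Nat.mul_succ]; omega
      _ ≤ n * k := Nat.mul_le_mul_left _ hi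
  rw [select, if_pos this, Nat.mul_add_div hn, Nat.div_eq_of_lt hp, Nat.mul_add_mod,
    Nat.mod_eq_of_lt hp, add_zero]

/-- A subset of the wrong size does not lead to a run of `C`. The resulting parity can be left open
in that case, as the count in cell `25` makes the sample void. -/
theorem exec_query {c₁ c₂ : ℕ} {p : Bool} (hkM : k ≤ M)
    (hC : ∀ q, (members q M).length = k →
      C.Halted ((C.step (select inp n k M q) fun c => ω (2 * c))^[t] (Prog.init n k)))
    (hs : Static n k M z m)
    (hq : ∀ i, q i = if i < m 29 then ω (c₁ + 2 * i) else ω (c₂ + 2 * i))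
    (h18 : m 18 = c₁) (h19 : m 19 = c₂) (h24 : m 24 = p.toNat) :
    Exec inp ω (query C) (t * (10 * k + 15) + 23 * M + 21) m o fun m' o' =>
      o' = o ∧ Static n k M z m' ∧ (∀ a < 64, 26 ≤ a → m' a = m a) ∧
      m' 25 = (if (members q M).length = k then m 25 + 1 else m 25) ∧
      ∃ p' : Bool, m' 24 = p'.toNat ∧ ((members q M).length = k →
        p' = xor p (xor (xorSum (fun i => q i && z i) M) (answer C t inp ω n k M q))) := by
  have hb := hs.le_base
  obtain ⟨T, hT⟩ : ∃ T, T = t * (10 * k + 15) + 6 := ⟨_, rfl⟩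
  refine Exec.le (T := 5 + ((M * (21 + 2) + 1) + (3 + (T + (1 + 3) + 2)))) ?_ (by omega)
  refine Exec.seq (Exec.block (by simp [Plain]) (by simp) ?_)
  set m₁ := effs inp ω [.add 15 1 2, .add 16 14 2, .const 17 0, .add 20 13 2, .add 23 29 2] m
    with hm₁
  have fr₁ : ∀ a, a < 15 ∨ a = 18 ∨ a = 19 ∨ 24 ≤ a → m₁ a = m a := by
    intro a ha
    simp only [hm₁, effs_cons, effs_nil, eff]
    repeat rw [Function.update_of_ne (by omega : a ≠ _)]
  have hr₁ : Reading n k M z q c₁ c₂ (m 29) p m 0 m₁ := by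
    constructor
    · exact hs.congr fun a ha => fr₁ a (by omega)
    · exact fun a _ ha' => fr₁ a (by omega)
    · simp [hm₁, eff, hs.num, hs.zero]
    · simp [hm₁, eff, hs.vec, hs.zero]
    · simp [hm₁, eff]
    · rw [fr₁ _ (by omega), h18]; simp
    · rw [fr₁ _ (by omega), h19]; simp
    · simp [hm₁, eff, hs.zero]
    · rw [fr₁ _ (by omega), h24]; simp [xorSum]
    · simp [hm₁, eff, hs.arr, hs.zero, members]
    · simp [members]
  refine Exec.seq ((Exec.loop (T := 21) 15 (fun j m' o' => o' = o ∧ j ≤ M ∧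
    Reading n k M z q c₁ c₂ (m 29) p m (M - j) m') (Q := fun m' o' => o' = o ∧
      Reading n k M z q c₁ c₂ (m 29) p m M m') ?_ ?_ M
      ⟨rfl, le_rfl, by simpa using hr₁⟩).mono le_rfl ?_)
  · rintro j m' o' ⟨rfl, hj, hr⟩
    refine ⟨by rw [hr.round]; omega, (exec_queryRound hq (by omega) hr).mono le_rfl ?_⟩
    rintro m'' o'' ⟨rfl, hr'⟩
    rw [show M - (j + 1) + 1 = M - j by omega] at hr'
    exact ⟨hr'.static.zero, rfl, by omega, hr'⟩
  · rintro m' o' ⟨rfl, -, hr⟩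
    exact ⟨by rw [hr.round]; omega, rfl, hr⟩
  rintro m₂ o₂ ⟨rfl, hr⟩
  have hs₂ := hr.static
  have hb₂ := hs₂.le_base
  refine Exec.seq (Exec.block (by simp [Plain]) (by simp) ?_)
  set m₃ := effs inp ω [.sub 22 12 20, .sub 21 20 12, .add 21 21 22] m₂ with hm₃
  have fr₃ : ∀ a, a < 21 ∨ 23 ≤ a → m₃ a = m₂ a := by
    intro a ha
    simp only [hm₃, effs_cons, effs_nil, eff]
    repeat rw [Function.update_of_ne (by omega : a ≠ _)]
  -- The sum of both truncated differences is the distance of `[20]` from `[12]`; it vanishes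
  -- exactly if the array has `k` entries.
  have h21 : m₃ 21 = 0 ↔ (members q M).length = k := by
    simp [hm₃, eff, hs₂.upper, hr.upper]
    omega
  have hs₃ : Static n k M z m₃ := hs₂.congr fun a ha => fr₃ a (by omega)
  have hb₃ := hs₃.le_base
  refine Exec.cond 21 (T := T + (1 + 3)) (fun h => ?_) fun h => ?_
  · rw [Ne, h21] at h
    refine Exec.block (by simp) (by simp) ?_
    rw [effs_nil]
    refine ⟨hs₃.zero, rfl, hs₃, fun a ha ha' => ?_, ?_,
      xor p (xorSum (fun i => q i && z i) M), ?_, fun h' => absurd h' h⟩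
    · rw [fr₃ a (by omega), hr.frame a ha (by omega)]
    · rw [fr₃ _ (by omega), hr.frame 25 (by omega) (by omega), if_neg h]
    · rw [fr₃ _ (by omega), hr.parity]
  · rw [h21] at h
    have hbase : Base (m₃ 5) m₃ := ⟨by omega, hs₃.zero, hs₃.one, rfl⟩
    -- The array written by the loop describes the tape of the selected blocks.
    let ho : Offsets inp (select inp n k M q) n k (m₃ 5) m₃ :=
      { off := fun i => n * (members q M).getD i 0
        le := by rw [hs₃.arr]; omega
        upper := by rw [hs₃.upper, hs₃.arr]
        upper_le := by rw [hs₃.upper]; omega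
        arr := by
          intro i hi
          rw [hs₃.arr, fr₃ _ (by omega)]
          refine hr.entry i _ ?_
          simp [List.getD, h, hi]
        len := hs₃.len
        input := fun i hi p hp => select_mul_add hi hp
        input_of_le := fun p hp => by rw [select, if_neg (by omega)] }
    refine Exec.seq (T := T) (T' := 1 + 3)
      ((exec_simulate hbase ho hs₃.half hs₃.free (hC q h)).mono hT.ge ?_)
    rintro m₄ o₄ ⟨rfl, fr₄, hle₄, hfree₄, h7⟩
    have hs₄ : Static n k M z m₄ :=
      { len := (fr₄ 0 (by omega) (by omega)).trans hs₃.len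
        num := (fr₄ 1 (by omega) (by omega)).trans hs₃.num
        zero := (fr₄ 2 (by omega) (by omega)).trans hs₃.zero
        one := (fr₄ 3 (by omega) (by omega)).trans hs₃.one
        half := (fr₄ 4 (by omega) (by omega)).trans hs₃.half
        upper := (fr₄ 12 (by omega) (by omega)).trans hs₃.upper
        arr := (fr₄ 13 (by omega) (by omega)).trans hs₃.arr
        vec := (fr₄ 14 (by omega) (by omega)).trans hs₃.vec
        le_base := by omega
        free := hfree₄
        bits := fun i hi => (fr₄ _ (by omega) (by omega)).trans (hs₃.bits i hi) }
    refine Exec.seq (Exec.block (by simp [Plain]) (by simp) ?_)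
    refine (exec_flip (b := answer C t inp ω n k M q)
      (p := xor p (xorSum (fun i => q i && z i) M)) ?_ ?_ ?_ ?_).mono le_rfl ?_
    · simp [eff, hs₄.zero]
    · simp [eff, hs₄.one]
    · simp [eff, h7, answer]
    · simp [eff, fr₄ 24 (by omega) (by omega), fr₃ 24 (by omega), hr.parity]
    · rintro m₅ o₅ ⟨rfl, rfl⟩
      refine ⟨rfl, ?_, ?_, ?_, ?_⟩
      · refine hs₄.congr fun a ha => ?_
        simp only [effs_cons, effs_nil, eff]
        have := hs₄.le_base
        repeat rw [Function.update_of_ne (by omega : a ≠ _)]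
      · intro a ha ha'
        simp only [effs_cons, effs_nil, eff]
        repeat rw [Function.update_of_ne (by omega : a ≠ _)]
        rw [fr₄ a (by omega) (by omega), fr₃ a (by omega), hr.frame a ha (by omega)]
      · simp [eff, h, hs₄.one, fr₄ 25 (by omega) (by omega), fr₃ 25 (by omega),
          hr.frame 25 (by omega) (by omega)]
      · refine ⟨_, Function.update_self .., fun _ => by simp⟩

/-- Cell `24` is not reset between the two queries. It ends with the parity that gives the sign of
the product of the two correlations, and one test of it decides which counter to increase. -/
theorem exec_sample {c : ℕ} (hkM : k ≤ M)
    (hC : ∀ q, (members q M).length = k →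
      C.Halted ((C.step (select inp n k M q) fun c => ω (2 * c))^[t] (Prog.init n k)))
    (hs : Static n k M z m) (h30 : m 30 = 2 * c + 1) :
    Exec inp ω (sample C) (2 * (t * (10 * k + 15) + 23 * M + 21) + 17) m o fun m' o' =>
      o' = o ∧ Static n k M z m' ∧ (∀ a < 64, (31 ≤ a ∨ a = 28 ∨ a = 29) → m' a = m a) ∧
      m' 30 = 2 * (c + 2 * M) + 1 ∧
      (m' 26 : ℤ) - m' 27 = m 26 - m 27 + sampleVal C t inp ω n k M (m 29) z c := by
  have hb := hs.le_base
  set q₁ : ℕ → Bool := fun i => own ω (c + i) with hq₁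
  set q₂ : ℕ → Bool := fun i => if i < m 29 then own ω (c + M + i) else own ω (c + i) with hq₂
  set Tq := t * (10 * k + 15) + 23 * M + 21 with hTq
  refine Exec.le (T := 4 + (Tq + (3 + (Tq + (5 + 5))))) ?_ (by omega)
  refine Exec.seq (Exec.block (by simp [Plain]) (by simp) ?_)
  set m₁ := effs inp ω [.const 24 0, .const 25 0, .add 18 30 2, .add 19 30 2] m with hm₁
  have fr₁ : ∀ a, a < 18 ∨ 26 ≤ a → m₁ a = m a := by
    intro a ha
    simp only [hm₁, effs_cons, effs_nil, eff]
    repeat rw [Function.update_of_ne (by omega : a ≠ _)]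
  have hs₁ : Static n k M z m₁ := hs.congr fun a ha => fr₁ a (by omega)
  refine Exec.seq ((exec_query (q := q₁) (c₁ := 2 * c + 1) (c₂ := 2 * c + 1) (p := false) hkM hC hs₁
    ?_ ?_ ?_ ?_).mono le_rfl ?_)
  · intro i
    rw [ite_self]
    simp only [hq₁, own]
    congr 1
    ring
  · simp [hm₁, eff, h30, hs.zero]
  · simp [hm₁, eff, h30, hs.zero]
  · simp [hm₁, eff]
  rintro m₂ o₂ ⟨rfl, hs₂, fr₂, h25₂, h24₂⟩
  refine Exec.seq (Exec.block (by simp [Plain]) (by simp) ?_)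
  set m₃ := effs inp ω [.add 18 30 1, .add 18 18 1, .add 19 30 2] m₂ with hm₃
  have fr₃ : ∀ a, a < 18 ∨ 20 ≤ a → m₃ a = m₂ a := by
    intro a ha
    simp only [hm₃, effs_cons, effs_nil, eff]
    repeat rw [Function.update_of_ne (by omega : a ≠ _)]
  have hs₃ : Static n k M z m₃ := hs₂.congr fun a ha => fr₃ a (by have := hs₂.le_base; omega)
  have fr₁₃ : ∀ a < 64, 26 ≤ a → m₃ a = m a := fun a ha ha' => by
    rw [fr₃ a (by omega), fr₂ a ha ha', fr₁ a (by omega)]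
  have h30₂ : m₂ 30 = 2 * c + 1 := by
    rw [fr₂ 30 (by omega) (by omega), fr₁ 30 (by omega), h30]
  obtain ⟨p₂, hp₂⟩ := h24₂
  refine Exec.seq ((exec_query (q := q₂) (c₁ := 2 * (c + M) + 1) (c₂ := 2 * c + 1) (p := p₂)
    hkM hC hs₃ ?_ ?_ ?_ ?_).mono le_rfl ?_)
  · intro i
    rw [fr₁₃ 29 (by omega) (by omega)]
    simp only [hq₂, own]
    congr 2 <;> ring
  · simp [hm₃, eff, h30₂, hs₂.num]
    ring
  · simp [hm₃, eff, h30₂, hs₂.zero]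
  · rw [fr₃ _ (by omega), hp₂.1]
  rintro m₄ o₄ ⟨rfl, hs₄, fr₄, h25₄, p₄, h24₄, hp₄⟩
  refine Exec.seq (Exec.block (by simp [Plain]) (by simp) ?_)
  -- A sample uses `2 * M` own tosses. They occupy every other address, which accounts for the four
  -- additions of `M`.
  set m₅ := effs inp ω [.add 30 30 1, .add 30 30 1, .add 30 30 1, .add 30 30 1, .sub 21 25 3] m₄
    with hm₅
  have fr₅ : ∀ a, a ≠ 30 → a ≠ 21 → m₅ a = m₄ a := by
    intro a ha ha'
    simp only [hm₅, effs_cons, effs_nil, eff]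
    repeat rw [Function.update_of_ne (by omega : a ≠ _)]
  have hs₅ : Static n k M z m₅ := hs₄.congr fun a ha =>
    fr₅ a (by have := hs₄.le_base; omega) (by have := hs₄.le_base; omega)
  have fr₁₅ : ∀ a < 64, 26 ≤ a → a ≠ 30 → m₅ a = m a := fun a ha ha' h30 => by
    rw [fr₅ a h30 (by omega), fr₄ a ha ha', fr₁₃ a ha ha']
  have h30₅ : m₅ 30 = 2 * (c + 2 * M) + 1 := by
    simp [hm₅, eff, fr₄ 30 (by omega) (by omega), fr₁₃ 30 (by omega) (by omega), h30, hs₄.num]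
    ring
  have h25₁ : m₁ 25 = 0 := by simp [hm₁, eff]
  have h25₅ : m₄ 25 = (if (members q₁ M).length = k then 1 else 0) +
      if (members q₂ M).length = k then 1 else 0 := by
    rw [h25₄, fr₃ 25 (by omega), h25₂, h25₁]
    split_ifs <;> rfl
  -- This is nonzero exactly if both subsets had size `k`; otherwise the value of the sample is
  -- zero.
  have h21 : m₅ 21 = m₄ 25 - 1 := by simp [hm₅, eff, hs₄.one]
  have hval : sampleVal C t inp ω n k M (m 29) z c =
      corr C t inp ω n k M z q₁ * corr C t inp ω n k M z q₂ := rfl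
  have h26 := fr₁₅ 26 (by omega) (by omega) (by omega)
  have h27 := fr₁₅ 27 (by omega) (by omega) (by omega)
  have h24₅ := fr₅ 24 (by omega) (by omega)
  have upd : ∀ r v, 26 ≤ r → r < 28 → Static n k M z (Function.update m₅ r v) ∧
      (∀ a < 64, (31 ≤ a ∨ a = 28 ∨ a = 29) → Function.update m₅ r v a = m a) ∧
      Function.update m₅ r v 30 = 2 * (c + 2 * M) + 1 := by
    intro r v hr hr'
    refine ⟨hs₅.congr fun a ha => ?_, fun a ha ha' => ?_, ?_⟩
    · have := hs₅.le_base
      rw [Function.update_of_ne (by omega)]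
    · rw [Function.update_of_ne (by omega), fr₁₅ a ha (by omega) (by omega)]
    · rw [Function.update_of_ne (by omega), h30₅]
  refine Exec.cond 21 (T := 3) (fun h => ?_) fun h => ?_
  · rw [h21, h25₅] at h
    have hh : (members q₁ M).length = k ∧ (members q₂ M).length = k := by
      by_contra hc
      apply h
      split_ifs <;> simp_all
    have h24 := h24₅.trans h24₄
    rw [hp₄ hh.2, hp₂.2 hh.1] at h24
    refine Exec.cond 24 (T := 1) (fun h' => ?_) fun h' => ?_
    · refine Exec.block (by simp [Plain]) (by simp) ?_
      simp only [effs_cons, effs_nil, eff]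
      obtain ⟨u1, u2, u3⟩ := upd 27 (m₅ 27 + m₅ 3) (by omega) (by omega)
      refine ⟨u1.zero, u1.zero, trivial, u1, u2, u3, ?_⟩
      rw [hval, corr, corr, if_pos hh.1, if_pos hh.2]
      rw [h24] at h'
      have : ((if (xorSum (fun i => q₁ i && z i) M ^^ answer C t inp ω n k M q₁) = true then -1
          else 1) * if (xorSum (fun i => q₂ i && z i) M ^^ answer C t inp ω n k M q₂) = true
            then -1 else 1 : ℤ) = -1 := by
        revert h'
        generalize (xorSum (fun i => q₁ i && z i) M ^^ answer C t inp ω n k M q₁) = a,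
          (xorSum (fun i => q₂ i && z i) M ^^ answer C t inp ω n k M q₂) = b
        cases a <;> cases b <;> simp
      rw [this]
      simp [hs₅.one, h26, h27]
      ring
    · refine Exec.block (by simp [Plain]) (by simp) ?_
      simp only [effs_cons, effs_nil, eff]
      obtain ⟨u1, u2, u3⟩ := upd 26 (m₅ 26 + m₅ 3) (by omega) (by omega)
      refine ⟨u1.zero, trivial, u1, u2, u3, ?_⟩
      rw [hval, corr, corr, if_pos hh.1, if_pos hh.2]
      rw [h24] at h'
      have : ((if (xorSum (fun i => q₁ i && z i) M ^^ answer C t inp ω n k M q₁) = true then -1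
          else 1) * if (xorSum (fun i => q₂ i && z i) M ^^ answer C t inp ω n k M q₂) = true
            then -1 else 1 : ℤ) = 1 := by
        revert h'
        generalize (xorSum (fun i => q₁ i && z i) M ^^ answer C t inp ω n k M q₁) = a,
          (xorSum (fun i => q₂ i && z i) M ^^ answer C t inp ω n k M q₂) = b
        cases a <;> cases b <;> simp
      rw [this]
      simp [hs₅.one, h26, h27]
      ring
  · refine Exec.block (by simp) (by simp) ⟨rfl, hs₅, fun a ha ha' =>
      fr₁₅ a ha (by omega) (by omega), h30₅, ?_⟩
    rw [effs_nil, h26, h27, hval, corr, corr]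
    rw [h21, h25₅] at h
    split_ifs at h ⊢ <;> simp_all

theorem exec_estimate {c N : ℕ} (hkM : k ≤ M)
    (hC : ∀ q, (members q M).length = k →
      C.Halted ((C.step (select inp n k M q) fun c => ω (2 * c))^[t] (Prog.init n k)))
    (hs : Static n k M z m) (h30 : m 30 = 2 * c + 1) (h31 : m 31 = N) :
    Exec inp ω (estimate C) (N * (2 * (t * (10 * k + 15) + 23 * M + 21) + 20) + 5) m o
      fun m' o' => o' = o ∧ Static n k M z m' ∧
        (∀ a < 64, (34 ≤ a ∨ a = 29 ∨ a = 31 ∨ a = 32) → m' a = m a) ∧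
        m' 30 = 2 * (c + 2 * M * N) + 1 ∧ m' 33 = est C t inp ω n k M N (m 29) z c := by
  have hb := hs.le_base
  set Ts := 2 * (t * (10 * k + 15) + 23 * M + 21) + 17 with hTs
  refine Exec.le (T := 3 + ((N * (Ts + 1 + 2) + 1) + 1)) ?_ (by rw [hTs]; ring_nf; omega)
  refine Exec.seq (Exec.block (by simp [Plain]) (by simp) ?_)
  set m₁ := effs inp ω [.const 26 0, .const 27 0, .add 28 31 2] m with hm₁
  have fr₁ : ∀ a, a < 26 ∨ 29 ≤ a → m₁ a = m a := by
    intro a ha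
    simp only [hm₁, effs_cons, effs_nil, eff]
    repeat rw [Function.update_of_ne (by omega : a ≠ _)]
  have hs₁ : Static n k M z m₁ := hs.congr fun a ha => fr₁ a (by omega)
  set S : ℕ → ℤ := fun i => ∑ j ∈ Finset.range i,
    sampleVal C t inp ω n k M (m 29) z (c + 2 * M * j) with hS
  refine Exec.seq ((Exec.loop (T := Ts + 1) 28 (fun j m' o' => o' = o ∧ j ≤ N ∧
    Static n k M z m' ∧ m' 28 = j ∧
    (∀ a < 64, (31 ≤ a ∨ a = 29) → m' a = m a) ∧
    m' 30 = 2 * (c + 2 * M * (N - j)) + 1 ∧ (m' 26 : ℤ) - m' 27 = S (N - j))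
    (Q := fun m' o' => o' = o ∧ Static n k M z m' ∧
    (∀ a < 64, (31 ≤ a ∨ a = 29) → m' a = m a) ∧
    m' 30 = 2 * (c + 2 * M * N) + 1 ∧ (m' 26 : ℤ) - m' 27 = S N) ?_ ?_ N
    ⟨rfl, le_rfl, hs₁, ?_, fun a _ ha => fr₁ a (by omega), ?_, ?_⟩).mono le_rfl ?_)
  · rintro j m' o' ⟨rfl, hj, hs', h28, fr, h30', hd⟩
    refine ⟨by omega, Exec.seq ((exec_sample hkM hC hs' h30').mono le_rfl ?_)⟩
    rintro m'' o'' ⟨rfl, hs'', fr', h30'', hd'⟩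
    refine Exec.block (by simp [Plain]) (by simp) ?_
    have e28 : m'' 28 = j + 1 := (fr' 28 (by omega) (by omega)).trans h28
    refine ⟨by simp [eff, hs''.zero], rfl, by omega, ?_, ?_, ?_, ?_, ?_⟩
    · refine hs''.congr fun a ha => ?_
      have := hs''.le_base
      simp only [effs_cons, effs_nil, eff]
      rw [Function.update_of_ne (by omega : a ≠ _)]
    · simp [eff, hs''.one, e28]
    · intro a ha ha'
      simp only [effs_cons, effs_nil, eff]
      rw [Function.update_of_ne (by omega : a ≠ _), fr' a ha (by omega), fr a ha ha']
    · simp [eff, h30'']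
      rw [show N - j = N - (j + 1) + 1 by omega]
      ring
    · have e29 : m' 29 = m 29 := fr 29 (by omega) (by omega)
      simp [eff, hd', hd, e29]
      rw [show N - j = N - (j + 1) + 1 by omega]
      simp only [hS]
      rw [Finset.sum_range_succ]
  · rintro m' o' ⟨rfl, -, hs', h28, fr, h30', hd⟩
    exact ⟨h28, rfl, hs', fr, h30', hd⟩
  · simp [hm₁, eff, hs.zero, h31]
  · simp [hm₁, eff, h30]
  · simp [hm₁, eff, hS]
  · rintro m' o' ⟨rfl, hs', fr, h30', hd⟩
    refine Exec.block (by simp [Plain]) (by simp) ⟨rfl, ?_, ?_, ?_, ?_⟩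
    · refine hs'.congr fun a ha => ?_
      have := hs'.le_base
      simp only [effs_cons, effs_nil, eff]
      rw [Function.update_of_ne (by omega : a ≠ _)]
    · intro a ha ha'
      simp only [effs_cons, effs_nil, eff]
      rw [Function.update_of_ne (by omega : a ≠ _), fr a ha (by omega)]
    · simp [eff, h30']
    -- The counters are natural numbers, and their truncated difference is the `toNat` in `est`.
    · simp only [hS] at hd
      simp only [effs_cons, effs_nil, eff, Function.update_self, est]
      rw [← hd]
      omega

end Ram

/-! ### The search -/

namespace Ram

/-- Cell `34 := ` a random number below `[31]`, which has to be a power of two. -/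
def drawCode : Code :=
  seq (block [.const 34 0, .const 37 1, .sub 38 31 37])
    (loop 38 (block [.coin 22 30, .add 30 30 3, .add 30 30 3, .add 34 34 34, .add 34 34 22,
      .add 37 37 37, .sub 38 31 37]))

/-- Fix the bit of `z` at address `[35]`. -/
def stepCode (C : Prog) : Code :=
  seq (block [.store 35 2, .add 29 29 3]) (seq (estimate C) (seq (block [.sub 38 33 34])
    (seq (cond 38 (block []) (block [.sub 34 34 33, .store 35 3]))
      (block [.add 35 35 3, .sub 36 36 3]))))

/-- Try to find a string of large weight. The attempt is successful if cells `37` and `38` are not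
zero at the end. -/
def attemptCode (C : Prog) : Code :=
  seq drawCode (seq (block [.const 29 0, .add 35 14 2, .add 36 1 2]) (seq (loop 36 (stepCode C))
    (seq (estimate C) (block [.sub 38 33 34, .add 37 33 3, .sub 37 37 32]))))

/-- Print `z`. -/
def printCode : Code :=
  seq (block [.add 35 14 2, .add 36 1 2]) (loop 36 (seq (block [.load 22 35])
    (seq (block [.print 22]) (block [.add 35 35 3, .sub 36 36 3]))))

/-- Make attempts until one is successful, and print its result. -/
def searchCode (C : Prog) : Code :=
  loop 39 (seq (attemptCode C) (seq (cond 38 (cond 37 (seq printCode (block [.const 39 1]))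
    (block [])) (block [])) (block [.sub 39 39 3])))

/-- The number with the `L` binary digits `ω c`, ..., `ω (c + L - 1)`. -/
def draw (ω : ℕ → Bool) (c : ℕ) : ℕ → ℕ
  | 0 => 0
  | i + 1 => 2 * draw ω c i + (ω (c + i)).toNat

/-- The first `i` bits of the string found with estimates `E`, each of which uses `D` coin tosses,
for the random number `u`, and the rest of `u`. -/
def walk (E : ℕ → (ℕ → Bool) → ℕ → ℕ) (D c u : ℕ) : ℕ → (ℕ → Bool) × ℕ
  | 0 => (fun _ => false, u)
  | i + 1 =>
    let w := walk E D c u i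
    let e := E (i + 1) (Function.update w.1 i false) (c + D * i)
    if w.2 < e then (Function.update w.1 i false, w.2) else (Function.update w.1 i true, w.2 - e)

/-- The outcome of an attempt that uses the coin tosses from `c` on. -/
def attempt (E : ℕ → (ℕ → Bool) → ℕ → ℕ) (ω : ℕ → Bool) (M D L θ c : ℕ) :
    Option (ℕ → Bool) :=
  let w := walk E D (c + L) (draw ω c L) M
  let e := E M w.1 (c + L + D * M)
  if w.2 < e ∧ θ ≤ e then some w.1 else none

/-- The outcome of up to `j` attempts. -/
def search (E : ℕ → (ℕ → Bool) → ℕ → ℕ) (ω : ℕ → Bool) (M D L θ : ℕ) : ℕ → ℕ → Option (ℕ → Bool)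
  | 0, _ => none
  | j + 1, c => (attempt E ω M D L θ c).orElse fun _ => search E ω M D L θ j (c + (L + D * (M + 1)))

/-! ### Correctness and running time of the search code -/

variable {C : Prog} {t : ℕ} {inp ω : ℕ → Bool} {n k M N L : ℕ} {z : ℕ → Bool} {m : ℕ → ℕ}
  {o : List Bool}

theorem Static.update (h : Static n k M z m) {i : ℕ} (hi : i < M) (b : Bool) :
    Static n k M (Function.update z i b) (Function.update m (64 + i) b.toNat) := by
  have hb := h.le_base
  have fr : ∀ a, a ≠ 64 + i → Function.update m (64 + i) b.toNat a = m a :=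
    fun a ha => Function.update_of_ne ha ..
  refine ⟨(fr _ (by omega)).trans h.len, (fr _ (by omega)).trans h.num,
    (fr _ (by omega)).trans h.zero, (fr _ (by omega)).trans h.one, (fr _ (by omega)).trans h.half,
    (fr _ (by omega)).trans h.upper, (fr _ (by omega)).trans h.arr, (fr _ (by omega)).trans h.vec,
    by rw [fr _ (by omega)]; exact hb, fun a ha => ?_, fun j hj => ?_⟩
  · rw [fr _ (by omega)] at ha
    rw [fr _ (by omega), h.free a ha]
  · by_cases hij : j = i
    · subst hij; simp
    · rw [fr _ (by omega), Function.update_of_ne hij, h.bits j hj]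

/-- The code does not know `L`: cell `37` is doubled until it reaches `[31] = 2 ^ L`, and one binary
digit is read per doubling. -/
theorem exec_draw {c : ℕ} (hs : Static n k M z m) (h30 : m 30 = 2 * c + 1) (h31 : m 31 = 2 ^ L) :
    Exec inp ω drawCode (L * 9 + 4) m o fun m' o' => o' = o ∧ Static n k M z m' ∧
      (∀ a < 64, 23 ≤ a → a ≠ 30 → a ≠ 34 → a ≠ 37 → a ≠ 38 → m' a = m a) ∧
      m' 30 = 2 * (c + L) + 1 ∧ m' 34 = draw (own ω) c L := by
  have hb := hs.le_base
  refine Exec.le (T := 3 + (L * (7 + 2) + 1)) ?_ (by omega)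
  refine Exec.seq (Exec.block (by simp [Plain]) (by simp) ?_)
  set m₁ := effs inp ω [.const 34 0, .const 37 1, .sub 38 31 37] m with hm₁
  have fr₁ : ∀ a, a ≠ 34 → a ≠ 37 → a ≠ 38 → m₁ a = m a := by
    intro a ha ha' ha''
    simp only [hm₁, effs_cons, effs_nil, eff]
    repeat rw [Function.update_of_ne (by omega : a ≠ _)]
  refine Exec.loop (T := 7) 38 (fun j m' o' => o' = o ∧ j ≤ L ∧ Static n k M z m' ∧
    (∀ a < 64, 23 ≤ a → a ≠ 30 → a ≠ 34 → a ≠ 37 → a ≠ 38 → m' a = m a) ∧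
    m' 30 = 2 * (c + (L - j)) + 1 ∧ m' 37 = 2 ^ (L - j) ∧ m' 38 = 2 ^ L - 2 ^ (L - j) ∧
    m' 34 = draw (own ω) c (L - j)) ?_ ?_ L ⟨rfl, le_rfl, ?_, ?_, ?_, ?_, ?_, ?_⟩
  · rintro j m' o' ⟨rfl, hj, hs', fr, h30', h37, h38, h34⟩
    have hlt : 2 ^ (L - (j + 1)) < 2 ^ L := Nat.pow_lt_pow_right (by omega) (by omega)
    refine ⟨by omega, Exec.block (by simp [Plain]) (by simp) ?_⟩
    have e31 : m' 31 = 2 ^ L := by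
      rw [fr 31 (by omega) (by omega) (by omega) (by omega) (by omega) (by omega), h31]
    have hL : L - j = L - (j + 1) + 1 := by omega
    have fr' : ∀ a, a ≠ 22 → a ≠ 30 → a ≠ 34 → a ≠ 37 → a ≠ 38 → effs inp ω [.coin 22 30,
        .add 30 30 3, .add 30 30 3, .add 34 34 34, .add 34 34 22, .add 37 37 37, .sub 38 31 37] m' a
        = m' a := by
      intro a h1 h2 h3 h4 h5
      simp only [effs_cons, effs_nil, eff]
      repeat rw [Function.update_of_ne (by omega : a ≠ _)]
    have hs'' := hs'.congr fun a ha => by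
      have := hs'.le_base
      exact fr' a (by omega) (by omega) (by omega) (by omega) (by omega)
    refine ⟨hs''.zero, rfl, by omega, hs'', ?_, ?_, ?_, ?_, ?_⟩
    · intro a h1 h2 h3 h4 h5 h6
      rw [fr' a (by omega) h3 h4 h5 h6, fr a h1 h2 h3 h4 h5 h6]
    · simp [eff, hs'.one, h30']; omega
    · simp [eff, h37, hL, pow_succ]; omega
    · simp [eff, h37, hL, pow_succ, e31]; omega
    · simp [eff, h34, hL, draw, own, h30']; ring
  · rintro m' o' ⟨rfl, -, hs', fr, h30', h37, h38, h34⟩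
    exact ⟨by simpa using h38, rfl, hs', fr, h30', h34⟩
  · exact hs.congr fun a ha => fr₁ a (by omega) (by omega) (by omega)
  · exact fun a h1 h2 h3 h4 h5 h6 => fr₁ a h4 h5 h6
  · simp [hm₁, eff, h30]
  · simp [hm₁, eff]
  · simp [hm₁, eff, h31]
  · simp [hm₁, eff, draw]

/-- The loop invariant: the first `i` bits of `z` have been found. -/
structure Walking (C : Prog) (t : ℕ) (inp ω : ℕ → Bool) (n k M N c u : ℕ) (m₀ : ℕ → ℕ) (i : ℕ)
    (z : ℕ → Bool) (m : ℕ → ℕ) : Prop where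
  static : Static n k M z m
  bits : ∀ j < i, z j = (walk (est C t inp ω n k M N) (2 * M * N) c u i).1 j
  rest : m 34 = (walk (est C t inp ω n k M N) (2 * M * N) c u i).2
  level : m 29 = i
  addr : m 35 = 64 + i
  round : m 36 = M - i
  coin : m 30 = 2 * (c + 2 * M * N * i) + 1
  num : m 31 = N
  frame : ∀ a < 64, (39 ≤ a ∨ a = 32) → m a = m₀ a

theorem exec_step {c u i T : ℕ} {m₀ : ℕ → ℕ} (hkM : k ≤ M)
    (hC : ∀ q, (members q M).length = k →
      C.Halted ((C.step (select inp n k M q) fun c => ω (2 * c))^[t] (Prog.init n k)))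
    (hT : T = N * (2 * (t * (10 * k + 15) + 23 * M + 21) + 20) + 5) (hi : i < M)
    (h : Walking C t inp ω n k M N c u m₀ i z m) :
    Exec inp ω (stepCode C) (T + 9) m o fun m' o' =>
      o' = o ∧ ∃ z', Walking C t inp ω n k M N c u m₀ (i + 1) z' m' := by
  have hs := h.static
  have hb := hs.le_base
  set E := est C t inp ω n k M N with hE
  set w := walk E (2 * M * N) c u i with hw
  refine Exec.le (T := 2 + (T + (1 + (4 + 2)))) ?_ (by omega)
  refine Exec.seq (Exec.block (by simp [Plain]) (by simp) ?_)
  have e₁ : effs inp ω [.store 35 2, .add 29 29 3] m =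
      Function.update (Function.update m (64 + i) 0) 29 (i + 1) := by
    have n29 : 29 ≠ 64 + i := by omega
    have n3 : 3 ≠ 64 + i := by omega
    simp [eff, h.addr, hs.zero, h.level, hs.one, Function.update_of_ne n29, Function.update_of_ne n3]
  rw [e₁]
  set m₁ := Function.update (Function.update m (64 + i) 0) 29 (i + 1) with hm₁
  have fr₁ : ∀ a, a ≠ 29 → a ≠ 64 + i → m₁ a = m a := by
    intro a h1 h2
    rw [hm₁, Function.update_of_ne h1, Function.update_of_ne h2]
  have hs₁ : Static n k M (Function.update z i false) m₁ :=
    (hs.update hi false).congr fun a ha => by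
      have : Function.update m (64 + i) false.toNat 5 = m 5 := Function.update_of_ne (by omega) ..
      rw [hm₁, Function.update_of_ne (by omega)]
      rfl
  refine Exec.seq ((exec_estimate (N := N) (c := c + 2 * M * N * i) hkM hC hs₁ ?_ ?_).mono hT.ge ?_)
  · rw [fr₁ _ (by omega) (by omega), h.coin]
  · rw [fr₁ _ (by omega) (by omega), h.num]
  rintro m₂ o₂ ⟨rfl, hs₂, fr₂, h30₂, h33⟩
  have hb₂ := hs₂.le_base
  have h29₂ : m₂ 29 = i + 1 := by rw [fr₂ 29 (by omega) (by omega), hm₁, Function.update_self]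
  set e := E (i + 1) (Function.update w.1 i false) (c + 2 * M * N * i) with he
  have h33' : m₂ 33 = e := by
    rw [h33, hm₁, Function.update_self, he, hE]
    -- The memory still holds bits of an earlier attempt beyond position `i`, where `walk` has
    -- `false`. An estimate at level `i + 1` does not see them.
    refine est_congr (fun j hj => ?_) _
    by_cases hji : j = i
    · subst hji; simp
    · rw [Function.update_of_ne hji, Function.update_of_ne hji, h.bits j (by omega)]
  have h34₂ : m₂ 34 = w.2 := by
    rw [fr₂ 34 (by omega) (by omega), fr₁ _ (by omega) (by omega), h.rest]
  have h35₂ : m₂ 35 = 64 + i := by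
    rw [fr₂ 35 (by omega) (by omega), fr₁ _ (by omega) (by omega), h.addr]
  have hwalk : walk E (2 * M * N) c u (i + 1) = if w.2 < e then (Function.update w.1 i false, w.2)
      else (Function.update w.1 i true, w.2 - e) := rfl
  refine Exec.seq (Exec.block (by simp [Plain]) (by simp) ?_)
  set m₃ := effs inp ω [.sub 38 33 34] m₂ with hm₃
  have fr₃ : ∀ a, a ≠ 38 → m₃ a = m₂ a := by
    intro a h1
    simp only [hm₃, effs_cons, effs_nil, eff]
    rw [Function.update_of_ne h1]
  have h38 : m₃ 38 = e - w.2 := by simp [hm₃, eff, h33', h34₂]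
  have hs₃ : Static n k M (Function.update z i false) m₃ := hs₂.congr fun a ha =>
    fr₃ a (by omega)
  refine Exec.seq (Exec.mono (T := 4) (Q := fun m' o' => o' = o₂ ∧ ∃ z', Static n k M z' m' ∧
    (∀ j < i + 1, z' j = (walk E (2 * M * N) c u (i + 1)).1 j) ∧
    m' 34 = (walk E (2 * M * N) c u (i + 1)).2 ∧
    ∀ a < 64, 29 ≤ a → a ≠ 34 → a ≠ 38 → m' a = m₂ a) ?_ le_rfl ?_)
  · refine Exec.cond 38 (T := 2) (fun hlt => ?_) fun hlt => ?_
    · have hlt' : w.2 < e := by omega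
      refine Exec.block (by simp) (by simp) ?_
      rw [effs_nil, hwalk, if_pos hlt']
      refine ⟨hs₃.zero, rfl, _, hs₃, fun j hj => ?_, ?_, fun a _ _ _ ha => fr₃ a ha⟩
      · by_cases hji : j = i
        · subst hji; simp
        · rw [Function.update_of_ne hji]
          exact (h.bits j (by omega)).trans (Function.update_of_ne hji ..).symm
      · rw [fr₃ _ (by omega), h34₂]
    · have hlt' : ¬ w.2 < e := by omega
      refine Exec.block (by simp [Plain]) (by simp) ?_
      rw [hwalk, if_neg hlt']
      have e₄ : effs inp ω [.sub 34 34 33, .store 35 3] m₃ =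
          Function.update (Function.update m₃ 34 (w.2 - e)) (64 + i) 1 := by
        simp [eff, fr₃ 34 (by omega), fr₃ 33 (by omega), fr₃ 35 (by omega), fr₃ 3 (by omega),
          h34₂, h33', h35₂, hs₂.one]
      rw [e₄]
      have hs₄ : Static n k M (Function.update z i false) (Function.update m₃ 34 (w.2 - e)) :=
        hs₃.congr fun a ha => by
          have := hs₃.le_base
          rw [Function.update_of_ne (by omega)]
      refine ⟨rfl, _, hs₄.update hi true, fun j hj => ?_, ?_, fun a h1 h2 h3 h4 => ?_⟩
      · by_cases hji : j = i
        · subst hji; simp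
        · rw [Function.update_of_ne hji, Function.update_of_ne hji]
          exact (h.bits j (by omega)).trans (Function.update_of_ne hji ..).symm
      · rw [Function.update_of_ne (by omega), Function.update_self]
      · rw [Function.update_of_ne (by omega), Function.update_of_ne h3, fr₃ a h4]
  · rintro m₄ o₄ ⟨rfl, z', hs₄, hz', h34₄, fr₄⟩
    have fr : ∀ a < 64, 34 ≤ a → a ≠ 34 → a ≠ 38 → m₄ a = m a := fun a h1 h2 h3 h4 => by
      rw [fr₄ a h1 (by omega) h3 h4, fr₂ a h1 (by omega), fr₁ a (by omega) (by omega)]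
    have fr' : ∀ a, a ≠ 35 → a ≠ 36 → effs inp ω [.add 35 35 3, .sub 36 36 3] m₄ a = m₄ a := by
      intro a h1 h2
      simp only [effs_cons, effs_nil, eff]
      rw [Function.update_of_ne h2, Function.update_of_ne h1]
    refine Exec.block (by simp [Plain]) (by simp) ⟨rfl, z', ?_⟩
    constructor
    · exact hs₄.congr fun a ha => fr' a (by have := hs₄.le_base; omega)
        (by have := hs₄.le_base; omega)
    · exact hz'
    · rw [fr' _ (by omega) (by omega), h34₄]
    · rw [fr' _ (by omega) (by omega), fr₄ _ (by omega) (by omega) (by omega) (by omega), h29₂]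
    · simp [eff, hs₄.one, fr 35, h.addr, add_assoc]
    · simp [eff, hs₄.one, fr 36, h.round]
      omega
    · rw [fr' _ (by omega) (by omega), fr₄ _ (by omega) (by omega) (by omega) (by omega), h30₂]
      ring
    · rw [fr' _ (by omega) (by omega), fr₄ _ (by omega) (by omega) (by omega) (by omega),
        fr₂ 31 (by omega) (by omega), fr₁ _ (by omega) (by omega), h.num]
    · intro a h1 h2
      rw [fr' _ (by omega) (by omega), fr₄ _ h1 (by omega) (by omega) (by omega),
        fr₂ a h1 (by omega), fr₁ _ (by omega) (by omega), h.frame a h1 h2]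

theorem exec_attempt {c T θ : ℕ} (hkM : k ≤ M)
    (hC : ∀ q, (members q M).length = k →
      C.Halted ((C.step (select inp n k M q) fun c => ω (2 * c))^[t] (Prog.init n k)))
    (hN : N = 2 ^ L)
    (hT : T = N * (2 * (t * (10 * k + 15) + 23 * M + 21) + 20) + 5)
    (hs : Static n k M z m) (h30 : m 30 = 2 * c + 1) (h31 : m 31 = N) (h32 : m 32 = θ) :
    Exec inp ω (attemptCode C) ((M + 1) * (T + 11) + L * 9) m o fun m' o' =>
      o' = o ∧ (∃ z', Static n k M z' m' ∧
        ((m' 38 ≠ 0 ∧ m' 37 ≠ 0) → ∃ z'', attempt (est C t inp ω n k M N) (own ω) M (2 * M * N) L θ c =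
          some z'' ∧ ∀ j < M, z' j = z'' j)) ∧
        (¬ (m' 38 ≠ 0 ∧ m' 37 ≠ 0) →
          attempt (est C t inp ω n k M N) (own ω) M (2 * M * N) L θ c = none) ∧
      m' 30 = 2 * (c + (L + 2 * M * N * (M + 1))) + 1 ∧ m' 31 = N ∧
      ∀ a < 64, (39 ≤ a ∨ a = 32) → m' a = m a := by
  refine Exec.le (T := (L * 9 + 4) + (3 + ((M * ((T + 9) + 2) + 1) + (T + 3)))) ?_
    (by ring_nf; omega)
  refine Exec.seq ((exec_draw hs h30 (h31.trans hN)).mono le_rfl ?_)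
  rintro m₁ o₁ ⟨rfl, hs₁, fr₁, h30₁, h34₁⟩
  have hb₁ := hs₁.le_base
  refine Exec.seq (Exec.block (by simp [Plain]) (by simp) ?_)
  set m₂ := effs inp ω [.const 29 0, .add 35 14 2, .add 36 1 2] m₁ with hm₂
  have fr₂ : ∀ a, a ≠ 29 → a ≠ 35 → a ≠ 36 → m₂ a = m₁ a := by
    intro a h1 h2 h3
    simp only [hm₂, effs_cons, effs_nil, eff]
    repeat rw [Function.update_of_ne (by omega : a ≠ _)]
  have hw₂ : Walking C t inp ω n k M N (c + L) (draw (own ω) c L) m 0 z m₂ := by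
    constructor
    · exact hs₁.congr fun a ha => fr₂ a (by omega) (by omega) (by omega)
    · simp
    · rw [fr₂ _ (by omega) (by omega) (by omega), h34₁]; rfl
    · simp [hm₂, eff]
    · simp [hm₂, eff, hs₁.vec, hs₁.zero]
    · simp [hm₂, eff, hs₁.num, hs₁.zero]
    · rw [fr₂ _ (by omega) (by omega) (by omega), h30₁]; rfl
    · rw [fr₂ _ (by omega) (by omega) (by omega), fr₁ _ (by omega) (by omega) (by omega) (by omega)
        (by omega) (by omega), h31]
    · intro a h1 h2
      rw [fr₂ _ (by omega) (by omega) (by omega), fr₁ _ (by omega) (by omega) (by omega) (by omega)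
        (by omega) (by omega)]
  refine Exec.seq ((Exec.loop (T := T + 9) 36 (fun j m' o' => o' = o₁ ∧ j ≤ M ∧
    ∃ z', Walking C t inp ω n k M N (c + L) (draw (own ω) c L) m (M - j) z' m')
    (Q := fun m' o' => o' = o₁ ∧
      ∃ z', Walking C t inp ω n k M N (c + L) (draw (own ω) c L) m M z' m') ?_ ?_ M
      ⟨rfl, le_rfl, z, by simpa using hw₂⟩).mono le_rfl ?_)
  · rintro j m' o' ⟨rfl, hj, z', hw⟩
    refine ⟨by rw [hw.round]; omega, (exec_step hkM hC hT (by omega) hw).mono le_rfl ?_⟩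
    rintro m'' o'' ⟨rfl, z'', hw'⟩
    rw [show M - (j + 1) + 1 = M - j by omega] at hw'
    exact ⟨hw'.static.zero, rfl, by omega, z'', hw'⟩
  · rintro m' o' ⟨rfl, -, z', hw⟩
    exact ⟨by rw [hw.round]; omega, rfl, z', hw⟩
  rintro m₃ o₃ ⟨rfl, z₃, hw₃⟩
  refine Exec.seq ((exec_estimate (N := N) (c := c + L + 2 * M * N * M) hkM hC hw₃.static hw₃.coin
    hw₃.num).mono hT.ge ?_)
  rintro m₄ o₄ ⟨rfl, hs₄, fr₄, h30₄, h33₄⟩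
  have hb₄ := hs₄.le_base
  refine Exec.block (by simp [Plain]) (by simp) ?_
  set m₅ := effs inp ω [.sub 38 33 34, .add 37 33 3, .sub 37 37 32] m₄ with hm₅
  have fr₅ : ∀ a, a ≠ 37 → a ≠ 38 → m₅ a = m₄ a := by
    intro a h1 h2
    simp only [hm₅, effs_cons, effs_nil, eff]
    repeat rw [Function.update_of_ne (by omega : a ≠ _)]
  set w := walk (est C t inp ω n k M N) (2 * M * N) (c + L) (draw (own ω) c L) M with hw
  have h33' : m₄ 33 = est C t inp ω n k M N M w.1 (c + L + 2 * M * N * M) := by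
    rw [h33₄, hw₃.level]
    exact est_congr hw₃.bits _
  have h34' : m₄ 34 = w.2 := by rw [fr₄ _ (by omega) (by omega), hw₃.rest]
  have h32' : m₄ 32 = θ := by
    rw [fr₄ _ (by omega) (by omega), hw₃.frame 32 (by omega) (by omega), h32]
  -- Cell `37` holds `e + 1 - θ` for the last estimate `e`; the added one makes the test `θ ≤ e`
  -- instead of a strict inequality.
  have hiff : (m₅ 38 ≠ 0 ∧ m₅ 37 ≠ 0) ↔
      w.2 < est C t inp ω n k M N M w.1 (c + L + 2 * M * N * M) ∧
        θ ≤ est C t inp ω n k M N M w.1 (c + L + 2 * M * N * M) := by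
    simp [hm₅, eff, h33', h34', h32', hs₄.one]
    omega
  refine ⟨rfl, ⟨z₃, hs₄.congr fun a ha => fr₅ a (by omega) (by omega), fun h => ⟨w.1, ?_,
    hw₃.bits⟩⟩, fun h => ?_, ?_, ?_, fun a h1 h2 => ?_⟩
  · rw [hiff] at h
    simp only [attempt, ← hw]
    rw [if_pos h]
  · rw [hiff] at h
    simp only [attempt, ← hw]
    rw [if_neg h]
  · rw [fr₅ _ (by omega) (by omega), h30₄]
    ring
  · rw [fr₅ _ (by omega) (by omega), fr₄ _ (by omega) (by omega), hw₃.num]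
  · rw [fr₅ _ (by omega) (by omega), fr₄ _ h1 (by omega), hw₃.frame a h1 h2]

theorem exec_print (hs : Static n k M z m) :
    Exec inp ω printCode (M * 6 + 3) m o fun m' o' =>
      m' 2 = 0 ∧ m' 3 = 1 ∧ o' = o ++ (List.range M).map z := by
  refine Exec.le (T := 2 + (M * (4 + 2) + 1)) ?_ (by omega)
  refine Exec.seq (Exec.block (by simp [Plain]) (by simp) ?_)
  refine Exec.loop (T := 4) 36 (fun j m' o' => j ≤ M ∧ (∀ a, a < 22 ∨ 64 ≤ a → m' a = m a) ∧
    m' 35 = 64 + (M - j) ∧ m' 36 = j ∧ o' = o ++ (List.range (M - j)).map z) ?_ ?_ M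
    ⟨le_rfl, ?_, ?_, ?_, ?_⟩
  · rintro j m' o' ⟨hj, fr, h35, h36, rfl⟩
    refine ⟨by omega, Exec.le (T := 1 + (1 + 2)) ?_ (by omega)⟩
    refine Exec.seq (Exec.block (by simp [Plain]) (by simp) ?_)
    refine Exec.seq (Exec.print _ ?_)
    refine Exec.block (by simp [Plain]) (by simp) ?_
    have h2 : m' 2 = 0 := (fr 2 (by omega)).trans hs.zero
    have h3 : m' 3 = 1 := (fr 3 (by omega)).trans hs.one
    refine ⟨by simp [eff, h2], by omega, fun a ha => ?_, ?_, ?_, ?_⟩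
    · simp only [effs_cons, effs_nil, eff]
      repeat rw [Function.update_of_ne (by omega : a ≠ _)]
      exact fr a ha
    · simp [eff, h3, h35]; omega
    · simp [eff, h3, h36]
    · have hz : m' (64 + (M - (j + 1))) = (z (M - (j + 1))).toNat := by
        rw [fr _ (by omega), hs.bits _ (by omega)]
      rw [show M - j = M - (j + 1) + 1 by omega, List.range_succ]
      simp only [effs_cons, effs_nil, eff, Function.update_self, h35, hz]
      cases hc : z (M - (j + 1)) <;> simp [hc]
  · rintro m' o' ⟨-, fr, -, h36, rfl⟩
    exact ⟨h36, (fr 2 (by omega)).trans hs.zero, (fr 3 (by omega)).trans hs.one, rfl⟩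
  · intro a ha
    simp only [effs_cons, effs_nil, eff]
    repeat rw [Function.update_of_ne (by omega : a ≠ _)]
  · simp [eff, hs.vec, hs.zero]
  · simp [eff, hs.num, hs.zero]
  · simp

theorem exec_search {c T θ K : ℕ} (hkM : k ≤ M)
    (hC : ∀ q, (members q M).length = k →
      C.Halted ((C.step (select inp n k M q) fun c => ω (2 * c))^[t] (Prog.init n k)))
    (hN : N = 2 ^ L)
    (hT : T = N * (2 * (t * (10 * k + 15) + 23 * M + 21) + 20) + 5)
    (hs : Static n k M z m) (h30 : m 30 = 2 * c + 1) (h31 : m 31 = N) (h32 : m 32 = θ)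
    (h39 : m 39 = K) :
    Exec inp ω (searchCode C) (K * ((M + 1) * (T + 17) + L * 9 + 11) + 1) m [] fun _ o' =>
      o' = ((search (est C t inp ω n k M N) (own ω) M (2 * M * N) L θ K c).map fun z =>
        (List.range M).map z).getD [] := by
  set E := est C t inp ω n k M N with hE
  set D := 2 * M * N with hD
  set S := search E (own ω) M D L θ K c with hS
  refine Exec.le (T := K * (((M + 1) * (T + 11) + L * 9 + (((M * 6 + 3 + 1) + 2 + 2) + 1)) + 2) + 1)
    ?_ (by gcongr ?_ + 1; gcongr K * ?_; ring_nf; omega)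
  -- Success sets `[39]` to one just before it is decremented, which ends the loop early. Hence the
  -- number of rounds is only bounded, and the state with `j = 0` keeps the printed result.
  refine Exec.loop_of_le (T := (M + 1) * (T + 11) + L * 9 + (((M * 6 + 3 + 1) + 2 + 2) + 1)) 39
    (fun j m' o' => m' 39 = j ∧ ((j = 0 ∧ m' 2 = 0 ∧
        o' = (S.map fun z => (List.range M).map z).getD []) ∨
      (o' = [] ∧ ∃ c', (∃ z', Static n k M z' m') ∧ m' 30 = 2 * c' + 1 ∧ m' 31 = N ∧ m' 32 = θ ∧
        search E (own ω) M D L θ j c' = S))) ?_ ?_ K ⟨h39, Or.inr ⟨rfl, c, ⟨z, hs⟩, h30, h31, h32, rfl⟩⟩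
  · rintro j m' o' ⟨h39, ⟨hj, -⟩ | ⟨rfl, c', ⟨z', hs'⟩, h30, h31, h32, hsearch⟩⟩
    · omega
    refine ⟨by omega, ?_⟩
    refine Exec.seq ((exec_attempt hkM hC hN hT hs' h30 h31 h32).mono le_rfl ?_)
    rintro m₁ o₁ ⟨rfl, ⟨z₁, hs₁, hsome⟩, hnone, h30₁, h31₁, fr₁⟩
    have hb₁ := hs₁.le_base
    have h39₁ : m₁ 39 = j + 1 := (fr₁ 39 (by omega) (by omega)).trans h39
    have h32₁ : m₁ 32 = θ := (fr₁ 32 (by omega) (by omega)).trans h32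
    refine Exec.seq (Exec.mono (T := (M * 6 + 3 + 1) + 2 + 2) (Q := fun m₂ o₂ =>
      (m₂ 39 = 1 ∧ m₂ 2 = 0 ∧ m₂ 3 = 1 ∧ o₂ = (S.map fun z => (List.range M).map z).getD []) ∨
      (m₂ = m₁ ∧ o₂ = [] ∧ attempt E (own ω) M D L θ c' = none)) ?_ le_rfl ?_)
    · refine Exec.cond 38 (T := (M * 6 + 3 + 1) + 2) (fun h38 => ?_) fun h38 => ?_
      · refine Exec.cond 37 (T := M * 6 + 3 + 1) (fun h37 => ?_) fun h37 => ?_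
        · obtain ⟨z₂, hatt, hz₂⟩ := hsome ⟨h38, h37⟩
          refine Exec.seq ((exec_print hs₁).mono le_rfl ?_)
          rintro m₂ o₂ ⟨h2, h3, rfl⟩
          refine Exec.block (by simp [Plain]) (by simp) ⟨by simp [eff, h2], by simp [eff, h2],
            Or.inl ⟨by simp [eff], by simp [eff, h2], by simp [eff, h3], ?_⟩⟩
          rw [← hsearch, search, hatt]
          simp only [Option.orElse_some, Option.map_some, Option.getD_some, List.nil_append]
          exact List.map_congr_left fun i hi => hz₂ i (List.mem_range.1 hi)
        · exact Exec.block (by simp) (by simp) ⟨hs₁.zero, Or.inr ⟨rfl, rfl, hnone (by tauto)⟩⟩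
      · exact Exec.block (by simp) (by simp) (Or.inr ⟨rfl, rfl, hnone (by tauto)⟩)
    · rintro m₂ o₂ (⟨h39₂, h2, h3, rfl⟩ | ⟨rfl, rfl, hatt⟩)
      · exact Exec.block (by simp [Plain]) (by simp) ⟨by simp [eff, h2], 0, by omega,
          by simp [eff, h39₂, h3], Or.inl ⟨rfl, by simp [eff, h2], rfl⟩⟩
      · have fr : ∀ a, a ≠ 39 → effs inp ω [.sub 39 39 3] m₂ a = m₂ a := by
          intro a ha
          simp only [effs_cons, effs_nil, eff]
          rw [Function.update_of_ne ha]
        refine Exec.block (by simp [Plain]) (by simp) ⟨by simp [eff, hs₁.zero], j, le_rfl,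
          by simp [eff, h39₁, hs₁.one], Or.inr ⟨rfl, c' + (L + D * (M + 1)), ⟨z₁, hs₁.congr fun a ha =>
            fr a (by omega)⟩, ?_, ?_, ?_, ?_⟩⟩
        · rw [fr _ (by omega), h30₁]
        · rw [fr _ (by omega), h31₁]
        · rw [fr _ (by omega), h32₁]
        · rw [← hsearch, search, hatt]
          rfl
  · rintro m' o' ⟨h39, ⟨-, -, h⟩ | ⟨rfl, c', -, -, -, -, h⟩⟩
    · exact ⟨h39, h⟩
    · refine ⟨h39, ?_⟩
      rw [← h]
      rfl

end Ram

/-! ### The whole program -/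

namespace Ram

/-- Multiply cell `31` by the `a`-th, and cell `32` by the `b`-th power of the least power of two
that is not below `[r]`, where `[37] = 1` and `[38] = [r] - 1`. -/
def scaleCode (r a b : ℕ) : Code :=
  loop 38 (block (.add 37 37 37 :: (List.replicate a (.add 31 31 31) ++
    (List.replicate b (.add 32 32 32) ++ [.sub 38 r 37]))))

/-- Compute the parameters: `e` is an upper bound of the inverse of the advantage. -/
def initCode (e : ℕ) : Code :=
  seq (block [.const 3 1, .add 21 1 2])
    (seq (loop 21 (block [.sub 21 21 3, .sub 21 21 3, .add 4 4 3]))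
      (seq (block [.const 31 4194304, .const 32 524288, .const 37 1, .sub 38 4 37])
        (seq (scaleCode 4 6 5) (seq (block [.const 36 e, .const 37 1, .sub 38 36 37])
          (seq (scaleCode 36 6 4) (block [.const 14 64, .add 13 14 1, .add 12 13 4, .add 5 13 1,
            .const 30 1, .add 39 4 2]))))))

/-- The program that computes the direct product from a program for the xor. -/
def mainCode (C : Prog) (e : ℕ) : Code := seq (initCode e) (searchCode C)

/-! ### Computation of the parameters -/

variable {inp ω : ℕ → Bool} {m : ℕ → ℕ} {o : List Bool}

theorem effs_replicate_add (r a : ℕ) (m : ℕ → ℕ) :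
    effs inp ω (List.replicate a (.add r r r)) m = Function.update m r (m r * 2 ^ a) := by
  induction a generalizing m with
  | zero => simp
  | succ a ih =>
    rw [List.replicate_succ, effs_cons, ih]
    simp only [eff, Function.update_idem, Function.update_self]
    congr 1
    ring

/-- Cell `37` runs through the powers of two until it reaches `x`, in `Nat.clog 2 x` rounds. Since
the parameters are products of such powers, doublings suffice to compute them on a machine without
multiplication. -/
theorem exec_scale {r a b x : ℕ} (hr : r < 31 ∨ r = 36) (h2 : m 2 = 0) (hr2 : m r = x)
    (h37 : m 37 = 1) (h38 : m 38 = x - 1) :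
    Exec inp ω (scaleCode r a b) (Nat.clog 2 x * (a + b + 4) + 1) m o fun m' o' => o' = o ∧
      m' 31 = m 31 * 2 ^ (a * Nat.clog 2 x) ∧ m' 32 = m 32 * 2 ^ (b * Nat.clog 2 x) ∧
      ∀ c, c ≠ 31 → c ≠ 32 → c ≠ 37 → c ≠ 38 → m' c = m c := by
  set K := Nat.clog 2 x with hK
  refine Exec.loop (T := a + b + 2) 38 (fun j m' o' => o' = o ∧ j ≤ K ∧
    m' 31 = m 31 * 2 ^ (a * (K - j)) ∧ m' 32 = m 32 * 2 ^ (b * (K - j)) ∧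
    m' 37 = 2 ^ (K - j) ∧ m' 38 = x - 2 ^ (K - j) ∧
    ∀ c, c ≠ 31 → c ≠ 32 → c ≠ 37 → c ≠ 38 → m' c = m c) ?_ ?_ K
    ⟨rfl, le_rfl, by simp, by simp, by simp [h37], by simp [h38], fun _ _ _ _ _ => rfl⟩
  · rintro j m' o' ⟨rfl, hj, h31, h32, h37, h38, fr⟩
    have hlt : 2 ^ (K - (j + 1)) < x := Nat.pow_lt_of_lt_clog (by omega)
    have e : effs inp ω (.add 37 37 37 :: (List.replicate a (.add 31 31 31) ++
        (List.replicate b (.add 32 32 32) ++ [.sub 38 r 37]))) m' =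
        Function.update (Function.update (Function.update (Function.update m' 37 (2 ^ (K - j)))
          31 (m 31 * 2 ^ (a * (K - j)))) 32 (m 32 * 2 ^ (b * (K - j)))) 38 (x - 2 ^ (K - j)) := by
      have hKj : K - j = K - (j + 1) + 1 := by omega
      have hr' : m' r = x := by
        rw [fr r (by omega) (by omega) (by omega) (by omega), hr2]
      rw [effs_cons, effs_append, effs_append, effs_replicate_add, effs_replicate_add]
      simp only [effs_cons, effs_nil, eff]
      rw [Function.update_of_ne (a := r) (by omega), Function.update_of_ne (a := r) (by omega),
        Function.update_of_ne (a := r) (by omega), hr']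
      simp only [h37, hKj]
      simp
      congr 1
      · congr 1
        · congr 1
          · congr 1; ring
          · rw [h31]; ring
        · rw [h32]; ring
      · congr 1; ring
    have hpl : ∀ i ∈ (Instr.add 37 37 37 :: (List.replicate a (.add 31 31 31) ++
        (List.replicate b (.add 32 32 32) ++ [.sub 38 r 37]))), Plain i := by
      intro i hi
      simp only [List.mem_cons, List.mem_append, List.mem_replicate, List.not_mem_nil,
        or_false] at hi
      rcases hi with rfl | ⟨-, rfl⟩ | ⟨-, rfl⟩ | rfl <;> simp [Plain]
    refine ⟨by omega, Exec.block hpl (by simp; omega) ?_⟩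
    rw [e]
    refine ⟨?_, rfl, by omega, by simp, by simp, by simp, by simp, fun c h1 h2 h3 h4 => ?_⟩
    · simp [fr 2, h2]
    · rw [Function.update_of_ne h4, Function.update_of_ne h2, Function.update_of_ne h1,
        Function.update_of_ne h3, fr c h1 h2 h3 h4]
  · rintro m' o' ⟨rfl, -, h31, h32, h37, h38, fr⟩
    have : x ≤ 2 ^ K := Nat.le_pow_clog (by omega) x
    exact ⟨by rw [h38, Nat.sub_zero]; exact Nat.sub_eq_zero_of_le this, rfl,
      by simpa using h31, by simpa using h32, fr⟩

/-- The logarithm of the number of samples. -/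
def logSamples (k e : ℕ) : ℕ := 22 + 6 * Nat.clog 2 k + 6 * Nat.clog 2 e

/-- The threshold. -/
def threshold (k e : ℕ) : ℕ := 2 ^ (19 + 5 * Nat.clog 2 k + 4 * Nat.clog 2 e)

theorem exec_init {n k e : ℕ} :
    Exec inp ω (initCode e) (5 * k + 15 * Nat.clog 2 k + 14 * Nat.clog 2 e + 30)
      (Prog.init n (2 * k)).mem [] fun m' o' => o' = [] ∧
      Static n k (2 * k) (fun _ => false) m' ∧ m' 30 = 2 * 0 + 1 ∧ m' 31 = 2 ^ logSamples k e ∧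
      m' 32 = threshold k e ∧ m' 39 = k := by
  set m := (Prog.init n (2 * k)).mem with hm
  have hm0 : m 0 = n := rfl
  have hm1 : m 1 = 2 * k := rfl
  have hmz : ∀ a, 2 ≤ a → m a = 0 := fun a ha => by
    simp only [hm, Prog.init]
    rw [if_neg (by omega), if_neg (by omega)]
  obtain ⟨ck, hck⟩ : ∃ ck, ck = Nat.clog 2 k := ⟨_, rfl⟩
  obtain ⟨ce, hce⟩ : ∃ ce, ce = Nat.clog 2 e := ⟨_, rfl⟩
  refine Exec.le (T := 2 + ((k * (3 + 2) + 1) + (4 + ((ck * (6 + 5 + 4) + 1) + (3 +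
    ((ce * (6 + 4 + 4) + 1) + 6)))))) ?_ (by omega)
  refine Exec.seq (Exec.block (by simp [Plain]) (by simp) ?_)
  -- The input format gives `2 * k`; it is halved by repeated subtraction of two.
  refine Exec.seq (Exec.mono (Exec.loop (T := 3) 21 (fun j m' o' => o' = [] ∧ j ≤ k ∧
    m' 21 = 2 * j ∧ m' 4 = k - j ∧ m' 3 = 1 ∧ ∀ a, a ≠ 3 → a ≠ 4 → a ≠ 21 → m' a = m a)
    (Q := fun m' o' => o' = [] ∧ m' 4 = k ∧ m' 3 = 1 ∧ ∀ a, a ≠ 3 → a ≠ 4 → a ≠ 21 → m' a = m a)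
    ?_ ?_ k ⟨rfl, le_rfl, ?_, ?_, ?_, ?_⟩) le_rfl ?_)
  · rintro j m' o' ⟨rfl, hj, h21, h4, h3, fr⟩
    refine ⟨by omega, Exec.block (by simp [Plain]) (by simp) ⟨?_, rfl, by omega, ?_, ?_, ?_, ?_⟩⟩
    · simp [eff, fr 2, hmz]
    · simp [eff, h21, h3]; omega
    · simp [eff, h4, h3]; omega
    · simp [eff, h3]
    · intro a h1 h2 h3
      simp only [effs_cons, effs_nil, eff]
      repeat rw [Function.update_of_ne (by omega : a ≠ _)]
      exact fr a h1 h2 h3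
  · rintro m' o' ⟨rfl, -, h21, h4, h3, fr⟩
    exact ⟨by simpa using h21, rfl, by simpa using h4, h3, fr⟩
  · simp [eff, hm1, hmz]
  · simp [eff, hmz]
  · simp [eff]
  · intro a h1 h2 h3
    simp only [effs_cons, effs_nil, eff]
    repeat rw [Function.update_of_ne (by omega : a ≠ _)]
  rintro m₁ o₁ ⟨rfl, h4₁, h3₁, fr₁⟩
  refine Exec.seq (Exec.block (by simp [Plain]) (by simp) ?_)
  set m₂ := effs inp ω [.const 31 4194304, .const 32 524288, .const 37 1, .sub 38 4 37] m₁ with hm₂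
  have fr₂ : ∀ a, a ≠ 31 → a ≠ 32 → a ≠ 37 → a ≠ 38 → m₂ a = m₁ a := by
    intro a h1 h2 h3 h4
    simp only [hm₂, effs_cons, effs_nil, eff]
    repeat rw [Function.update_of_ne (by omega : a ≠ _)]
  refine Exec.seq ((exec_scale (x := k) (a := 6) (b := 5) (by omega) ?_ ?_ ?_ ?_).mono
    (by rw [hck]) ?_)
  · rw [fr₂ _ (by omega) (by omega) (by omega) (by omega), fr₁ _ (by omega) (by omega) (by omega),
      hmz _ le_rfl]
  · rw [fr₂ _ (by omega) (by omega) (by omega) (by omega), h4₁]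
  · simp [hm₂, eff]
  · simp [hm₂, eff, h4₁]
  rintro m₃ o₃ ⟨rfl, h31₃, h32₃, fr₃⟩
  refine Exec.seq (Exec.block (by simp [Plain]) (by simp) ?_)
  set m₄ := effs inp ω [.const 36 e, .const 37 1, .sub 38 36 37] m₃ with hm₄
  have fr₄ : ∀ a, a ≠ 36 → a ≠ 37 → a ≠ 38 → m₄ a = m₃ a := by
    intro a h1 h2 h3
    simp only [hm₄, effs_cons, effs_nil, eff]
    repeat rw [Function.update_of_ne (by omega : a ≠ _)]
  have fr₁₄ : ∀ a, a < 31 ∨ 38 < a → a ≠ 3 → a ≠ 4 → a ≠ 21 → m₄ a = m a := by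
    intro a h1 h2 h3 h4
    rw [fr₄ _ (by omega) (by omega) (by omega), fr₃ _ (by omega) (by omega) (by omega) (by omega),
      fr₂ _ (by omega) (by omega) (by omega) (by omega), fr₁ _ h2 h3 h4]
  refine Exec.seq ((exec_scale (x := e) (a := 6) (b := 4) (by omega) ?_ ?_ ?_ ?_).mono
    (by rw [hce]) ?_)
  · rw [fr₁₄ _ (by omega) (by omega) (by omega) (by omega), hmz _ le_rfl]
  · simp [hm₄, eff]
  · simp [hm₄, eff]
  · simp [hm₄, eff]
  rintro m₅ o₅ ⟨rfl, h31₅, h32₅, fr₅⟩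
  have fr₁₅ : ∀ a, a < 31 ∨ 38 < a → a ≠ 3 → a ≠ 4 → a ≠ 21 → m₅ a = m a := by
    intro a h1 h2 h3 h4
    rw [fr₅ _ (by omega) (by omega) (by omega) (by omega), fr₁₄ _ h1 h2 h3 h4]
  have h3₅ : m₅ 3 = 1 := by
    rw [fr₅ _ (by omega) (by omega) (by omega) (by omega), fr₄ _ (by omega) (by omega) (by omega),
      fr₃ _ (by omega) (by omega) (by omega) (by omega),
      fr₂ _ (by omega) (by omega) (by omega) (by omega), h3₁]
  have h4₅ : m₅ 4 = k := by
    rw [fr₅ _ (by omega) (by omega) (by omega) (by omega), fr₄ _ (by omega) (by omega) (by omega),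
      fr₃ _ (by omega) (by omega) (by omega) (by omega),
      fr₂ _ (by omega) (by omega) (by omega) (by omega), h4₁]
  have h0₅ : m₅ 0 = n := (fr₁₅ 0 (by omega) (by omega) (by omega) (by omega)).trans hm0
  have h1₅ : m₅ 1 = 2 * k := (fr₁₅ 1 (by omega) (by omega) (by omega) (by omega)).trans hm1
  have h2₅ : m₅ 2 = 0 := (fr₁₅ 2 (by omega) (by omega) (by omega) (by omega)).trans (hmz _ le_rfl)
  refine Exec.block (by simp [Plain]) (by simp) ⟨rfl, ?_, ?_, ?_, ?_, ?_⟩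
  · have hz : ∀ a, 40 ≤ a → effs inp ω [.const 14 64, .add 13 14 1, .add 12 13 4, .add 5 13 1,
        .const 30 1, .add 39 4 2] m₅ a = 0 := by
      intro a ha
      simp only [effs_cons, effs_nil, eff]
      repeat rw [Function.update_of_ne (by omega : a ≠ _)]
      rw [fr₁₅ a (by omega) (by omega) (by omega) (by omega), hmz a (by omega)]
    have h5 : effs inp ω [.const 14 64, .add 13 14 1, .add 12 13 4, .add 5 13 1,
        .const 30 1, .add 39 4 2] m₅ 5 = 64 + 2 * k + 2 * k := by simp [eff, h1₅]
    constructor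
    · simp [eff, h0₅]
    · simp [eff, h1₅]
    · simp [eff, h2₅]
    · simp [eff, h3₅]
    · simp [eff, h4₅]
    · simp [eff, h1₅, h4₅]
    · simp [eff, h1₅]
    · simp [eff]
    · exact h5.ge
    · intro a ha
      exact hz a (by omega)
    · intro i _
      exact hz _ (by omega)
  · simp [eff]
  · simp only [effs_cons, effs_nil, eff]
    simp only [ne_eq, Nat.reduceEqDiff, not_false_eq_true,
      Function.update_of_ne]
    rw [h31₅, fr₄ _ (by omega) (by omega) (by omega), h31₃]
    have : m₂ 31 = 2 ^ 22 := by simp [hm₂, eff]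
    rw [this, logSamples, pow_add, pow_add]
  · simp only [effs_cons, effs_nil, eff]
    simp only [ne_eq, Nat.reduceEqDiff, not_false_eq_true,
      Function.update_of_ne]
    rw [h32₅, fr₄ _ (by omega) (by omega) (by omega), h32₃]
    have : m₂ 32 = 2 ^ 19 := by simp [hm₂, eff]
    rw [this, threshold, pow_add, pow_add]
  · simp [eff, h4₅, h2₅]

/-- A bound for the running time of the whole program. -/
def runTime (t k e : ℕ) : ℕ :=
  5 * k + 15 * Nat.clog 2 k + 14 * Nat.clog 2 e + 30 + (k * ((2 * k + 1) *
    (2 ^ logSamples k e * (2 * (t * (10 * k + 15) + 23 * (2 * k) + 21) + 20) + 5 + 17) +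
      logSamples k e * 9 + 11) + 1)

theorem exec_main {C : Prog} {n k t e : ℕ}
    (hC : ∀ q, (members q (2 * k)).length = k →
      C.Halted ((C.step (select inp n k (2 * k) q) fun c => ω (2 * c))^[t] (Prog.init n k))) :
    Exec inp ω (mainCode C e) (runTime t k e) (Prog.init n (2 * k)).mem [] fun _ o' =>
      o' = ((search (est C t inp ω n k (2 * k) (2 ^ logSamples k e)) (own ω) (2 * k)
        (2 * (2 * k) * 2 ^ logSamples k e) (logSamples k e) (threshold k e) k 0).map fun z =>
          (List.range (2 * k)).map z).getD [] := by
  refine Exec.seq (exec_init.mono le_rfl ?_)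
  rintro m o ⟨rfl, hs, h30, h31, h32, h39⟩
  exact exec_search (by omega) hC rfl rfl hs h30 h31 h32 h39

end Ram

/-! ### Computability of the translation -/

namespace Ram

variable {α : Type} [Primcodable α]

theorem primrec_instr {f : α → (ℕ × ℕ) ⊕ (ℕ × ℕ × ℕ) ⊕ (ℕ × ℕ × ℕ) ⊕ (ℕ × ℕ) ⊕ (ℕ × ℕ) ⊕ (ℕ × ℕ) ⊕
    (ℕ × ℕ) ⊕ ℕ ⊕ (ℕ × ℕ)} (hf : Primrec f) : Primrec fun a => Instr.equivSum.symm (f a) :=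
  Primrec.of_equiv_symm.comp hf

theorem primrec_jz {f g : α → ℕ} (hf : Primrec f) (hg : Primrec g) :
    Primrec fun a => Instr.jz (f a) (g a) :=
  primrec_instr (Primrec.sumInr.comp <| Primrec.sumInr.comp <| Primrec.sumInr.comp <|
    Primrec.sumInr.comp <| Primrec.sumInr.comp <| Primrec.sumInr.comp <| Primrec.sumInr.comp <|
    Primrec.sumInr.comp <| hf.pair hg)

theorem primrec_const {f g : α → ℕ} (hf : Primrec f) (hg : Primrec g) :
    Primrec fun a => Instr.const (f a) (g a) :=
  primrec_instr (Primrec.sumInl.comp <| hf.pair hg)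

/-- Code that depends on a parameter in a primitive recursive way. -/
def PrimCode (c : α → Code) : Prop := Primrec₂ fun (a : α) (p : ℕ) => c a p

theorem PrimCode.comp {c : α → Code} (h : PrimCode c) {β : Type} [Primcodable β] {f : β → α}
    {g : β → ℕ} (hf : Primrec f) (hg : Primrec g) : Primrec fun b => c (f b) (g b) :=
  Primrec₂.comp h hf hg

theorem PrimCode.block {l : α → List Instr} (hl : Primrec l) : PrimCode fun a => block (l a) :=
  hl.comp₂ Primrec₂.left

theorem primrec_length {f : α → List Instr} (hf : Primrec f) : Primrec fun a => (f a).length :=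
  Primrec.list_length.comp hf

theorem PrimCode.seq {c d : α → Code} (hc : PrimCode c) (hd : PrimCode d) :
    PrimCode fun a => seq (c a) (d a) := by
  have h1 : Primrec fun x : α × ℕ => c x.1 x.2 := hc.comp Primrec.fst Primrec.snd
  exact Primrec.list_append.comp h1 (hd.comp Primrec.fst
    (Primrec.nat_add.comp Primrec.snd (primrec_length h1)))

theorem PrimCode.loop (r : ℕ) {c : α → Code} (hc : PrimCode c) :
    PrimCode fun a => loop r (c a) := by
  have hs : Primrec fun x : α × ℕ => x.2 + 1 := Primrec.succ.comp Primrec.snd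
  have h1 : Primrec fun x : α × ℕ => c x.1 (x.2 + 1) := hc.comp Primrec.fst hs
  exact Primrec.list_cons.comp (primrec_jz (Primrec.const r) (Primrec.succ.comp
      (Primrec.nat_add.comp hs (primrec_length h1))))
    (Primrec.list_append.comp h1 (Primrec.list_cons.comp
      (primrec_jz (Primrec.const 2) Primrec.snd) (Primrec.const [])))

theorem PrimCode.cond (r : ℕ) {c d : α → Code} (hc : PrimCode c) (hd : PrimCode d) :
    PrimCode fun a => cond r (c a) (d a) := by
  have hs : Primrec fun x : α × ℕ => x.2 + 1 := Primrec.succ.comp Primrec.snd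
  have h1 : Primrec fun x : α × ℕ => c x.1 (x.2 + 1) := hc.comp Primrec.fst hs
  have h2 : Primrec fun x : α × ℕ => x.2 + 1 + (c x.1 (x.2 + 1)).length + 1 :=
    Primrec.succ.comp (Primrec.nat_add.comp hs (primrec_length h1))
  have h3 : Primrec fun x : α × ℕ => d x.1 (x.2 + 1 + (c x.1 (x.2 + 1)).length + 1) :=
    hd.comp Primrec.fst h2
  exact Primrec.list_cons.comp (primrec_jz (Primrec.const r) h2)
    (Primrec.list_append.comp h1 (Primrec.list_cons.comp
      (primrec_jz (Primrec.const 2) (Primrec.nat_add.comp h2 (primrec_length h3))) h3))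

theorem primrec_fetch (r : ℕ) {f : α → ℕ} (hf : Primrec f) : Primrec fun a => fetch r (f a) :=
  Primrec.list_cons.comp (primrec_const (Primrec.const r) hf) (Primrec.const _)

theorem primrec_put {f : α → ℕ} (hf : Primrec f) : Primrec fun a => put (f a) :=
  Primrec.list_cons.comp (primrec_const (Primrec.const 8) hf) (Primrec.const _)

theorem primCode_inputRound : PrimCode fun _ : α => inputRound :=
  (PrimCode.block (Primrec.const _)).seq ((PrimCode.cond 10 (PrimCode.block (Primrec.const _))
    (PrimCode.block (Primrec.const _))).seq (PrimCode.block (Primrec.const _)))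

theorem primrec_elim {β γ σ : Type} [Primcodable β] [Primcodable γ] [Primcodable σ]
    {f : α → β → σ} {g : α → γ → σ} (hf : Primrec₂ f) (hg : Primrec₂ g) :
    Primrec₂ fun a (s : β ⊕ γ) => Sum.elim (f a) (g a) s := by
  refine (Primrec.sumCasesOn (f := fun x : α × (β ⊕ γ) => x.2) (g := fun x b => f x.1 b)
    (h := fun x c => g x.1 c) Primrec.snd ?_ ?_).of_eq fun x => by rcases x with ⟨a, b | c⟩ <;> rfl
  · exact hf.comp (Primrec.fst.comp Primrec.fst) Primrec.snd
  · exact hg.comp (Primrec.fst.comp Primrec.fst) Primrec.snd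

/-- Instructions are encoded through a sum of nine types. Each kind is translated by code that is
primitive recursive in its operands, and `primrec_elim` glues the cases together. -/
theorem primrec_transl {tgt : α → ℕ → ℕ} {i : α → Instr} {p : α → ℕ} (ht : Primrec₂ tgt)
    (hi : Primrec i) (hp : Primrec p) : Primrec fun a => transl (tgt a) (i a) (p a) := by
  have key : ∀ {γ : Type} [Primcodable γ] (c : α × γ → Code), PrimCode c →
      Primrec₂ fun (a : α) (v : γ) => c (a, v) (p a) := fun _ h =>
    PrimCode.comp h Primrec.id (hp.comp Primrec.fst)
  have app : ∀ {γ : Type} [Primcodable γ] {f g : γ → List Instr}, Primrec f → Primrec g →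
      Primrec fun a => f a ++ g a := fun hf hg => Primrec.list_append.comp hf hg
  have cns : ∀ {γ : Type} [Primcodable γ] (j : Instr) {g : γ → List Instr}, Primrec g →
      Primrec fun a => j :: g a := fun j _ hg => Primrec.list_cons.comp (Primrec.const j) hg
  have s1 : Primrec fun x : α × ℕ × ℕ => x.2.1 := Primrec.fst.comp Primrec.snd
  have s2 : Primrec fun x : α × ℕ × ℕ => x.2.2 := Primrec.snd.comp Primrec.snd
  have t1 : Primrec fun x : α × ℕ × ℕ × ℕ => x.2.1 := Primrec.fst.comp Primrec.snd
  have t2 : Primrec fun x : α × ℕ × ℕ × ℕ => x.2.2.1 :=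
    Primrec.fst.comp (Primrec.snd.comp Primrec.snd)
  have t3 : Primrec fun x : α × ℕ × ℕ × ℕ => x.2.2.2 :=
    Primrec.snd.comp (Primrec.snd.comp Primrec.snd)
  have h₁ := key (fun x : α × ℕ × ℕ => transl (tgt x.1) (.const x.2.1 x.2.2)) (PrimCode.block
    (Primrec.list_cons.comp (primrec_const (Primrec.const 9) s2) (primrec_put s1)))
  have h₂ := key (fun x : α × ℕ × ℕ × ℕ => transl (tgt x.1) (.add x.2.1 x.2.2.1 x.2.2.2))
    (PrimCode.block (app (app (primrec_fetch 9 t2) (primrec_fetch 10 t3)) (cns _ (primrec_put t1))))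
  have h₃ := key (fun x : α × ℕ × ℕ × ℕ => transl (tgt x.1) (.sub x.2.1 x.2.2.1 x.2.2.2))
    (PrimCode.block (app (app (primrec_fetch 9 t2) (primrec_fetch 10 t3)) (cns _ (primrec_put t1))))
  have h₄ := key (fun x : α × ℕ × ℕ => transl (tgt x.1) (.load x.2.1 x.2.2)) (PrimCode.block
    (app (primrec_fetch 9 s2) (cns _ (cns _ (primrec_put s1)))))
  have h₅ := key (fun x : α × ℕ × ℕ => transl (tgt x.1) (.store x.2.1 x.2.2)) (PrimCode.block
    (app (app (primrec_fetch 9 s2) (primrec_fetch 8 s1)) (Primrec.const _)))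
  have h₆ := key (fun x : α × ℕ × ℕ => transl (tgt x.1) (.input x.2.1 x.2.2))
    ((PrimCode.block (app (primrec_fetch 9 s2) (Primrec.const _))).seq
      ((PrimCode.loop 10 primCode_inputRound).seq (PrimCode.block (cns _ (primrec_put s1)))))
  have h₇ := key (fun x : α × ℕ × ℕ => transl (tgt x.1) (.coin x.2.1 x.2.2)) (PrimCode.block
    (app (primrec_fetch 9 s2) (cns _ (cns _ (primrec_put s1)))))
  have h₈ := key (fun x : α × ℕ => transl (tgt x.1) (.print x.2)) (PrimCode.block
    (app (primrec_fetch 9 Primrec.snd) (Primrec.const _)))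
  have h₉ := key (fun x : α × ℕ × ℕ => transl (tgt x.1) (.jz x.2.1 x.2.2)) (PrimCode.block
    (app (primrec_fetch 9 s1) (Primrec.list_cons.comp
      (primrec_jz (Primrec.const 9) (ht.comp Primrec.fst s2)) (Primrec.const []))))
  have h := (primrec_elim h₁ <| primrec_elim h₂ <| primrec_elim h₃ <| primrec_elim h₄ <|
    primrec_elim h₅ <| primrec_elim h₆ <| primrec_elim h₇ <| primrec_elim h₈ h₉).comp Primrec.id
      ((Primrec.of_equiv (e := Instr.equivSum)).comp hi)
  refine h.of_eq fun a => ?_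
  cases i a <;> simp [Instr.equivSum]

theorem primrec_size : Primrec size :=
  primrec_length (primrec_transl (tgt := fun _ l => l) Primrec₂.right Primrec.id (Primrec.const 0))

theorem primrec_pos : Primrec₂ pos := by
  have h1 : Primrec₂ fun (x : Prog × ℕ) (j : ℕ) => (x.1[j]?).elim 0 size := by
    refine (Primrec.option_casesOn (o := fun y : (Prog × ℕ) × ℕ => y.1.1[y.2]?) (f := fun _ => 0)
      (g := fun _ i => size i) ?_ (Primrec.const 0) (primrec_size.comp Primrec.snd)).of_eq ?_
    · exact Primrec.list_getElem?.comp (Primrec.fst.comp Primrec.fst) Primrec.snd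
    · intro y
      cases hy : y.1.1[y.2]? <;> simp [hy]
  have h2 : Primrec fun x : Prog × ℕ => (List.range x.2).map fun j => (x.1[j]?).elim 0 size :=
    Primrec.list_map (Primrec.list_range.comp Primrec.snd) h1
  refine (Primrec.list_foldr (h := fun _ y => y.1 + y.2) h2 (Primrec.const 0) ?_).of_eq fun x => ?_
  · exact Primrec.nat_add.comp (Primrec.fst.comp Primrec.snd) (Primrec.snd.comp Primrec.snd)
  · rfl

theorem primCode_translate : PrimCode translate := by
  refine Primrec.list_flatMap (Primrec.list_range.comp (primrec_length Primrec.fst)) ?_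
  refine (Primrec.option_casesOn (o := fun y : (Prog × ℕ) × ℕ => y.1.1[y.2]?)
    (f := fun _ => ([] : List Instr)) (g := fun y i =>
      transl (fun l => y.1.2 + pos y.1.1 l) i (y.1.2 + pos y.1.1 y.2)) ?_ (Primrec.const [])
        ?_).of_eq ?_
  · exact Primrec.list_getElem?.comp (Primrec.fst.comp Primrec.fst) Primrec.snd
  · refine primrec_transl (α := ((Prog × ℕ) × ℕ) × Instr) (i := Prod.snd)
      (tgt := fun y l => y.1.1.2 + pos y.1.1.1 l) (p := fun y => y.1.1.2 + pos y.1.1.1 y.1.2)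
      ?_ Primrec.snd ?_
    · have h : Primrec fun y : (((Prog × ℕ) × ℕ) × Instr) × ℕ => y.1.1.1 :=
        Primrec.fst.comp (Primrec.fst.comp Primrec.fst)
      exact Primrec.nat_add.comp (Primrec.snd.comp h)
        (primrec_pos.comp (Primrec.fst.comp h) Primrec.snd)
    · have h : Primrec fun y : ((Prog × ℕ) × ℕ) × Instr => y.1.1 := Primrec.fst.comp Primrec.fst
      exact Primrec.nat_add.comp (Primrec.snd.comp h)
        (primrec_pos.comp (Primrec.fst.comp h) (Primrec.snd.comp Primrec.fst))
  · intro y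
    cases hy : y.1.1[y.2]? <;> simp [hy]

theorem primCode_simulate : PrimCode simulate :=
  (PrimCode.block (Primrec.const _)).seq
    (primCode_translate.seq (PrimCode.block (Primrec.const _)))

theorem primCode_block (l : List Instr) : PrimCode fun _ : α => block l :=
  PrimCode.block (Primrec.const _)

theorem primCode_query : PrimCode query :=
  (primCode_block _).seq <| (PrimCode.loop 15 (((primCode_block _).cond 23 (primCode_block _)).seq
    ((PrimCode.cond 22 ((primCode_block _).seq ((primCode_block _).cond 22 (primCode_block _)))
      (primCode_block _)).seq (primCode_block _)))).seq <| (primCode_block _).seq <|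
    (primCode_block _).cond 21 <| primCode_simulate.seq <| (primCode_block _).seq <|
      (primCode_block _).cond 7 (primCode_block _)

theorem primCode_estimate : PrimCode estimate :=
  (primCode_block _).seq <| (PrimCode.loop 28 <| ((primCode_block _).seq <| primCode_query.seq <|
    (primCode_block _).seq <| primCode_query.seq <| (primCode_block _).seq <|
    ((primCode_block _).cond 24 (primCode_block _)).cond 21 (primCode_block _)).seq
      (primCode_block _)).seq (primCode_block _)

theorem primCode_search : PrimCode searchCode :=
  PrimCode.loop 39 <| (((primCode_block _).seq (PrimCode.loop 38 (primCode_block _))).seq <|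
      (primCode_block _).seq <| (PrimCode.loop 36 <| (primCode_block _).seq <|
        primCode_estimate.seq <| (primCode_block _).seq <|
          ((primCode_block _).cond 38 (primCode_block _)).seq (primCode_block _)).seq <|
      primCode_estimate.seq (primCode_block _)).seq <|
    (PrimCode.cond 38 (PrimCode.cond 37 (PrimCode.seq ((primCode_block _).seq <| PrimCode.loop 36 <|
      (primCode_block _).seq <| (primCode_block _).seq (primCode_block _)) (primCode_block _))
        (primCode_block _)) (primCode_block _)).seq (primCode_block _)

theorem primCode_init : PrimCode initCode :=
  (primCode_block _).seq <| (PrimCode.loop 21 (primCode_block _)).seq <| (primCode_block _).seq <|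
    (PrimCode.loop 38 (primCode_block _)).seq <| (PrimCode.block <| Primrec.list_cons.comp
      (primrec_const (Primrec.const 36) Primrec.id) (Primrec.const _)).seq <|
    (PrimCode.loop 38 (primCode_block _)).seq (primCode_block _)

/-- The program is assembled by combinators that preserve `PrimCode`; only the translated program
and the constant `e` vary. -/
theorem computable_main : Computable fun a : Prog × ℕ => mainCode a.1 a.2 0 := by
  have h1 : PrimCode fun a : Prog × ℕ => initCode a.2 :=
    PrimCode.comp primCode_init (Primrec.snd.comp Primrec.fst) Primrec.snd
  have h2 : PrimCode fun a : Prog × ℕ => searchCode a.1 :=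
    PrimCode.comp primCode_search (Primrec.fst.comp Primrec.fst) Primrec.snd
  exact (PrimCode.comp (h1.seq h2) Primrec.id (Primrec.const 0)).to_comp

end Ram

/-! ### Independence of coin tosses -/

namespace Ram

open MeasureTheory ProbabilityTheory

instance : IsProbabilityMeasure coinMeasure :=
  inferInstanceAs (IsProbabilityMeasure (Measure.infinitePi _))

variable {X Y : Type*} {f : (ℕ → Bool) → X} {g : (ℕ → Bool) → Y} {s t : Finset ℕ}

/-- A function of finitely many tosses factors through a finite type. Measurability, boundedness and
integrability of all such functions, as well as independence over disjoint sets of tosses, follow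
from this. -/
theorem exists_factor (hf : DependsOn f s) : ∃ F : (s → Bool) → X, ∀ ω, f ω = F fun i => ω i := by
  refine ⟨fun v => f fun i => if h : i ∈ s then v ⟨i, h⟩ else false, fun ω => hf fun i hi => ?_⟩
  simp only [Finset.mem_coe] at hi
  simp [hi]

theorem finite_range_of_dependsOn (hf : DependsOn f s) : (Set.range f).Finite := by
  obtain ⟨F, hF⟩ := exists_factor hf
  refine (Set.finite_range F).subset ?_
  rintro _ ⟨ω, rfl⟩
  exact ⟨_, (hF ω).symm⟩

theorem measurable_of_dependsOn [MeasurableSpace X] (hf : DependsOn f s) : Measurable f := by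
  obtain ⟨F, hF⟩ := exists_factor hf
  rw [funext hF]
  exact (measurable_of_finite F).comp (by fun_prop)

theorem measurableSet_of_dependsOn {p : (ℕ → Bool) → Prop} (hp : DependsOn p s) :
    MeasurableSet {ω | p ω} :=
  measurableSet_setOfPred.2 (measurable_of_dependsOn hp)

theorem integrable_of_dependsOn {f : (ℕ → Bool) → ℝ} (hf : DependsOn f s) :
    Integrable f coinMeasure := by
  obtain ⟨b, hb⟩ := ((finite_range_of_dependsOn hf).image fun x => ‖x‖).bddAbove
  exact Integrable.of_bound (measurable_of_dependsOn hf).aestronglyMeasurable b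
    (ae_of_all _ fun ω => hb ⟨_, ⟨ω, rfl⟩, rfl⟩)

theorem memLp_of_dependsOn {f : (ℕ → Bool) → ℝ} (hf : DependsOn f s) :
    MemLp f 2 coinMeasure := by
  obtain ⟨b, hb⟩ := ((finite_range_of_dependsOn hf).image fun x => ‖x‖).bddAbove
  exact MemLp.of_bound (measurable_of_dependsOn hf).aestronglyMeasurable b
    (ae_of_all _ fun ω => hb ⟨_, ⟨ω, rfl⟩, rfl⟩)

theorem iIndepFun_coin : iIndepFun (fun (i : ℕ) (ω : ℕ → Bool) => ω i) coinMeasure :=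
  iIndepFun_infinitePi (X := fun _ x => x) fun _ => measurable_id

theorem indepFun_of_dependsOn [MeasurableSpace X] [MeasurableSpace Y] (hf : DependsOn f s)
    (hg : DependsOn g t) (h : Disjoint s t) : IndepFun f g coinMeasure := by
  obtain ⟨F, hF⟩ := exists_factor hf
  obtain ⟨G, hG⟩ := exists_factor hg
  rw [funext hF, funext hG]
  exact (iIndepFun_coin.indepFun_finset s t h fun i => by fun_prop).comp
    (measurable_of_finite F) (measurable_of_finite G)

theorem coin_real_and {p q : (ℕ → Bool) → Prop} (hp : DependsOn p s) (hq : DependsOn q t)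
    (h : Disjoint s t) : coinMeasure.real {ω | p ω ∧ q ω} =
      coinMeasure.real {ω | p ω} * coinMeasure.real {ω | q ω} := by
  have := (indepFun_of_dependsOn hp hq h).measure_inter_preimage_eq_mul {True} {True}
    (by measurability) (by measurability)
  have e : ∀ r : (ℕ → Bool) → Prop, r ⁻¹' {True} = {ω | r ω} := fun r => by ext; simp
  rw [e, e] at this
  simp only [measureReal_def, ← ENNReal.toReal_mul, ← this]
  rfl

theorem coin_integral_mul {f g : (ℕ → Bool) → ℝ} (hf : DependsOn f s) (hg : DependsOn g t)
    (h : Disjoint s t) : ∫ ω, f ω * g ω ∂coinMeasure =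
      (∫ ω, f ω ∂coinMeasure) * ∫ ω, g ω ∂coinMeasure :=
  (indepFun_of_dependsOn hf hg h).integral_fun_mul_eq_mul_integral
    (measurable_of_dependsOn hf).aestronglyMeasurable
    (measurable_of_dependsOn hg).aestronglyMeasurable

theorem coin_map_injective {σ : ℕ → ℕ} (hσ : σ.Injective) :
    coinMeasure.map (fun ω i => ω (σ i)) = coinMeasure :=
  Measure.map_infinitePi_infinitePi_of_inj hσ

theorem coin_integral_injective {σ : ℕ → ℕ} (hσ : σ.Injective)
    {f : (ℕ → Bool) → ℝ} (hf : DependsOn f s) :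
    ∫ ω, f (fun i => ω (σ i)) ∂coinMeasure = ∫ ω, f ω ∂coinMeasure := by
  conv_rhs => rw [← coin_map_injective hσ]
  have hm : Measurable fun (ω : ℕ → Bool) i => ω (σ i) := by fun_prop
  rw [integral_map hm.aemeasurable (measurable_of_dependsOn hf).aestronglyMeasurable]

theorem coin_map_block (c M : ℕ) : coinMeasure.map (fun ω (i : Fin M) => ω (c + i)) =
    Measure.infinitePi fun _ : Fin M => (PMF.uniformOfFintype Bool).toMeasure :=
  Measure.map_infinitePi_infinitePi_of_inj fun i j h => Fin.ext (by simpa using h)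

theorem coin_real_block (c M : ℕ) (r : Fin M → Bool) :
    coinMeasure.real {ω | (fun i : Fin M => ω (c + i)) = r} = (2 ^ M)⁻¹ := by
  have : {ω : ℕ → Bool | (fun i : Fin M => ω (c + i)) = r} =
      (fun ω (i : Fin M) => ω (c + i)) ⁻¹' {r} := rfl
  rw [this, ← map_measureReal_apply (by fun_prop) (by measurability), coin_map_block,
    measureReal_def, Measure.infinitePi_singleton_of_fintype]
  simp

theorem coin_integral_block (c M : ℕ) (g : (Fin M → Bool) → ℝ) :
    ∫ ω, g (fun i : Fin M => ω (c + i)) ∂coinMeasure = (2 ^ M)⁻¹ * ∑ r, g r := by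
  have hm : Measurable fun (ω : ℕ → Bool) (i : Fin M) => ω (c + i) := by fun_prop
  rw [← integral_map (f := g) hm.aemeasurable (measurable_of_finite g).aestronglyMeasurable]
  have : IsProbabilityMeasure (coinMeasure.map fun ω (i : Fin M) => ω (c + i)) :=
    Measure.isProbabilityMeasure_map hm.aemeasurable
  rw [integral_fintype .of_finite, Finset.mul_sum]
  refine Finset.sum_congr rfl fun r _ => ?_
  rw [map_measureReal_apply hm (by measurability), ← coin_real_block c M r]
  rfl

/-- The coin tosses with even numbers `ω` and odd numbers `ω'`. -/
def interleave (ω ω' : ℕ → Bool) (i : ℕ) : Bool := if i % 2 = 0 then ω (i / 2) else ω' (i / 2)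

@[simp] theorem interleave_even (ω ω' : ℕ → Bool) (i : ℕ) : interleave ω ω' (2 * i) = ω i := by
  simp [interleave]

@[simp] theorem interleave_odd (ω ω' : ℕ → Bool) (i : ℕ) :
    interleave ω ω' (2 * i + 1) = ω' i := by
  have h1 : (2 * i + 1) % 2 = 1 := by omega
  have h2 : (2 * i + 1) / 2 = i := by omega
  simp [interleave, h1, h2]

theorem measurable_interleave : Measurable fun ω : (ℕ → Bool) × (ℕ → Bool) =>
    interleave ω.1 ω.2 := by
  refine measurable_pi_lambda _ fun i => ?_
  by_cases h : i % 2 = 0 <;> simp only [interleave, h, if_true, if_false] <;> fun_prop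

/-- The tosses of the simulated program and those of the search are independent fair sequences.
Hence the former may be fixed, which fixes the function to be decoded, while the latter stay random.
-/
theorem coin_map_interleave : (coinMeasure.prod coinMeasure).map
    (fun ω : (ℕ → Bool) × (ℕ → Bool) => interleave ω.1 ω.2) = coinMeasure := by
  have h : IndepFun (fun (ω : ℕ → Bool) i => ω (2 * i)) (fun ω i => ω (2 * i + 1))
      coinMeasure := by
    refine IndepFun.process_indepFun_process (by fun_prop) (by fun_prop) fun I J => ?_
    refine indepFun_of_dependsOn (s := I.image fun i => 2 * i) (t := J.image fun i => 2 * i + 1)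
      (fun x y hxy => ?_) (fun x y hxy => ?_) ?_
    · funext i
      exact hxy _ (by simp)
    · funext i
      exact hxy _ (by simp)
    · rw [Finset.disjoint_left]
      simp only [Finset.mem_image]
      rintro _ ⟨a, -, rfl⟩ ⟨b, -, hb⟩
      omega
  have m1 : Measurable fun (ω : ℕ → Bool) i => ω (2 * i) := by fun_prop
  have m2 : Measurable fun (ω : ℕ → Bool) i => ω (2 * i + 1) := by fun_prop
  have h2 := h.map_prod_eq_prod_map_map m1.aemeasurable m2.aemeasurable
  rw [coin_map_injective (fun i j h => by simpa using h),
    coin_map_injective (fun i j h => by simpa using h)] at h2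
  rw [← h2, Measure.map_map measurable_interleave (by fun_prop)]
  convert Measure.map_id
  funext ω i
  simp only [interleave, Function.comp, id]
  split_ifs with h0
  · congr 1; omega
  · congr 1; omega

/-- The probability of an event is the mean of its conditional probabilities, given the coin
tosses with even numbers. -/
theorem integral_real_interleave {p : (ℕ → Bool) → Prop} (hp : DependsOn p s) :
    Integrable (fun ω => coinMeasure.real {ω' | p (interleave ω ω')}) coinMeasure ∧
    ∫ ω, coinMeasure.real {ω' | p (interleave ω ω')} ∂coinMeasure = coinMeasure.real {ω | p ω} := by
  have hm := measurable_interleave (measurableSet_of_dependsOn hp)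
  constructor
  · exact (measurable_measure_prodMk_left hm).ennreal_toReal.aestronglyMeasurable
      |> fun h => Integrable.of_bound h 1 (ae_of_all _ fun ω => by
        rw [Real.norm_of_nonneg measureReal_nonneg]
        exact measureReal_le_one)
  · conv_rhs => rw [← coin_map_interleave]
    rw [map_measureReal_apply measurable_interleave (measurableSet_of_dependsOn hp),
      measureReal_def, Measure.prod_apply hm, ← integral_toReal
        (measurable_measure_prodMk_left hm).aemeasurable (ae_of_all _ fun ω => measure_lt_top _ _)]
    rfl

/-- Chebyshev's inequality for sums of bounded functions of disjoint sets of coin tosses. -/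
theorem coin_chebyshev {N : ℕ} {x : ℕ → (ℕ → Bool) → ℝ} {I : ℕ → Finset ℕ} {w η : ℝ}
    (hx : ∀ j, DependsOn (x j) (I j)) (hI : Pairwise fun i j => Disjoint (I i) (I j))
    (h1 : ∀ j ω, |x j ω| ≤ 1) (hw : ∀ j, ∫ ω, x j ω ∂coinMeasure = w) (hη : 0 < η) (hN : 0 < N) :
    coinMeasure.real {ω | η * N ≤ |∑ j ∈ Finset.range N, x j ω - N * w|} ≤ (N * η ^ 2)⁻¹ := by
  have hN' : (0 : ℝ) < N := by exact_mod_cast hN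
  have hL : ∀ j, MemLp (x j) 2 coinMeasure := fun j => memLp_of_dependsOn (hx j)
  have hm : ∫ ω, (∑ j ∈ Finset.range N, x j) ω ∂coinMeasure = N * w := by
    simp only [Finset.sum_apply]
    rw [integral_finsetSum _ fun j _ => integrable_of_dependsOn (hx j)]
    simp [hw]
  -- Pairwise independence makes the variances add up, and each of them is at most one.
  have hv : variance (∑ j ∈ Finset.range N, x j) coinMeasure ≤ N := by
    rw [IndepFun.variance_sum (fun j _ => hL j) fun i _ j _ hij =>
      indepFun_of_dependsOn (hx i) (hx j) (hI hij)]
    calc _ ≤ ∑ j ∈ Finset.range N, (1 : ℝ) := Finset.sum_le_sum fun j _ => ?_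
      _ = N := by simp
    refine (variance_le_expectation_sq (hL j).aestronglyMeasurable).trans ?_
    calc ∫ ω, (x j ^ 2) ω ∂coinMeasure ≤ ∫ ω, (1 : ℝ) ∂coinMeasure := by
          refine integral_mono (hL j).integrable_sq (integrable_const _) fun ω => ?_
          have := h1 j ω
          simp only [Pi.pow_apply]
          rw [← sq_abs]
          exact pow_le_one₀ (abs_nonneg _) this
      _ = 1 := by simp
  have := meas_ge_le_variance_div_sq (μ := coinMeasure) (X := ∑ j ∈ Finset.range N, x j)
    (memLp_finsetSum' _ fun j _ => hL j) (c := η * N) (by positivity)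
  rw [hm] at this
  simp only [Finset.sum_apply] at this
  rw [measureReal_def]
  refine ENNReal.toReal_le_of_le_ofReal (by positivity) (this.trans ?_)
  refine ENNReal.ofReal_le_ofReal ?_
  calc _ ≤ (N : ℝ) / (η * N) ^ 2 := by gcongr
    _ = _ := by field_simp

end Ram

/-! ### Sampling from the Fourier weights -/

namespace Ram

open MeasureTheory

/-- The sign of a bit. -/
def sign (b : Bool) : ℤ := if b then -1 else 1

/-- The character given by the first `M` bits of `z`. -/
def chi (M : ℕ) (z q : ℕ → Bool) : ℤ := ∏ i ∈ Finset.range M, sign (q i && z i)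

/-- Replace the first `l` bits of `q` by those of `q'`. -/
def mix (l : ℕ) (q q' : ℕ → Bool) (i : ℕ) : Bool := if i < l then q' i else q i

/-- A sample for the Fourier weight of `F` above the first `l` bits of `z`, taken from the coin
tosses with numbers from `c` on. -/
def smp (F : (ℕ → Bool) → ℤ) (M l : ℕ) (z : ℕ → Bool) (c : ℕ) (ω : ℕ → Bool) : ℤ :=
  F (fun i => ω (c + i)) * chi M z (fun i => ω (c + i)) *
    (F (mix l (fun i => ω (c + i)) fun i => ω (c + M + i)) *
      chi M z (mix l (fun i => ω (c + i)) fun i => ω (c + M + i)))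

/-- The Fourier weight of `F` above the first `l` bits of `z`. -/
noncomputable def weight (F : (ℕ → Bool) → ℤ) (M l : ℕ) (z : ℕ → Bool) : ℝ :=
  ∫ ω, (smp F M l z 0 ω : ℝ) ∂coinMeasure

/-- The Fourier coefficient of `F` at `z`. -/
noncomputable def coeff (F : (ℕ → Bool) → ℤ) (M : ℕ) (z : ℕ → Bool) : ℝ :=
  ∫ ω, (F ω * chi M z ω : ℝ) ∂coinMeasure

theorem sign_mul_self (b : Bool) : sign b * sign b = 1 := by cases b <;> rfl

theorem abs_sign (b : Bool) : |sign b| = 1 := by cases b <;> rfl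

theorem abs_chi (M : ℕ) (z q : ℕ → Bool) : |chi M z q| = 1 := by
  rw [chi, Finset.abs_prod]
  simp [abs_sign]

theorem sign_xorSum (f : ℕ → Bool) (i : ℕ) :
    sign (xorSum f i) = ∏ j ∈ Finset.range i, sign (f j) := by
  induction i with
  | zero => rfl
  | succ i ih =>
    rw [Finset.prod_range_succ, ← ih, xorSum]
    generalize xorSum f i = a, f i = b
    cases a <;> cases b <;> rfl

variable {F : (ℕ → Bool) → ℤ} {M l c : ℕ} {z z' : ℕ → Bool} {ω : ℕ → Bool}

theorem chi_eq_mul {i : ℕ} (hi : i < M) (z q : ℕ → Bool) :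
    chi M z q = sign (q i && z i) * ∏ j ∈ (Finset.range M).erase i, sign (q j && z j) :=
  (Finset.mul_prod_erase _ _ (Finset.mem_range.2 hi)).symm

theorem chi_update {i : ℕ} (hi : i < M) (z q : ℕ → Bool) (b : Bool) :
    chi M (Function.update z i b) q =
      sign (q i && b) * ∏ j ∈ (Finset.range M).erase i, sign (q j && z j) := by
  rw [chi_eq_mul hi, Function.update_self]
  congr 1
  refine Finset.prod_congr rfl fun j hj => ?_
  rw [Function.update_of_ne (Finset.ne_of_mem_erase hj)]

theorem chi_congr (h : ∀ i < M, z i = z' i) {q q' : ℕ → Bool} (hq : ∀ i < M, q i = q' i) :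
    chi M z q = chi M z' q' :=
  Finset.prod_congr rfl fun i hi => by rw [h i (Finset.mem_range.1 hi), hq i (Finset.mem_range.1 hi)]

/-- Only the factors at position `l` differ. If the two tosses for this position agree, then mixing
up to `l` and up to `l + 1` gives the same subset and both summands equal the sample on the right;
if they differ, the two summands cancel. -/
theorem smp_add (hl : l < M) (z : ℕ → Bool) (c : ℕ) (ω : ℕ → Bool) :
    smp F M (l + 1) (Function.update z l false) c ω + smp F M (l + 1) (Function.update z l true) c ω =
      smp F M l z c ω * (1 + sign (ω (c + l)) * sign (ω (c + M + l))) := by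
  simp only [smp, chi_update hl, chi_eq_mul hl z]
  generalize hq : (fun i => ω (c + i)) = q, hq' : (fun i => ω (c + M + i)) = q'
  have e1 : ω (c + l) = q l := by rw [← hq]
  have e2 : ω (c + M + l) = q' l := by rw [← hq']
  have e3 : mix (l + 1) q q' l = q' l := by simp [mix]
  have e4 : mix l q q' l = q l := by simp [mix]
  rw [e1, e2, e3, e4]
  by_cases h : q l = q' l
  · have e : mix (l + 1) q q' = mix l q q' := by
      funext i
      rcases lt_trichotomy i l with h1 | rfl | h1
      · simp [mix, h1, h1.trans (Nat.lt_succ_self l)]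
      · rw [e3, e4, h]
      · simp [mix, show ¬ i < l + 1 by omega, show ¬ i < l by omega]
    rw [e, ← h]
    generalize q l = a, z l = b
    cases a <;> cases b <;> simp [sign] <;> ring
  · have : q' l = !q l := by cases hh : q l <;> cases hh' : q' l <;> simp_all
    rw [this]
    generalize q l = a, z l = b
    cases a <;> simp [sign]

theorem dependsOn_smp (hF : DependsOn F (Finset.range M : Finset ℕ)) (hl : l ≤ M) :
    DependsOn (smp F M l z c) (Finset.Ico c (c + 2 * M) : Finset ℕ) := by
  intro x y h
  have h1 : ∀ i < M, x (c + i) = y (c + i) := fun i hi => h _ (by simp; omega)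
  have h2 : ∀ i < M, x (c + M + i) = y (c + M + i) := fun i hi => h _ (by simp; omega)
  have h3 : ∀ i < M, mix l (fun i => x (c + i)) (fun i => x (c + M + i)) i =
      mix l (fun i => y (c + i)) (fun i => y (c + M + i)) i := fun i hi => by
    simp only [mix, h1 i hi, h2 i hi]
  simp only [smp]
  rw [hF (x := fun i => x (c + i)) (y := fun i => y (c + i)) fun i hi => h1 i (by simpa using hi),
    hF (x := mix l (fun i => x (c + i)) (fun i => x (c + M + i)))
      (y := mix l (fun i => y (c + i)) (fun i => y (c + M + i))) fun i hi => h3 i (by simpa using hi),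
    chi_congr (fun _ _ => rfl) h1, chi_congr (fun _ _ => rfl) h3]

theorem dependsOn_comp {X Y : Type*} {f : (ℕ → Bool) → X} {s : Set ℕ} (hf : DependsOn f s)
    (g : X → Y) : DependsOn (fun ω => g (f ω)) s := fun _ _ h => congrArg g (hf h)

theorem dependsOn_smp_cast (hF : DependsOn F (Finset.range M : Finset ℕ)) (hl : l ≤ M) :
    DependsOn (fun ω => (smp F M l z c ω : ℝ)) (Finset.Ico c (c + 2 * M) : Finset ℕ) :=
  dependsOn_comp (dependsOn_smp hF hl) _

/-- The law of the tosses is invariant under shifts, so the position at which a sample starts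
reading is irrelevant. -/
theorem integral_smp (hF : DependsOn F (Finset.range M : Finset ℕ)) (hl : l ≤ M) (z : ℕ → Bool)
    (c : ℕ) : ∫ ω, (smp F M l z c ω : ℝ) ∂coinMeasure = weight F M l z := by
  rw [weight, ← coin_integral_injective (add_right_injective c)
    (dependsOn_smp_cast (z := z) (c := 0) hF hl)]
  simp only [smp, Nat.zero_add, Nat.add_assoc]

theorem abs_smp_le (h1 : ∀ q, |F q| ≤ 1) : |smp F M l z c ω| ≤ 1 := by
  simp only [smp, abs_mul, abs_chi, mul_one]
  exact mul_le_one₀ (h1 _) (abs_nonneg _) (h1 _)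

theorem weight_le_one (hF : DependsOn F (Finset.range M : Finset ℕ)) (hl : l ≤ M)
    (h1 : ∀ q, |F q| ≤ 1) (z : ℕ → Bool) : weight F M l z ≤ 1 := by
  calc weight F M l z ≤ ∫ ω, (1 : ℝ) ∂coinMeasure := by
        refine integral_mono (integrable_of_dependsOn (dependsOn_smp_cast hF hl))
          (integrable_const _) fun ω => ?_
        have := (le_abs_self _).trans (abs_smp_le (F := F) (M := M) (l := l) (z := z) (c := 0)
          (ω := ω) h1)
        show (smp F M l z 0 ω : ℝ) ≤ 1
        exact_mod_cast this
    _ = 1 := by simp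

/-- The mean of `smp_add`: the second term on its right carries the sign of toss `M + l`, which the
level-`l` sample does not use, so this term has mean zero. -/
theorem weight_add (hF : DependsOn F (Finset.range M : Finset ℕ)) (hl : l < M) (z : ℕ → Bool) :
    weight F M (l + 1) (Function.update z l false) + weight F M (l + 1) (Function.update z l true) =
      weight F M l z := by
  have d0 := dependsOn_smp_cast (z := z) (c := 0) hF hl.le
  rw [weight, weight, ← integral_add (integrable_of_dependsOn (dependsOn_smp_cast hF hl))
    (integrable_of_dependsOn (dependsOn_smp_cast hF hl))]
  have e : ∀ ω, (smp F M (l + 1) (Function.update z l false) 0 ω : ℝ) +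
      smp F M (l + 1) (Function.update z l true) 0 ω = smp F M l z 0 ω +
        (smp F M l z 0 ω * sign (ω l)) * sign (ω (M + l)) := fun ω => by
    have := smp_add (F := F) hl z 0 ω
    simp only [Nat.zero_add] at this
    have := congrArg (Int.cast : ℤ → ℝ) this
    push_cast at this
    rw [this]
    ring
  -- At level `l` only the first `l` tosses of the second block are used, so toss `M + l` can be
  -- removed.
  have d1 : DependsOn (fun ω : ℕ → Bool => (smp F M l z 0 ω * sign (ω l) : ℝ))
      ((Finset.range (2 * M)).erase (M + l) : Finset ℕ) := by
    intro x y h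
    have h1 : ∀ i < M, x (0 + i) = y (0 + i) := fun i hi => h _ (by simp; omega)
    have h2 : ∀ i < l, x (0 + M + i) = y (0 + M + i) := fun i hi => h _ (by simp; omega)
    have h3 : ∀ i < M, mix l (fun i => x (0 + i)) (fun i => x (0 + M + i)) i =
        mix l (fun i => y (0 + i)) (fun i => y (0 + M + i)) i := fun i hi => by
      simp only [mix]
      split_ifs with hil
      · exact h2 i hil
      · exact h1 i hi
    have : smp F M l z 0 x = smp F M l z 0 y := by
      simp only [smp]
      rw [hF (x := fun i => x (0 + i)) (y := fun i => y (0 + i)) fun i hi => by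
          exact h1 i (by simpa using hi),
        hF (x := mix l (fun i => x (0 + i)) (fun i => x (0 + M + i)))
          (y := mix l (fun i => y (0 + i)) (fun i => y (0 + M + i)))
            fun i hi => h3 i (by simpa using hi),
        chi_congr (q := fun i => x (0 + i)) (q' := fun i => y (0 + i)) (fun _ _ => rfl)
          h1, chi_congr (fun _ _ => rfl) h3]
    have hxy : x l = y l := by
      have := h1 l hl
      rwa [Nat.zero_add] at this
    simp only [this, hxy]
  have d2 : DependsOn (fun ω : ℕ → Bool => (sign (ω (M + l)) : ℝ)) ({M + l} : Finset ℕ) :=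
    fun x y h => by simp only [h (M + l) (by simp)]
  have hs : ∫ ω, (sign (ω (M + l)) : ℝ) ∂coinMeasure = 0 := by
    have := coin_integral_block (M + l) 1 fun r => (sign (r 0) : ℝ)
    simp only [Fin.val_zero, Nat.add_zero] at this
    rw [this, ← (Equiv.funUnique (Fin 1) Bool).symm.sum_comp]
    simp [sign]
  have d3 := coin_integral_mul d1 d2 (by simp)
  have d4 : DependsOn (fun ω : ℕ → Bool => (smp F M l z 0 ω * sign (ω l) * sign (ω (M + l)) : ℝ))
      (Finset.range (2 * M) : Finset ℕ) := by
    intro x y h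
    have h1 := d1 fun i hi => h i (by simp at hi ⊢; omega)
    have h2 := d2 fun i hi => h i (by simp at hi ⊢; omega)
    simp only at h1 h2 ⊢
    rw [h1, h2]
  simp only [e]
  rw [integral_add (integrable_of_dependsOn d0) (integrable_of_dependsOn d4), d3, hs, mul_zero,
    add_zero]
  rfl

/-- At the top level the second subset is resampled completely. The two factors are independent with
the same mean, the Fourier coefficient. -/
theorem weight_top (hF : DependsOn F (Finset.range M : Finset ℕ)) (z : ℕ → Bool) :
    weight F M M z = coeff F M z ^ 2 := by
  have d : DependsOn (fun ω => (F ω * chi M z ω : ℝ)) (Finset.range M : Finset ℕ) := fun x y h => by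
    have h' : ∀ i < M, x i = y i := fun i hi => h i (by simpa using hi)
    simp only [hF h, chi_congr (fun _ _ => rfl) h']
  have ds : ∀ a, DependsOn (fun ω : ℕ → Bool => (F (fun i => ω (a + i)) * chi M z fun i => ω (a + i) : ℝ))
      (Finset.Ico a (a + M) : Finset ℕ) := fun a x y h =>
    @d (fun i => x (a + i)) (fun i => y (a + i)) fun i hi => h (a + i) (by simp at hi ⊢; omega)
  have hc : ∀ a, ∫ ω, (F (fun i => ω (a + i)) * chi M z fun i => ω (a + i) : ℝ) ∂coinMeasure =
      coeff F M z := fun a => coin_integral_injective (add_right_injective a) d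
  have := coin_integral_mul (ds 0) (ds M) (by
    rw [Finset.disjoint_left]; simp only [Finset.mem_Ico]; omega)
  rw [hc, hc] at this
  rw [sq, ← this, weight]
  congr 1
  funext ω
  have e : ∀ i < M, mix M (fun i => ω (0 + i)) (fun i => ω (0 + M + i)) i = ω (M + i) :=
    fun i hi => by simp [mix, hi]
  rw [smp, hF (x := mix M (fun i => ω (0 + i)) fun i => ω (0 + M + i)) (y := fun i => ω (M + i))
    fun i hi => e i (by simpa using hi), chi_congr (fun _ _ => rfl) e]
  push_cast
  ring

/-- Weights of prefixes are sums of weights of complete strings, which are squares; the induction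
descends from the top level. -/
theorem weight_nonneg (hF : DependsOn F (Finset.range M : Finset ℕ)) (hl : l ≤ M) (z : ℕ → Bool) :
    0 ≤ weight F M l z := by
  induction hl using Nat.decreasingInduction generalizing z with
  | self => rw [weight_top hF]; positivity
  | of_succ l hl ih => rw [← weight_add hF hl]; exact add_nonneg (ih _) (ih _)

end Ram

/-! ### The probability of success of the search -/

namespace Ram

open MeasureTheory

/-! ### Random numbers and the accuracy of estimates -/

variable {s t : Finset ℕ}

theorem dependsOn_and {p q : (ℕ → Bool) → Prop} {s : Set ℕ} (hp : DependsOn p s)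
    (hq : DependsOn q s) : DependsOn (fun ω => p ω ∧ q ω) s :=
  fun _ _ h => congrArg₂ And (hp h) (hq h)

theorem coin_real_add {p q : (ℕ → Bool) → Prop} (hq : DependsOn q s) (h : ∀ ω, p ω → ¬ q ω) :
    coinMeasure.real {ω | p ω ∨ q ω} = coinMeasure.real {ω | p ω} + coinMeasure.real {ω | q ω} :=
  measureReal_union (Set.disjoint_left.2 h) (measurableSet_of_dependsOn hq)

theorem coin_real_not {p : (ℕ → Bool) → Prop} (hp : DependsOn p s) :
    coinMeasure.real {ω | ¬ p ω} = 1 - coinMeasure.real {ω | p ω} :=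
  probReal_compl_eq_one_sub (measurableSet_of_dependsOn hp)

open Classical in
theorem integral_ite {p : (ℕ → Bool) → Prop} (hp : DependsOn p s) :
    ∫ ω, (if p ω then (1 : ℝ) else 0) ∂coinMeasure = coinMeasure.real {ω | p ω} := by
  rw [← integral_indicator_one (measurableSet_of_dependsOn hp)]
  rfl

open Classical in
theorem integrable_ite {p : (ℕ → Bool) → Prop} (hp : DependsOn p s) :
    Integrable (fun ω => if p ω then (1 : ℝ) else 0) coinMeasure :=
  integrable_of_dependsOn (s := s) fun _ _ h => by simp only [hp h]

open Classical in
theorem sum_coin_real {ι : Type*} {U : Finset ι} {p : ι → (ℕ → Bool) → Prop}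
    (hp : ∀ u, DependsOn (p u) s) : ∑ u ∈ U, coinMeasure.real {ω | p u ω} =
      ∫ ω, ∑ u ∈ U, (if p u ω then (1 : ℝ) else 0) ∂coinMeasure := by
  rw [integral_finsetSum _ fun u _ => integrable_ite (hp u)]
  simp only [integral_ite (hp _)]

theorem draw_lt (ω : ℕ → Bool) (c i : ℕ) : draw ω c i < 2 ^ i := by
  induction i with
  | zero => simp [draw]
  | succ i ih =>
    rw [draw, pow_succ]
    have := Bool.toNat_le (ω (c + i))
    omega

theorem dependsOn_draw (c i : ℕ) :
    DependsOn (fun ω => draw ω c i) (Finset.Ico c (c + i) : Finset ℕ) := by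
  induction i with
  | zero => intro x y _; rfl
  | succ i ih =>
    intro x y h
    have h1 := ih fun j hj => h j (by simp at hj ⊢; omega)
    have h2 := h (c + i) (by simp)
    simp only [draw] at h1 ⊢
    rw [h1, h2]

theorem coin_real_draw {c i u : ℕ} (hu : u < 2 ^ i) :
    coinMeasure.real {ω | draw ω c i = u} = (2 ^ i)⁻¹ := by
  induction i generalizing u with
  | zero =>
    have : {ω : ℕ → Bool | draw ω c 0 = u} = Set.univ := by
      ext ω
      simp [draw]
      omega
    simp [this]
  | succ i ih =>
    -- The last digit drawn is the lowest one, so it is the parity of `u`, and the earlier digits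
    -- give `u / 2`.
    have e : {ω : ℕ → Bool | draw ω c (i + 1) = u} =
        {ω | draw ω c i = u / 2 ∧ ω (c + i) = decide (u % 2 = 1)} := by
      ext ω
      simp only [draw, Set.mem_ofPred_eq]
      by_cases h2 : u % 2 = 1 <;> cases ω (c + i) <;> simp [h2] <;> omega
    have d1 : DependsOn (fun ω => draw ω c i = u / 2) (Finset.Ico c (c + i) : Finset ℕ) :=
      dependsOn_comp (dependsOn_draw c i) (· = u / 2)
    have d2 : DependsOn (fun ω : ℕ → Bool => ω (c + i) = decide (u % 2 = 1))
        ({c + i} : Finset ℕ) := fun x y h => by simp only [h (c + i) (by simp)]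
    have h1 := coin_real_block (c + i) 1 fun _ => decide (u % 2 = 1)
    rw [e, coin_real_and d1 d2 (by simp), ih (by rw [pow_succ] at hu; omega), pow_succ, mul_inv]
    congr 1
    rw [pow_one] at h1
    rw [← h1]
    congr 1
    ext ω
    simp [funext_iff]

/-- Conditioning on the drawn number, which is uniform below `2 ^ L` and independent of the events
`q u`. -/
theorem coin_real_draw_and {q : ℕ → (ℕ → Bool) → Prop} {c L : ℕ} (hq : ∀ u, DependsOn (q u) t)
    (ht : Disjoint (Finset.Ico c (c + L)) t) : coinMeasure.real {ω | q (draw ω c L) ω} =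
      (2 ^ L)⁻¹ * ∑ u ∈ Finset.range (2 ^ L), coinMeasure.real {ω | q u ω} := by
  classical
  have d1 : ∀ u, DependsOn (fun ω => draw ω c L = u) (Finset.Ico c (c + L) : Finset ℕ) :=
    fun u => dependsOn_comp (dependsOn_draw c L) (· = u)
  have d2 : ∀ u, DependsOn (fun ω => draw ω c L = u ∧ q u ω)
      (Finset.Ico c (c + L) ∪ t : Finset ℕ) := fun u => dependsOn_and
    ((d1 u).mono (by simp)) ((hq u).mono (by simp))
  have d3 : DependsOn (fun ω => q (draw ω c L) ω) (Finset.Ico c (c + L) ∪ t : Finset ℕ) := by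
    intro x y h
    have h1 := dependsOn_draw c L fun i hi => h i (by simp at hi ⊢; tauto)
    simp only at h1 ⊢
    rw [h1]
    exact hq _ fun i hi => h i (by simp at hi ⊢; tauto)
  rw [Finset.mul_sum, Finset.sum_congr rfl fun u hu => by
    rw [← coin_real_draw (c := c) (Finset.mem_range.1 hu), ← coin_real_and (d1 u) (hq u) ht],
    sum_coin_real d2, ← integral_ite d3]
  congr 1
  funext ω
  rw [Finset.sum_eq_single (draw ω c L)]
  · simp
  · intro u _ hu
    rw [if_neg fun h => hu h.1.symm]
  · intro h
    exact absurd (Finset.mem_range.2 (draw_lt ω c L)) h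

/-- An estimate of `N` times the weight above the first `l` bits of `z`. -/
def estim (F : (ℕ → Bool) → ℤ) (M N : ℕ) (ω : ℕ → Bool) (l : ℕ) (z : ℕ → Bool) (c : ℕ) : ℕ :=
  (∑ j ∈ Finset.range N, smp F M l z (c + 2 * M * j) ω).toNat

variable {F : (ℕ → Bool) → ℤ} {M N L θ l c : ℕ} {z : ℕ → Bool} {η : ℝ}

theorem dependsOn_estim (hF : DependsOn F (Finset.range M : Finset ℕ)) (hl : l ≤ M) :
    DependsOn (fun ω => estim F M N ω l z c) (Finset.Ico c (c + 2 * M * N) : Finset ℕ) := by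
  intro x y h
  simp only [estim]
  congr 1
  refine Finset.sum_congr rfl fun j hj => dependsOn_smp hF hl fun i hi => h i ?_
  have hj' := Finset.mem_range.1 hj
  have : 2 * M * j + 2 * M ≤ 2 * M * N := by
    calc _ = 2 * M * (j + 1) := by ring
      _ ≤ _ := Nat.mul_le_mul_left _ hj'
  simp at hi ⊢
  omega

theorem estim_le (h1 : ∀ q, |F q| ≤ 1) (ω : ℕ → Bool) : estim F M N ω l z c ≤ N := by
  rw [estim, Int.toNat_le]
  calc _ ≤ ∑ j ∈ Finset.range N, (1 : ℤ) :=
        Finset.sum_le_sum fun j _ => (le_abs_self _).trans (abs_smp_le h1)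
    _ = N := by simp

/-- Chebyshev's inequality for the `N` independent samples. Cutting off a negative sum at zero does
not increase the error, because the true weight is nonnegative. -/
theorem coin_estim (hF : DependsOn F (Finset.range M : Finset ℕ)) (hl : l ≤ M)
    (h1 : ∀ q, |F q| ≤ 1) (hη : 0 < η) (hN : 0 < N) (z : ℕ → Bool) (c : ℕ) :
    coinMeasure.real {ω | η * N ≤ |(estim F M N ω l z c : ℝ) - N * weight F M l z|} ≤
      (N * η ^ 2)⁻¹ := by
  refine (measureReal_mono fun ω hω => ?_).trans (coin_chebyshev
    (x := fun j ω => (smp F M l z (c + 2 * M * j) ω : ℝ)) (w := weight F M l z)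
    (I := fun j => Finset.Ico (c + 2 * M * j) (c + 2 * M * j + 2 * M))
    (fun j => dependsOn_smp_cast hF hl) ?_ ?_ (fun j => integral_smp hF hl z _) hη hN)
  · simp only [Set.mem_ofPred_eq, estim] at hω ⊢
    refine hω.trans ?_
    have hw : 0 ≤ N * weight F M l z := mul_nonneg (by positivity) (weight_nonneg hF hl z)
    generalize hS : ∑ j ∈ Finset.range N, smp F M l z (c + 2 * M * j) ω = S
    have hS' : ∑ j ∈ Finset.range N, (smp F M l z (c + 2 * M * j) ω : ℝ) = S := by
      rw [← hS]; push_cast; rfl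
    rw [hS']
    have e : ((S.toNat : ℕ) : ℝ) = max (S : ℝ) 0 := by
      have : ((S.toNat : ℤ) : ℝ) = ((max S 0 : ℤ) : ℝ) := by rw [Int.toNat_eq_max]
      push_cast at this
      exact_mod_cast this
    rw [e]
    calc |max (S : ℝ) 0 - N * weight F M l z| =
          |max (S : ℝ) 0 - max (N * weight F M l z) 0| := by rw [max_eq_left hw]
      _ ≤ _ := abs_max_sub_max_le_abs _ _ _
  · intro i j hij
    refine Finset.disjoint_left.2 fun a ha hb => ?_
    simp only [Finset.mem_Ico] at ha hb
    rcases Nat.lt_or_gt_of_ne hij with h | h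
    · have := Nat.mul_le_mul_left (2 * M) (Nat.succ_le_of_lt h)
      rw [Nat.mul_succ] at this
      omega
    · have := Nat.mul_le_mul_left (2 * M) (Nat.succ_le_of_lt h)
      rw [Nat.mul_succ] at this
      omega
  · intro j ω
    have := abs_smp_le (F := F) (M := M) (l := l) (z := z) (c := c + 2 * M * j) (ω := ω) h1
    exact_mod_cast this

/-- Where the deviation is small the estimate exceeds the mean by at most `η * N`, and elsewhere it
is at most `N`. -/
theorem integral_estim_le (hF : DependsOn F (Finset.range M : Finset ℕ)) (hl : l ≤ M)
    (h1 : ∀ q, |F q| ≤ 1) (hη : 0 < η) (hN : 0 < N) (z : ℕ → Bool) (c : ℕ) :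
    ∫ ω, (estim F M N ω l z c : ℝ) ∂coinMeasure ≤
      N * (weight F M l z + η + (N * η ^ 2)⁻¹) := by
  classical
  have d := dependsOn_estim (N := N) (z := z) (c := c) hF hl
  have d2 : DependsOn (fun ω => η * N ≤ |(estim F M N ω l z c : ℝ) - N * weight F M l z|)
      (Finset.Ico c (c + 2 * M * N) : Finset ℕ) :=
    dependsOn_comp d fun e : ℕ => η * N ≤ |(e : ℝ) - N * weight F M l z|
  have hw := weight_nonneg hF hl z
  calc _ ≤ ∫ ω, (N * (weight F M l z + η) + N *
          if η * N ≤ |(estim F M N ω l z c : ℝ) - N * weight F M l z| then (1 : ℝ) else 0)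
            ∂coinMeasure := by
        refine integral_mono (integrable_of_dependsOn (dependsOn_comp d _))
          ((integrable_const _).add ((integrable_ite d2).const_mul _)) fun ω => ?_
        split_ifs with h
        · have : (estim F M N ω l z c : ℝ) ≤ N := by exact_mod_cast estim_le h1 ω
          have : (0 : ℝ) ≤ N * (weight F M l z + η) := by positivity
          linarith
        · have := (abs_lt.1 (not_le.1 h)).2
          linarith
    _ = N * (weight F M l z + η) +
        N * coinMeasure.real {ω | η * N ≤ |(estim F M N ω l z c : ℝ) - N * weight F M l z|} := by
      rw [integral_add (integrable_const _) ((integrable_ite d2).const_mul _), ← integral_ite d2,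
        ← integral_const_mul (N : ℝ)]
      simp
    _ ≤ _ := by
      have := mul_le_mul_of_nonneg_left (coin_estim hF hl h1 hη hN z c) (Nat.cast_nonneg (α := ℝ) N)
      linarith

/-- The first `i` bits of `z`. -/
def pre (z : ℕ → Bool) (i j : ℕ) : Bool := decide (j < i) && z j

theorem update_pre (z : ℕ → Bool) (i : ℕ) : Function.update (pre z i) i false = pre z i := by
  simp [pre]

theorem pre_succ (z : ℕ → Bool) (i : ℕ) :
    pre z (i + 1) = Function.update (pre z i) i (z i) := by
  funext j
  rcases lt_trichotomy j i with h | rfl | h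
  · simp [pre, h, h.ne, h.trans (Nat.lt_succ_self i)]
  · simp [pre]
  · rw [Function.update_of_ne h.ne']
    simp [pre, show ¬ j < i + 1 by omega, show ¬ j < i by omega]

/-! ### Intervals of random numbers belonging to a string -/

section Walk

variable {E : ℕ → (ℕ → Bool) → ℕ → ℕ} {D u : ℕ}

/-- The lower end of the interval of random numbers that lead to the first bits of `z`. -/
def offset (E : ℕ → (ℕ → Bool) → ℕ → ℕ) (D c : ℕ) (z : ℕ → Bool) : ℕ → ℕ
  | 0 => 0
  | i + 1 => offset E D c z i + if z i then E (i + 1) (pre z i) (c + D * i) else 0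

/-- An upper bound for `u` is needed only at the zero bits. At a one bit the walk turns the right
way because `offset` increases, so `hu` also bounds the earlier offsets. -/
theorem walk_eq (h : ∀ i < l, z i = false → u < offset E D c z i + E (i + 1) (pre z i) (c + D * i))
    (hu : offset E D c z l ≤ u) : walk E D c u l = (pre z l, u - offset E D c z l) := by
  induction l with
  | zero => simp [walk, offset, pre, funext_iff]
  | succ l ih =>
    have h1 : offset E D c z l ≤ u := by rw [offset] at hu; omega
    simp only [walk, ih (fun i hi => h i (hi.trans (Nat.lt_succ_self l))) h1, update_pre, pre_succ]
    cases hz : z l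
    · have := h l (Nat.lt_succ_self l) hz
      rw [if_pos (by omega)]
      simp [offset, hz, update_pre]
    · rw [offset, hz, if_pos rfl] at hu
      rw [if_neg (by omega), offset, hz, if_pos rfl, Nat.sub_sub]

theorem walk_fst_of_le {i j : ℕ} (h : i ≤ j) : (walk E D c u i).1 j = false := by
  induction i with
  | zero => rfl
  | succ i ih =>
    have := ih (by omega)
    simp only [walk]
    split_ifs <;> simp only [Function.update_of_ne (show j ≠ i by omega), this]

theorem walk_fst (i : ℕ) : (walk E D c u i).1 = pre (walk E D c u i).1 i := by
  funext j
  by_cases h : j < i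
  · simp [pre, h]
  · simp [pre, h, walk_fst_of_le (not_lt.1 h)]

/-- A converse of `walk_eq` that needs no accuracy of the estimates. With the test on the rest it
confines `u` to an interval whose length is the final estimate. -/
theorem of_walk_eq (h : (walk E D c u l).1 = pre z l) :
    offset E D c z l ≤ u ∧ (walk E D c u l).2 = u - offset E D c z l := by
  induction l with
  | zero => simp [offset, walk]
  | succ l ih =>
    have h' : (walk E D c u l).1 = pre z l := by
      funext j
      by_cases hj : j < l
      · have := congrFun h j
        simp only [walk] at this
        split_ifs at this <;> simp only [Function.update_of_ne hj.ne] at this <;>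
          simpa [pre, hj, hj.trans (Nat.lt_succ_self l)] using this
      · rw [walk_fst_of_le (not_lt.1 hj)]
        simp [pre, hj]
    obtain ⟨h1, h2⟩ := ih h'
    have hz := congrFun h l
    simp only [walk, h', update_pre, h2] at hz ⊢
    have e : pre z (l + 1) l = z l := by simp [pre]
    rw [e] at hz
    split_ifs at hz ⊢ with hlt
    · have : z l = false := by rw [← hz]; simp [pre]
      simp [offset, this, h1]
    · have : z l = true := by rw [← hz]; simp
      simp only [offset, this, if_true]
      omega

end Walk

/-- The number of coin tosses of an estimate. -/
abbrev estimCoins (M N : ℕ) : ℕ := 2 * M * N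

/-- The number of coin tosses of an attempt. -/
abbrev attemptCoins (M N L : ℕ) : ℕ := L + estimCoins M N * (M + 1)

theorem dependsOn_walk (hF : DependsOn F (Finset.range M : Finset ℕ)) (hl : l ≤ M) (u c : ℕ) :
    DependsOn (fun ω => walk (estim F M N ω) (estimCoins M N) c u l)
      (Finset.Ico c (c + estimCoins M N * l) : Finset ℕ) := by
  induction l with
  | zero => intro x y _; rfl
  | succ l ih =>
    intro x y h
    have h1 := ih (by omega) fun i hi => h i (by
      simp only [estimCoins, Nat.mul_succ, Finset.coe_Ico, Set.mem_Ico] at hi ⊢; omega)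
    simp only at h1
    have h2 : ∀ z, estim F M N x (l + 1) z (c + estimCoins M N * l) =
        estim F M N y (l + 1) z (c + estimCoins M N * l) := fun z =>
      dependsOn_estim (z := z) hF hl fun i hi => h i (by
        simp only [estimCoins, Nat.mul_succ, Finset.coe_Ico, Set.mem_Ico] at hi ⊢; omega)
    simp only [walk, h1, h2]

theorem dependsOn_offset (hF : DependsOn F (Finset.range M : Finset ℕ)) (hl : l ≤ M) (c : ℕ)
    (z : ℕ → Bool) : DependsOn (fun ω => offset (estim F M N ω) (estimCoins M N) c z l)
      (Finset.Ico c (c + estimCoins M N * l) : Finset ℕ) := by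
  induction l with
  | zero => intro x y _; rfl
  | succ l ih =>
    intro x y h
    have h1 := ih (by omega) fun i hi => h i (by
      simp only [estimCoins, Nat.mul_succ, Finset.coe_Ico, Set.mem_Ico] at hi ⊢; omega)
    simp only at h1
    have h2 : ∀ z, estim F M N x (l + 1) z (c + estimCoins M N * l) =
        estim F M N y (l + 1) z (c + estimCoins M N * l) := fun z =>
      dependsOn_estim (z := z) hF hl fun i hi => h i (by
        simp only [estimCoins, Nat.mul_succ, Finset.coe_Ico, Set.mem_Ico] at hi ⊢; omega)
    simp only [offset, h1, h2]

/-- Attempts read disjoint ranges of tosses, which makes them independent. -/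
theorem dependsOn_attempt (hF : DependsOn F (Finset.range M : Finset ℕ)) (c : ℕ) :
    DependsOn (fun ω => attempt (estim F M N ω) ω M (estimCoins M N) L θ c)
      (Finset.Ico c (c + attemptCoins M N L) : Finset ℕ) := by
  intro x y h
  have h1 := dependsOn_draw c L fun i hi => h i (by
    simp only [estimCoins, attemptCoins, Nat.mul_succ, Finset.coe_Ico, Set.mem_Ico] at hi ⊢; omega)
  have h2 := fun u => dependsOn_walk (N := N) hF le_rfl u (c + L) fun i hi => h i (by
    simp only [estimCoins, attemptCoins, Nat.mul_succ, Finset.coe_Ico, Set.mem_Ico] at hi ⊢; omega)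
  have h3 := fun z => dependsOn_estim (N := N) (z := z) (c := c + L + estimCoins M N * M) hF le_rfl
    fun i hi => h i (by
    simp only [estimCoins, attemptCoins, Nat.mul_succ, Finset.coe_Ico, Set.mem_Ico] at hi ⊢; omega)
  simp only at h1 h2 h3
  simp only [attempt, h1, h2, h3]

theorem dependsOn_search (hF : DependsOn F (Finset.range M : Finset ℕ)) (j c : ℕ) :
    DependsOn (fun ω => search (estim F M N ω) ω M (estimCoins M N) L θ j c)
      (Finset.Ico c (c + attemptCoins M N L * j) : Finset ℕ) := by
  induction j generalizing c with
  | zero => intro x y _; rfl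
  | succ j ih =>
    intro x y h
    have h1 := dependsOn_attempt (N := N) (L := L) (θ := θ) hF c fun i hi => h i (by
      simp only [estimCoins, attemptCoins, Nat.mul_succ, Finset.coe_Ico, Set.mem_Ico] at hi ⊢; omega)
    have h2 := ih (c + attemptCoins M N L) fun i hi => h i (by
      simp only [estimCoins, attemptCoins, Nat.mul_succ, Finset.coe_Ico, Set.mem_Ico] at hi ⊢; omega)
    simp only at h1 h2
    simp only [search, h1, h2]

end Ram

/-! ### Success and acceptance probabilities of attempts -/

namespace Ram

open MeasureTheory

variable {F : (ℕ → Bool) → ℤ} {M N L θ l c : ℕ} {z : ℕ → Bool} {η : ℝ}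

/-- If all estimates on the way to the first bits of `z` are good, then the end of the interval
for `z` is not far from the end of any interval that contains it. -/
theorem offset_add_le {ω : ℕ → Bool} (hF : DependsOn F (Finset.range M : Finset ℕ)) (hη : 0 ≤ η)
    (hgood : ∀ i < M, (estim F M N ω (i + 1) (pre z i) (c + estimCoins M N * i) : ℝ) ≤
      N * weight F M (i + 1) (pre z i) + η * N) {i j : ℕ} (hi : i + j ≤ M) :
    (offset (estim F M N ω) (estimCoins M N) c z (i + j) : ℝ) +
      N * weight F M (i + j) (pre z (i + j)) ≤
      offset (estim F M N ω) (estimCoins M N) c z i + N * weight F M i (pre z i) + j * (η * N) := by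
  induction j with
  | zero => simp
  | succ j ih =>
    have h1 := ih (by omega)
    have h2 := hgood (i + j) (by omega)
    have h3 := weight_add hF (show i + j < M by omega) (pre z (i + j))
    have h4 : 0 ≤ weight F M (i + j + 1) (Function.update (pre z (i + j)) (i + j) true) :=
      weight_nonneg hF (by omega) _
    have h5 : 0 ≤ η * N := by positivity
    have hN : (0 : ℝ) ≤ N := by positivity
    rw [← Nat.add_assoc, offset, pre_succ]
    rw [update_pre] at h3
    -- At a zero bit the offset stays and the weight can only drop. At a one bit the offset grows by
    -- the estimate for the other child, and the true weights of both children add up to that of the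
    -- parent.
    cases hz : z (i + j)
    · rw [update_pre]
      have := mul_le_mul_of_nonneg_left (le_of_le_of_eq (le_add_of_nonneg_right h4) h3) hN
      push_cast
      linarith
    · have : (N : ℝ) * weight F M (i + j + 1) (pre z (i + j)) +
          N * weight F M (i + j + 1) (Function.update (pre z (i + j)) (i + j) true) =
            N * weight F M (i + j) (pre z (i + j)) := by rw [← mul_add, h3]
      simp only [if_true]
      push_cast
      linarith

theorem disjoint_Ico (a b d : ℕ) : Disjoint (Finset.Ico a b) (Finset.Ico b d) :=
  Finset.disjoint_left.2 fun i hi hj => by simp only [Finset.mem_Ico] at hi hj; omega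

/-- An attempt finds every string whose weight is not too small. -/
theorem le_coin_attempt (hF : DependsOn F (Finset.range M : Finset ℕ)) (h1 : ∀ q, |F q| ≤ 1)
    (hη : 0 < η) {d : ℕ} (hd : d + (M + 1) * (η * (2 ^ L : ℕ)) ≤
      (2 ^ L : ℕ) * weight F M M (pre z M))
    (hθ : θ + η * (2 ^ L : ℕ) ≤ (2 ^ L : ℕ) * weight F M M (pre z M)) (c : ℕ) :
    (2 ^ L : ℝ)⁻¹ * (d * (1 - (M + 1) * (((2 ^ L : ℕ) : ℝ) * η ^ 2)⁻¹)) ≤ coinMeasure.real {ω |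
      attempt (estim F M (2 ^ L) ω) ω M (estimCoins M (2 ^ L)) L θ c = some (pre z M)} := by
  classical
  obtain ⟨N, hN⟩ : ∃ N, N = 2 ^ L := ⟨_, rfl⟩
  have hN0 : 0 < N := by rw [hN]; positivity
  rw [← hN] at hd hθ ⊢
  have hηN : 0 ≤ η * N := by positivity
  -- Index `i < M` stands for the estimate at level `i + 1` on the way to `z`, and `i = M` for the
  -- final test, again at level `M`.
  obtain ⟨lev, hlev⟩ : ∃ lev : ℕ → ℕ, lev = fun i => min (i + 1) M := ⟨_, rfl⟩
  have hlevM : ∀ i, lev i ≤ M := fun i => by rw [hlev]; exact min_le_right _ _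
  obtain ⟨bad, hbad⟩ : ∃ bad : ℕ → (ℕ → Bool) → Prop, bad = fun i ω => η * N ≤
    |(estim F M N ω (lev i) (pre z i) (c + L + estimCoins M N * i) : ℝ) -
      N * weight F M (lev i) (pre z i)| := ⟨_, rfl⟩
  obtain ⟨s, hs⟩ : ∃ s : (ℕ → Bool) → ℕ, s = fun ω =>
    offset (estim F M N ω) (estimCoins M N) (c + L) z M := ⟨_, rfl⟩
  set T := Finset.Ico (c + L) (c + attemptCoins M N L) with hT
  have dbad : ∀ i < M + 1, DependsOn (bad i) T := fun i hi => by
    rw [hbad]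
    refine (dependsOn_comp (dependsOn_estim (N := N) (z := pre z i) (c := c + L +
      estimCoins M N * i) hF (hlevM i)) fun e : ℕ => η * N ≤
        |(e : ℝ) - N * weight F M (lev i) (pre z i)|).mono fun a ha => ?_
    have := Nat.mul_le_mul_left (estimCoins M N) (show i + 1 ≤ M + 1 from hi)
    rw [Nat.mul_succ] at this
    simp only [hT, attemptCoins, Finset.coe_Ico, Set.mem_Ico] at ha ⊢
    simp only [estimCoins] at *
    omega
  have ds : DependsOn s T := by
    rw [hs]
    refine (dependsOn_offset hF le_rfl (c + L) z).mono fun a ha => ?_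
    simp only [hT, attemptCoins, Nat.mul_succ, Finset.coe_Ico, Set.mem_Ico] at ha ⊢
    omega
  have dgood : DependsOn (fun ω => ∃ i < M + 1, bad i ω) T := by
    intro x y h
    refine propext (exists_congr fun i => and_congr_right fun hi => ?_)
    rw [dbad i hi h]
  have hgood : 1 - (M + 1) * (N * η ^ 2)⁻¹ ≤ coinMeasure.real {ω | ¬ ∃ i < M + 1, bad i ω} := by
    rw [coin_real_not dgood]
    have : coinMeasure.real {ω | ∃ i < M + 1, bad i ω} ≤ (M + 1) * (N * η ^ 2)⁻¹ := by
      have e : {ω | ∃ i < M + 1, bad i ω} = ⋃ i ∈ Finset.range (M + 1), {ω | bad i ω} := by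
        ext ω
        simp
      rw [e]
      refine (measureReal_biUnion_finset_le _ _).trans ?_
      calc _ ≤ ∑ i ∈ Finset.range (M + 1), ((N : ℝ) * η ^ 2)⁻¹ :=
            Finset.sum_le_sum fun i _ => by
              rw [hbad]; exact coin_estim hF (hlevM i) h1 hη hN0 _ _
        _ = _ := by simp
    linarith
  have dq : ∀ u, DependsOn (fun ω => (¬ ∃ i < M + 1, bad i ω) ∧ s ω ≤ u ∧ u < s ω + d) T :=
    fun u x y h => by
      have e1 := dgood h
      have e2 := ds h
      simp only at e1
      simp only [e1, e2]
  -- If all estimates are good, each of the `d` numbers from `s ω` on leads to the acceptance of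
  -- `z`. Both `s` and the estimates use other tosses than the draw.
  have key : ∀ ω, (¬ ∃ i < M + 1, bad i ω) → s ω + d ≤ N ∧ ∀ u, s ω ≤ u → u < s ω + d →
      draw ω c L = u → attempt (estim F M N ω) ω M (estimCoins M N) L θ c = some (pre z M) := by
    intro ω hω
    have hg : ∀ i < M + 1, |(estim F M N ω (lev i) (pre z i) (c + L + estimCoins M N * i) : ℝ) -
        N * weight F M (lev i) (pre z i)| < η * N := fun i hi => by
      refine not_le.1 fun h => hω ⟨i, hi, ?_⟩
      rw [hbad]; exact h
    have hg1 : ∀ i < M, |(estim F M N ω (i + 1) (pre z i) (c + L + estimCoins M N * i) : ℝ) -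
        N * weight F M (i + 1) (pre z i)| < η * N := fun i hi => by
      have := hg i (by omega)
      rwa [show lev i = i + 1 by rw [hlev]; exact min_eq_left hi] at this
    have hgM := hg M (by omega)
    rw [show lev M = M by rw [hlev]; exact min_eq_right (by omega)] at hgM
    have hoff : ∀ i j, i + j ≤ M → _ := fun i j hij => offset_add_le (N := N) (c := c + L) (z := z)
      (ω := ω) hF hη.le (fun i hi => by have := (abs_lt.1 (hg1 i hi)).2; linarith) hij
    have hsω : s ω = offset (estim F M N ω) (estimCoins M N) (c + L) z M := by rw [hs]
    rw [← hsω.symm] at *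
    refine ⟨?_, fun u hu hu' hdraw => ?_⟩
    · have h2 := hoff 0 M (by omega)
      -- The total weight is at most one, which keeps the interval below `N`, within the range of
      -- the drawn number.
      have h3 : weight F M 0 (pre z 0) ≤ 1 := weight_le_one hF (by omega) h1 _
      have h4 := mul_le_mul_of_nonneg_left h3 (Nat.cast_nonneg (α := ℝ) N)
      simp only [Nat.zero_add, offset, Nat.cast_zero] at h2
      rw [hsω]
      have : ((offset (estim F M N ω) (estimCoins M N) (c + L) z M + d : ℕ) : ℝ) ≤ N := by
        push_cast
        linarith
      exact_mod_cast this
    · rw [hsω] at hu hu'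
      have hw : walk (estim F M N ω) (estimCoins M N) (c + L) u M =
          (pre z M, u - offset (estim F M N ω) (estimCoins M N) (c + L) z M) := by
        refine walk_eq (fun i hi hz => lt_of_lt_of_le hu' ?_) hu
        -- The errors telescope from level `i + 1` to the leaf: the interval for the zero child
        -- contains the `d` numbers belonging to `z`.
        have h2 := hoff (i + 1) (M - (i + 1)) (by omega)
        rw [show i + 1 + (M - (i + 1)) = M by omega, pre_succ, hz, update_pre, offset, hz,
          if_neg (by simp), Nat.add_zero] at h2
        have h3 := (abs_lt.1 (hg1 i hi)).1
        have h4 : ((M - (i + 1) : ℕ) : ℝ) * (η * N) ≤ M * (η * N) :=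
          mul_le_mul_of_nonneg_right (by exact_mod_cast Nat.sub_le _ _) hηN
        have : ((offset (estim F M N ω) (estimCoins M N) (c + L) z M + d : ℕ) : ℝ) ≤
            ((offset (estim F M N ω) (estimCoins M N) (c + L) z i +
              estim F M N ω (i + 1) (pre z i) (c + L + estimCoins M N * i) : ℕ) : ℝ) := by
          push_cast
          linarith
        exact_mod_cast this
      have h3 := (abs_lt.1 hgM).1
      have h5 : (0 : ℝ) ≤ M * (η * N) := by positivity
      have h6 : (d : ℝ) ≤ estim F M N ω M (pre z M) (c + L + estimCoins M N * M) := by linarith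
      have h7 : (θ : ℝ) ≤ estim F M N ω M (pre z M) (c + L + estimCoins M N * M) := by linarith
      have h6 : d ≤ estim F M N ω M (pre z M) (c + L + estimCoins M N * M) := by exact_mod_cast h6
      have h7 : θ ≤ estim F M N ω M (pre z M) (c + L + estimCoins M N * M) := by exact_mod_cast h7
      simp only [attempt, hdraw, hw]
      rw [if_pos ⟨by omega, h7⟩]
  calc (2 ^ L : ℝ)⁻¹ * (d * (1 - (M + 1) * (N * η ^ 2)⁻¹))
      ≤ (2 ^ L : ℝ)⁻¹ * (d * coinMeasure.real {ω | ¬ ∃ i < M + 1, bad i ω}) := by gcongr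
    _ = (2 ^ L : ℝ)⁻¹ * ∑ u ∈ Finset.range (2 ^ L), coinMeasure.real
          {ω | (¬ ∃ i < M + 1, bad i ω) ∧ s ω ≤ u ∧ u < s ω + d} := by
      congr 1
      rw [sum_coin_real dq, ← integral_ite (dependsOn_comp dgood Not), ← integral_const_mul]
      congr 1
      funext ω
      by_cases hω : ∃ i < M + 1, bad i ω
      · rw [if_neg (not_not.2 hω), mul_zero, Finset.sum_eq_zero]
        exact fun u _ => if_neg fun h => h.1 hω
      · have hle := (key ω hω).1
        simp only [hω, not_false_eq_true, true_and, if_true, mul_one]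
        rw [Finset.sum_boole]
        have : (Finset.range (2 ^ L)).filter (fun u => s ω ≤ u ∧ u < s ω + d) =
            Finset.Ico (s ω) (s ω + d) := by
          ext u
          simp only [Finset.mem_filter, Finset.mem_range, Finset.mem_Ico]
          omega
        rw [this]
        simp
    _ = coinMeasure.real {ω | (¬ ∃ i < M + 1, bad i ω) ∧ s ω ≤ draw ω c L ∧
          draw ω c L < s ω + d} := (coin_real_draw_and dq (disjoint_Ico _ _ _)).symm
    _ ≤ _ := measureReal_mono fun ω hω => (key ω hω.1).2 _ hω.2.1 hω.2.2 rfl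

/-- A string as an infinite sequence. -/
def ext (v : Fin M → Bool) (i : ℕ) : Bool := if h : i < M then v ⟨i, h⟩ else false

theorem pre_ext (v : Fin M → Bool) : pre (ext v) M = ext v := by
  funext i
  by_cases h : i < M <;> simp [pre, ext, h]

theorem exists_ext (h : z = pre z M) : ∃ v : Fin M → Bool, z = ext v := by
  refine ⟨fun i => z i, ?_⟩
  rw [h]
  funext i
  by_cases h : i < M <;> simp [pre, ext, h]

theorem ext_injective : Function.Injective (ext : (Fin M → Bool) → ℕ → Bool) := fun v v' h => by
  funext i
  simpa [ext] using congrFun h i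

/-- An attempt rarely accepts if the set `G` of strings that are not of small weight has small
total weight. -/
theorem coin_attempt_le (hF : DependsOn F (Finset.range M : Finset ℕ)) (h1 : ∀ q, |F q| ≤ 1)
    (hη : 0 < η) {G : Finset (Fin M → Bool)} (hG : ∀ v ∉ G,
      (2 ^ L : ℕ) * weight F M M (ext v) + η * (2 ^ L : ℕ) ≤ θ) (c : ℕ) :
    coinMeasure.real {ω | attempt (estim F M (2 ^ L) ω) ω M (estimCoins M (2 ^ L)) L θ c ≠ none} ≤
      ∑ v ∈ G, (weight F M M (ext v) + η + (((2 ^ L : ℕ) : ℝ) * η ^ 2)⁻¹) +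
        (((2 ^ L : ℕ) : ℝ) * η ^ 2)⁻¹ := by
  classical
  obtain ⟨N, hN⟩ : ∃ N, N = 2 ^ L := ⟨_, rfl⟩
  have hN0 : 0 < N := by rw [hN]; positivity
  rw [← hN] at hG ⊢
  obtain ⟨W, hW⟩ : ∃ W : (ℕ → Bool) → (ℕ → Bool) × ℕ, W = fun ω =>
    walk (estim F M N ω) (estimCoins M N) (c + L) (draw ω c L) M := ⟨_, rfl⟩
  obtain ⟨e, he⟩ : ∃ e : (Fin M → Bool) → (ℕ → Bool) → ℕ, e = fun v ω =>
    estim F M N ω M (ext v) (c + L + estimCoins M N * M) := ⟨_, rfl⟩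
  have dW : DependsOn W (Finset.Ico c (c + L + estimCoins M N * M) : Finset ℕ) := by
    intro x y h
    have h1 := dependsOn_draw c L fun i hi => h i (by
      simp only [Finset.coe_Ico, Set.mem_Ico] at hi ⊢; omega)
    have h2 := fun u => dependsOn_walk (N := N) hF le_rfl u (c + L) fun i hi => h i (by
      simp only [Finset.coe_Ico, Set.mem_Ico] at hi ⊢; omega)
    simp only at h1 h2
    rw [hW]
    simp only [h1, h2]
  have de : ∀ v, DependsOn (e v) (Finset.Ico (c + L + estimCoins M N * M)
      (c + L + estimCoins M N * M + 2 * M * N) : Finset ℕ) := fun v => by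
    rw [he]; exact dependsOn_estim hF le_rfl
  -- An accepted string in `G` is charged to the test on the rest, and one outside `G` to the
  -- threshold.
  have hsub : {ω | attempt (estim F M N ω) ω M (estimCoins M N) L θ c ≠ none} ⊆
      (⋃ v ∈ G, {ω | (W ω).1 = ext v ∧ (W ω).2 < e v ω}) ∪
        ⋃ v ∈ Gᶜ, {ω | (W ω).1 = ext v ∧ θ ≤ e v ω} := by
    intro ω hω
    simp only [Set.mem_ofPred_eq, attempt] at hω
    obtain ⟨v, hv⟩ := exists_ext (M := M) (walk_fst (E := estim F M N ω) (D := estimCoins M N)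
      (c := c + L) (u := draw ω c L) M)
    rw [hv] at hω
    have hacc := (ite_ne_right_iff.1 hω).1
    have hv' : (W ω).1 = ext v := by rw [hW]; exact hv
    have h2 : (W ω).2 < e v ω := by rw [hW, he]; exact hacc.1
    have h3 : θ ≤ e v ω := by rw [he]; exact hacc.2
    simp only [Set.mem_union, Set.mem_iUnion, Finset.mem_compl]
    by_cases hvG : v ∈ G
    · exact Or.inl ⟨v, hvG, hv', h2⟩
    · exact Or.inr ⟨v, hvG, hv', h3⟩
  refine (measureReal_mono hsub).trans ((measureReal_union_le _ _).trans (add_le_add ?_ ?_))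
  · refine (measureReal_biUnion_finset_le _ _).trans (Finset.sum_le_sum fun v _ => ?_)
    obtain ⟨s, hs⟩ : ∃ s : (ℕ → Bool) → ℕ, s = fun ω =>
      offset (estim F M N ω) (estimCoins M N) (c + L) (ext v) M := ⟨_, rfl⟩
    set T := Finset.Ico (c + L) (c + attemptCoins M N L) with hT
    have dq : ∀ u, DependsOn (fun ω => s ω ≤ u ∧ u < s ω + e v ω) T := fun u x y h => by
      have e1 : s x = s y := by
        rw [hs]
        refine dependsOn_offset hF le_rfl (c + L) (ext v) fun i hi => h i ?_
        simp only [hT, attemptCoins, Nat.mul_succ, Finset.coe_Ico, Set.mem_Ico] at hi ⊢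
        omega
      have e2 : e v x = e v y := de v fun i hi => h i (by
        simp only [hT, attemptCoins, estimCoins, Nat.mul_succ, Finset.coe_Ico,
          Set.mem_Ico] at hi ⊢
        omega)
      simp only [e1, e2]
    calc coinMeasure.real {ω | (W ω).1 = ext v ∧ (W ω).2 < e v ω}
        ≤ coinMeasure.real {ω | s ω ≤ draw ω c L ∧ draw ω c L < s ω + e v ω} := by
          refine measureReal_mono fun ω hω => ?_
          obtain ⟨h2, h3⟩ := hω
          rw [hW] at h2 h3
          have := of_walk_eq (h2.trans (pre_ext v).symm)
          rw [this.2] at h3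
          simp only [Set.mem_ofPred_eq, hs]
          omega
      _ = (2 ^ L : ℝ)⁻¹ * ∑ u ∈ Finset.range (2 ^ L), coinMeasure.real
            {ω | s ω ≤ u ∧ u < s ω + e v ω} := coin_real_draw_and dq (disjoint_Ico _ _ _)
      -- At most `e v ω` values of `u` lie in an interval of this length, so the probability is at
      -- most the mean estimate divided by `N`.
      _ ≤ (2 ^ L : ℝ)⁻¹ * ∫ ω, (e v ω : ℝ) ∂coinMeasure := by
        gcongr
        rw [sum_coin_real dq]
        refine integral_mono (integrable_finsetSum _ fun u _ => integrable_ite (dq u))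
          (integrable_of_dependsOn (dependsOn_comp (de v) _)) fun ω => ?_
        have h0 := Finset.sum_boole (R := ℝ) (fun u => s ω ≤ u ∧ u < s ω + e v ω)
          (Finset.range (2 ^ L))
        refine (Finset.sum_congr rfl fun u _ => by split_ifs <;> rfl).trans_le (h0.le.trans
          (Nat.cast_le.2 ((Finset.card_le_card (t := Finset.Ico (s ω) (s ω + e v ω))
            fun u hu => ?_).trans (by simp))))
        simp only [Finset.mem_filter, Finset.mem_Ico] at hu ⊢
        exact hu.2
      _ ≤ (2 ^ L : ℝ)⁻¹ * (N * (weight F M M (ext v) + η + (N * η ^ 2)⁻¹)) := by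
        gcongr
        rw [he]
        exact integral_estim_le hF le_rfl h1 hη hN0 _ _
      _ = _ := by
        rw [hN]
        push_cast
        rw [inv_mul_cancel_left₀ (by positivity)]
  · refine (measureReal_biUnion_finset_le _ _).trans ?_
    have dv : ∀ v : Fin M → Bool, DependsOn (fun ω => (W ω).1 = ext v)
      (Finset.Ico c (c + L + estimCoins M N * M) : Finset ℕ) := fun v =>
        dependsOn_comp dW fun w => w.1 = ext v
    have hβ : (0 : ℝ) ≤ (N * η ^ 2)⁻¹ := by positivity
    calc ∑ v ∈ Gᶜ, coinMeasure.real {ω | (W ω).1 = ext v ∧ θ ≤ e v ω}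
        ≤ ∑ v ∈ Gᶜ, coinMeasure.real {ω | (W ω).1 = ext v} * (N * η ^ 2)⁻¹ := by
          refine Finset.sum_le_sum fun v hv => ?_
          -- The final estimate uses fresh tosses and is independent of the string reached. As the
          -- strings exclude each other, the error probability is paid once and not once per string.
          rw [coin_real_and (dv v) (dependsOn_comp (de v) fun a => θ ≤ a) (disjoint_Ico _ _ _)]
          refine mul_le_mul_of_nonneg_left ?_ measureReal_nonneg
          refine (measureReal_mono fun ω hω => ?_).trans
            (coin_estim hF le_rfl h1 hη hN0 (ext v) (c + L + estimCoins M N * M))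
          have h2 := hG v (by simpa using hv)
          have h3 : (θ : ℝ) ≤ e v ω := by exact_mod_cast hω
          rw [he] at h3
          simp only [Set.mem_ofPred_eq]
          exact le_trans (by linarith) (le_abs_self _)
      _ = (∑ v ∈ Gᶜ, coinMeasure.real {ω | (W ω).1 = ext v}) * (N * η ^ 2)⁻¹ := by
        rw [Finset.sum_mul]
      _ ≤ 1 * (N * η ^ 2)⁻¹ := by
        gcongr
        rw [sum_coin_real dv]
        calc _ ≤ ∫ ω, (1 : ℝ) ∂coinMeasure := by
              refine integral_mono (integrable_finsetSum _ fun u _ => integrable_ite (dv u))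
                (integrable_const _) fun ω => ?_
              show ∑ v ∈ Gᶜ, (if (W ω).1 = ext v then (1 : ℝ) else 0) ≤ 1
              rw [Finset.sum_boole]
              have : ((Gᶜ).filter fun v => (W ω).1 = ext v).card ≤ 1 :=
                Finset.card_le_one.2 fun a ha b hb => ext_injective
                  ((Finset.mem_filter.1 ha).2.symm.trans (Finset.mem_filter.1 hb).2)
              exact_mod_cast this
          _ = 1 := by simp
      _ = _ := one_mul _

/-- The probability that one of up to `j` attempts finds a string, if it is found by an attempt
with probability `a`, and an attempt accepts with probability at most `Q`. -/
theorem le_coin_search (hF : DependsOn F (Finset.range M : Finset ℕ)) {D : ℕ}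
    (hD : D = estimCoins M N) {a Q x : ℝ} (ha : ∀ c, a ≤ coinMeasure.real {ω |
      attempt (estim F M N ω) ω M D L θ c = some z})
    (hQ : ∀ c, coinMeasure.real {ω | attempt (estim F M N ω) ω M D L θ c ≠ none} ≤ Q)
    (ha0 : 0 ≤ a) (hx : 0 ≤ x) (hxQ : x * Q ≤ 1) (j c : ℕ) :
    a * min (j : ℝ) x / 2 ≤ coinMeasure.real {ω | search (estim F M N ω) ω M D L θ j c = some z} := by
  subst hD
  have hQ0 : 0 ≤ Q := measureReal_nonneg.trans (hQ 0)
  induction j generalizing c with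
  | zero => simp [hx]
  | succ j ih =>
    have da := dependsOn_attempt (N := N) (L := L) (θ := θ) hF c
    have dse := dependsOn_search (N := N) (L := L) (θ := θ) hF j (c + attemptCoins M N L)
    have d1 := dependsOn_comp da fun o => o = none
    have d2 := dependsOn_comp dse fun o => o = some z
    have hsub : {ω | attempt (estim F M N ω) ω M (estimCoins M N) L θ c = some z ∨
        (attempt (estim F M N ω) ω M (estimCoins M N) L θ c = none ∧
          search (estim F M N ω) ω M (estimCoins M N) L θ j (c + attemptCoins M N L) = some z)} ⊆
        {ω | search (estim F M N ω) ω M (estimCoins M N) L θ (j + 1) c = some z} := by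
      rintro ω (h | ⟨h, h'⟩)
      · simp [search, h]
      · simp only [Set.mem_ofPred_eq, search, h]
        exact h'
    refine le_trans ?_ (measureReal_mono hsub)
    rw [coin_real_add (s := Finset.Ico c (c + attemptCoins M N L) ∪ Finset.Ico
        (c + attemptCoins M N L) (c + attemptCoins M N L + attemptCoins M N L * j))
        (dependsOn_and (d1.mono (Finset.coe_subset.2 Finset.subset_union_left))
          (d2.mono (Finset.coe_subset.2 Finset.subset_union_right))) fun ω h h' => by
          simp [h] at h', coin_real_and d1 d2 (disjoint_Ico _ _ _)]
    have h3 := hQ c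
    have h4 : coinMeasure.real {ω | attempt (estim F M N ω) ω M (estimCoins M N) L θ c ≠ none} =
      1 - coinMeasure.real {ω | attempt (estim F M N ω) ω M (estimCoins M N) L θ c = none} :=
        coin_real_not d1
    have h5 := ih (c + attemptCoins M N L)
    have h6 := ha c
    have hm0 : 0 ≤ min (j : ℝ) x := le_min (by positivity) hx
    -- If the first attempt rejects, which has probability at least `1 - Q`, the others run on
    -- independent tosses.
    have h7 : (1 - Q) * (a * min (j : ℝ) x / 2) ≤
        coinMeasure.real {ω | attempt (estim F M N ω) ω M (estimCoins M N) L θ c = none} *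
        coinMeasure.real {ω | search (estim F M N ω) ω M (estimCoins M N) L θ j
          (c + attemptCoins M N L) = some z} :=
      mul_le_mul (by linarith) h5 (by positivity) measureReal_nonneg
    have h8 : Q * min (j : ℝ) x ≤ 1 := by
      calc Q * min (j : ℝ) x ≤ Q * x := mul_le_mul_of_nonneg_left (min_le_right _ _) hQ0
        _ ≤ 1 := by linarith
    have h9 : min ((j + 1 : ℕ) : ℝ) x ≤ min (j : ℝ) x + 1 := by
      push_cast
      rcases min_cases (j : ℝ) x with h | h
      · rw [h.1]; exact min_le_left _ _
      · rw [h.1]; exact (min_le_right _ _).trans (by linarith)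
    -- The term lost to `Q` is at most `a / 2`, since `Q * min j x ≤ 1`; this is the source of the
    -- factor one half.
    calc a * min ((j + 1 : ℕ) : ℝ) x / 2 ≤ a * (min (j : ℝ) x + 1) / 2 := by gcongr
      _ ≤ a + (1 - Q) * (a * min (j : ℝ) x / 2) := by nlinarith
      _ ≤ _ := add_le_add h6 h7

end Ram

/-! ### Characters on the middle slice of the cube -/

namespace Ram

open Polynomial

/-- The number of ones in a string. -/
def wt {M : ℕ} (v : Fin M → Bool) : ℕ := (Finset.univ.filter fun i => v i = true).card

/-- The value of a character of the cube. -/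
def chr {M : ℕ} (v r : Fin M → Bool) : ℤ := ∏ i, sign (r i && v i)

/-- The strings with `k` ones. -/
def slice (k M : ℕ) : Finset (Fin M → Bool) := Finset.univ.filter fun r => wt r = k

/-- The sum of a character over a slice of the cube. -/
def krawtchouk (k : ℕ) {M : ℕ} (v : Fin M → Bool) : ℤ := ∑ r ∈ slice k M, chr v r

/-! ### Krawtchouk values and near-orthogonality of characters -/

variable {k M : ℕ}

/-- Expand the product of the factors `1 + sign (v i) * X`: each string contributes its character
times `X` to the power of its weight. -/
theorem krawtchouk_eq (v : Fin M → Bool) :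
    krawtchouk k v = ((1 - X : ℤ[X]) ^ wt v * (1 + X) ^ (M - wt v)).coeff k := by
  have h1 : ((1 - X : ℤ[X]) ^ wt v * (1 + X) ^ (M - wt v)) = ∏ i, (1 + C (sign (v i)) * X) := by
    have e : ∀ i, (1 + C (sign (v i)) * X : ℤ[X]) = if v i = true then 1 - X else 1 + X :=
      fun i => by cases v i <;> simp [sign, sub_eq_add_neg]
    simp only [e]
    rw [Finset.prod_ite, Finset.prod_const, Finset.prod_const]
    congr 2
    have := Finset.card_filter_add_card_filter_not (s := (Finset.univ : Finset (Fin M)))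
      fun i => v i = true
    simp only [Finset.card_univ, Fintype.card_fin] at this
    simp only [wt]
    omega
  have h2 : ∏ i, (1 + C (sign (v i)) * X : ℤ[X]) =
      ∏ i, ∑ b : Bool, if b then C (sign (v i)) * X else 1 := by
    refine Finset.prod_congr rfl fun i _ => ?_
    simp [add_comm]
  have h3 : ∀ r : Fin M → Bool, (∏ i, if r i then C (sign (v i)) * X else (1 : ℤ[X])) =
      C (chr v r) * X ^ wt r := by
    intro r
    have e : ∀ i, (if r i then C (sign (v i)) * X else (1 : ℤ[X])) =
        C (sign (r i && v i)) * if r i = true then X else 1 := fun i => by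
      cases r i <;> simp [sign]
    simp only [e]
    rw [Finset.prod_mul_distrib, chr, map_prod, Finset.prod_ite, Finset.prod_const,
      Finset.prod_const_one, mul_one]
    rfl
  rw [h1, h2, Finset.prod_univ_sum, Fintype.piFinset_univ]
  simp only [h3]
  rw [finsetSum_coeff, krawtchouk, slice, Finset.sum_filter]
  refine Finset.sum_congr rfl fun r _ => ?_
  simp [coeff_X_pow, eq_comm]

/-- With P = (1 - X)^(u+1) (1 + X)^(w+1), the combination equals 2k P - 2X P'. Its coefficient at
X^k vanishes, as X P' multiplies that coefficient of P by k. -/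
theorem krawtchouk_recurrence {k u w : ℕ} (h : u + w + 2 = 2 * k) :
    (u + 1 : ℤ) * ((1 - X : ℤ[X]) ^ u * (1 + X) ^ (w + 2)).coeff k +
      (w + 1) * ((1 - X : ℤ[X]) ^ (u + 2) * (1 + X) ^ w).coeff k = 0 := by
  have h1 : C (u + 1 : ℤ) * ((1 - X : ℤ[X]) ^ u * (1 + X) ^ (w + 2)) +
      C (w + 1 : ℤ) * ((1 - X : ℤ[X]) ^ (u + 2) * (1 + X) ^ w) =
      C (u + w + 2 : ℤ) * ((1 - X : ℤ[X]) ^ (u + 1) * (1 + X) ^ (w + 1)) -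
        C 2 * (X * derivative ((1 - X : ℤ[X]) ^ (u + 1) * (1 + X) ^ (w + 1))) := by
    simp [derivative_mul, derivative_pow]
    ring
  have h2 := congrArg (fun p : ℤ[X] => p.coeff k) h1
  simp only [coeff_add, coeff_sub, coeff_C_mul] at h2
  rw [h2]
  obtain ⟨j, rfl⟩ : ∃ j, k = j + 1 := ⟨k - 1, by omega⟩
  rw [coeff_X_mul, coeff_derivative]
  have : (u + w + 2 : ℤ) = 2 * (j + 1) := by exact_mod_cast h
  rw [this]
  ring

/-- The base for odd weights: the two middle binomial coefficients of row 2k - 1 are equal. -/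
theorem krawtchouk_one {k : ℕ} (hk : 0 < k) :
    ((1 - X : ℤ[X]) ^ 1 * (1 + X) ^ (2 * k - 1)).coeff k = 0 := by
  obtain ⟨j, rfl⟩ : ∃ j, k = j + 1 := ⟨k - 1, by omega⟩
  have e : (1 - X : ℤ[X]) ^ 1 * (1 + X) ^ (2 * (j + 1) - 1) =
      (1 + X) ^ (2 * j + 1) - X * (1 + X) ^ (2 * j + 1) := by
    rw [show 2 * (j + 1) - 1 = 2 * j + 1 by omega]
    ring
  rw [e, coeff_sub, coeff_X_mul, coeff_one_add_X_pow, coeff_one_add_X_pow, Nat.choose_symm_half]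
  simp

/-- Up to weight `k` the recurrence lets absolute values only decrease in steps of two. They start
from zero at weight 1 and from the claimed bound at weight 2. -/
theorem abs_krawtchouk_le_of_le {k w : ℕ} (hw : 0 < w) (hwk : w ≤ k) :
    (2 * k - 1 : ℤ) * |((1 - X : ℤ[X]) ^ w * (1 + X) ^ (2 * k - w)).coeff k| ≤
      (2 * k).choose k := by
  induction w using Nat.strong_induction_on with
  | _ w ih =>
    obtain rfl | rfl | ⟨u, rfl⟩ : w = 1 ∨ w = 2 ∨ ∃ u, w = u + 1 + 2 := by
      rcases w with _ | _ | _ | u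
      · omega
      · exact .inl rfl
      · exact .inr (.inl rfl)
      · exact .inr (.inr ⟨u, rfl⟩)
    · rw [krawtchouk_one (by omega)]
      simp
    · have h := krawtchouk_recurrence (k := k) (u := 0) (w := 2 * k - 2) (by omega)
      rw [show 2 * k - 2 + 2 = 2 * k by omega, pow_zero, one_mul, coeff_one_add_X_pow] at h
      have h2 : ((2 * k - 2 : ℕ) : ℤ) = 2 * k - 2 := by
        rw [Nat.cast_sub (by omega)]; push_cast; rfl
      rw [h2] at h
      have h3 : (0 : ℤ) ≤ 2 * k - 1 := by omega
      rw [← abs_of_nonneg h3, ← abs_mul]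
      have h4 : (2 * k - 1 : ℤ) * ((1 - X : ℤ[X]) ^ 2 * (1 + X) ^ (2 * k - 2)).coeff k =
          -((2 * k).choose k : ℤ) := by
        simp only [Nat.zero_add] at h
        push_cast at h ⊢
        linarith
      rw [h4, abs_neg, abs_of_nonneg (by positivity)]
    · have h := krawtchouk_recurrence (k := k) (u := u + 1) (w := 2 * k - (u + 1 + 2)) (by omega)
      rw [show 2 * k - (u + 1 + 2) + 2 = 2 * k - (u + 1) by omega] at h
      refine le_trans ?_ (ih (u + 1) (by omega) (by omega) (by omega))
      refine mul_le_mul_of_nonneg_left ?_ (by omega)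
      have h2 : ((2 * k - (u + 1 + 2) : ℕ) : ℤ) = 2 * k - (u + 1 + 2) := by
        rw [Nat.cast_sub (by omega)]; push_cast; rfl
      rw [h2] at h
      set x := ((1 - X : ℤ[X]) ^ (u + 1) * (1 + X) ^ (2 * k - (u + 1))).coeff k
      set y := ((1 - X : ℤ[X]) ^ (u + 1 + 2) * (1 + X) ^ (2 * k - (u + 1 + 2))).coeff k
      have h5 : (u + 2 : ℤ) ≤ 2 * k - (u + 2) := by omega
      have h6 : (2 * k - (u + 2) : ℤ) * y = -((u + 2) * x) := by
        push_cast at h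
        linarith
      have h7 : (2 * k - (u + 2) : ℤ) * |y| = (u + 2) * |x| := by
        rw [← abs_of_nonneg (show (0 : ℤ) ≤ 2 * k - (u + 2) by omega), ← abs_mul, h6, abs_neg,
          abs_mul, abs_of_nonneg (show (0 : ℤ) ≤ u + 2 by omega)]
      have h8 := mul_le_mul_of_nonneg_right h5 (abs_nonneg x)
      exact le_of_mul_le_mul_left (h7.le.trans h8) (by omega)

theorem wt_not (v : Fin M → Bool) : wt (fun i => !v i) = M - wt v := by
  have := Finset.card_filter_add_card_filter_not (s := (Finset.univ : Finset (Fin M)))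
    fun i => v i = true
  simp only [Finset.card_univ, Fintype.card_fin] at this
  simp only [wt, Bool.not_eq_true'] at *
  simp only [Bool.not_eq_true] at this
  omega

theorem chr_not (v r : Fin M → Bool) : chr (fun i => !v i) r = (-1) ^ wt r * chr v r := by
  have : (-1 : ℤ) ^ wt r = ∏ i, if r i = true then -1 else 1 := by
    rw [Finset.prod_ite, Finset.prod_const, Finset.prod_const_one, mul_one]
    rfl
  rw [this, chr, chr, ← Finset.prod_mul_distrib]
  refine Finset.prod_congr rfl fun i _ => ?_
  generalize r i = a, v i = b
  cases a <;> cases b <;> rfl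

/-- All strings in the slice have weight `k`, so complementing `v` changes every character value by
the same sign. This reduces weights above `k` to weights below `k` when `M = 2 * k`. -/
theorem krawtchouk_not (v : Fin M → Bool) :
    krawtchouk k (fun i => !v i) = (-1) ^ k * krawtchouk k v := by
  rw [krawtchouk, krawtchouk, Finset.mul_sum]
  refine Finset.sum_congr rfl fun r hr => ?_
  rw [chr_not, (Finset.mem_filter.1 hr).2]

theorem abs_chr (v r : Fin M → Bool) : |chr v r| = 1 := by
  rw [chr, Finset.abs_prod]
  simp [abs_sign]

theorem card_slice (k M : ℕ) : ((slice k M).card : ℤ) = M.choose k := by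
  have h1 : krawtchouk k (fun _ : Fin M => false) = (slice k M).card := by
    simp [krawtchouk, chr, sign]
  rw [← h1, krawtchouk_eq]
  simp [wt, coeff_one_add_X_pow]

theorem abs_krawtchouk_le (v : Fin M → Bool) : |krawtchouk k v| ≤ M.choose k := by
  rw [← card_slice, krawtchouk]
  refine (Finset.abs_sum_le_sum_abs _ _).trans ?_
  simp [abs_chr]

theorem abs_krawtchouk_le_of_ne {v : Fin (2 * k) → Bool} (h0 : v ≠ fun _ => false)
    (h1 : v ≠ fun _ => true) : (2 * k - 1 : ℤ) * |krawtchouk k v| ≤ (2 * k).choose k := by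
  have key : ∀ v : Fin (2 * k) → Bool, (v ≠ fun _ => false) → wt v ≤ k →
      (2 * k - 1 : ℤ) * |krawtchouk k v| ≤ (2 * k).choose k := by
    intro v h0 hk
    have : 0 < wt v := by
      obtain ⟨i, hi⟩ := Function.ne_iff.1 h0
      exact Finset.card_pos.2 ⟨i, by simpa using hi⟩
    rw [krawtchouk_eq]
    exact abs_krawtchouk_le_of_le this hk
  rcases le_total (wt v) k with h | h
  · exact key v h0 h
  · have h2 := key (fun i => !v i) (fun e => h1 (funext fun i => by
      simpa using congrFun e i)) (by rw [wt_not]; omega)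
    rwa [krawtchouk_not, abs_mul, abs_pow, abs_neg, abs_one, one_pow, one_mul] at h2

theorem chr_mul (v v' r : Fin M → Bool) :
    chr v r * chr v' r = chr (fun i => xor (v i) (v' i)) r := by
  rw [chr, chr, chr, ← Finset.prod_mul_distrib]
  refine Finset.prod_congr rfl fun i _ => ?_
  generalize r i = a, v i = b, v' i = c
  cases a <;> cases b <;> cases c <;> rfl

/-- A function on the middle slice with values `1` and `-1` has few large correlations with
characters. -/
theorem sum_sq_le {σ : (Fin (2 * k) → Bool) → ℝ} (hσ : ∀ r, σ r ^ 2 = 1)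
    (hk : 0 < k) {G : Finset (Fin (2 * k) → Bool)} {δ : (Fin (2 * k) → Bool) → ℝ}
    (hδ : ∀ v, (2 * k).choose k * δ v = ∑ r ∈ slice k (2 * k), σ r * chr v r) {τ : ℝ} (hτ : 0 < τ)
    (hG : ∀ v ∈ G, τ ≤ |δ v|) (h : 2 ≤ (2 * k - 1) * τ ^ 2) : ∑ v ∈ G, δ v ^ 2 ≤ 4 := by
  obtain ⟨B, hB⟩ : ∃ B : ℝ, B = Nat.choose (2 * k) k := ⟨_, rfl⟩
  simp only [← hB] at hδ
  have hB0 : 0 < B := by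
    rw [hB]; exact_mod_cast Nat.choose_pos (by omega)
  have hcard : ((slice k (2 * k)).card : ℝ) = B := by
    rw [hB]; exact_mod_cast card_slice k (2 * k)
  set A := ∑ v ∈ G, δ v ^ 2 with hA
  have hA0 : 0 ≤ A := Finset.sum_nonneg fun v _ => sq_nonneg _
  have hk1 : (0 : ℝ) < 2 * k - 1 := by
    have : (1 : ℝ) ≤ k := by exact_mod_cast hk
    linarith
  set S := ∑ v ∈ G, |δ v| with hS
  have hS0 : 0 ≤ S := Finset.sum_nonneg fun v _ => abs_nonneg _
  have hSA : τ * S ≤ A := by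
    rw [hS, hA, Finset.mul_sum]
    refine Finset.sum_le_sum fun v hv => ?_
    rw [← sq_abs, sq]
    exact mul_le_mul_of_nonneg_right (hG v hv) (abs_nonneg _)
  have h1 : B * A = ∑ r ∈ slice k (2 * k), σ r * ∑ v ∈ G, δ v * chr v r := by
    simp only [Finset.mul_sum]
    rw [Finset.sum_comm, hA, Finset.mul_sum]
    refine Finset.sum_congr rfl fun v _ => ?_
    rw [sq, ← mul_assoc, hδ, Finset.sum_mul]
    exact Finset.sum_congr rfl fun r _ => by ring
  -- Cauchy–Schwarz over the slice, on which σ has constant square.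
  have h2 : (B * A) ^ 2 ≤ B * ∑ r ∈ slice k (2 * k), (∑ v ∈ G, δ v * chr v r) ^ 2 := by
    rw [h1]
    refine (Finset.sum_mul_sq_le_sq_mul_sq _ _ _).trans ?_
    simp [hσ, hcard]
  have h3 : ∑ r ∈ slice k (2 * k), (∑ v ∈ G, δ v * (chr v r : ℝ)) ^ 2 =
      ∑ v ∈ G, ∑ v' ∈ G, δ v * δ v' * (krawtchouk k fun i => xor (v i) (v' i) : ℤ) := by
    have e : ∀ r, (∑ v ∈ G, δ v * (chr v r : ℝ)) ^ 2 =
        ∑ v ∈ G, ∑ v' ∈ G, δ v * δ v' * (chr (fun i => xor (v i) (v' i)) r : ℝ) := fun r => by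
      rw [sq, Finset.sum_mul_sum]
      refine Finset.sum_congr rfl fun v _ => Finset.sum_congr rfl fun v' _ => ?_
      rw [← chr_mul]
      push_cast
      ring
    simp only [e]
    rw [Finset.sum_comm]
    refine Finset.sum_congr rfl fun v _ => ?_
    rw [Finset.sum_comm]
    refine Finset.sum_congr rfl fun v' _ => ?_
    rw [krawtchouk]
    push_cast
    rw [Finset.mul_sum]
  -- The Gram matrix has diagonal `B`, the trivial bound `B` at complementary pairs and at most `B /
  -- (2 * k - 1)` elsewhere.
  have h4 : ∀ v v' : Fin (2 * k) → Bool,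
      δ v * δ v' * (krawtchouk k fun i => xor (v i) (v' i) : ℤ) ≤
        B * ((if v = v' then |δ v| * |δ v'| else 0) +
          (if v = fun i => !v' i then |δ v| * |δ v'| else 0) +
            |δ v| * |δ v'| / (2 * k - 1)) := by
    intro v v'
    have hab : 0 ≤ |δ v| * |δ v'| := by positivity
    have hab' : 0 ≤ |δ v| * |δ v'| / (2 * k - 1) := by positivity
    have h5 : δ v * δ v' * (krawtchouk k fun i => xor (v i) (v' i) : ℤ) ≤
        |δ v| * |δ v'| * |(krawtchouk k fun i => xor (v i) (v' i) : ℤ)| := by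
      push_cast
      rw [← abs_mul, ← abs_mul]
      exact le_abs_self _
    refine h5.trans ?_
    by_cases hc : v = v' ∨ v = fun i => !v' i
    · have h6 : (|(krawtchouk k fun i => xor (v i) (v' i) : ℤ)| : ℝ) ≤ B := by
        rw [hB]
        exact_mod_cast abs_krawtchouk_le (k := k) fun i => xor (v i) (v' i)
      have h7 : |δ v| * |δ v'| ≤ (if v = v' then |δ v| * |δ v'| else 0) +
          (if v = fun i => !v' i then |δ v| * |δ v'| else 0) := by
        rcases hc with hc | hc
        · rw [if_pos hc]
          have : 0 ≤ (if v = fun i => !v' i then |δ v| * |δ v'| else 0) := by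
            split_ifs <;> simp [hab]
          linarith
        · rw [if_pos hc]
          have : 0 ≤ (if v = v' then |δ v| * |δ v'| else 0) := by
            split_ifs <;> simp [hab]
          linarith
      push_cast at h6 ⊢
      calc _ ≤ |δ v| * |δ v'| * B := mul_le_mul_of_nonneg_left h6 hab
        _ = B * (|δ v| * |δ v'|) := mul_comm _ _
        _ ≤ _ := mul_le_mul_of_nonneg_left (by linarith) hB0.le
    · have hc1 : v ≠ v' := fun e => hc (.inl e)
      have hc2 : v ≠ fun i => !v' i := fun e => hc (.inr e)
      have h6 := abs_krawtchouk_le_of_ne (k := k) (v := fun i => xor (v i) (v' i))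
        (fun e => hc1 (funext fun i => by
          have := congrFun e i
          cases h1 : v i <;> cases h2 : v' i <;> simp_all))
        (fun e => hc2 (funext fun i => by
          have := congrFun e i
          cases h1 : v i <;> cases h2 : v' i <;> simp_all))
      have h7 : (2 * k - 1 : ℝ) * |(krawtchouk k fun i => xor (v i) (v' i) : ℤ)| ≤ B := by
        rw [hB]
        exact_mod_cast h6
      rw [if_neg hc1, if_neg hc2, zero_add, zero_add]
      push_cast at h7 ⊢
      have h8 : (|(krawtchouk k fun i => xor (v i) (v' i) : ℝ)| : ℝ) ≤ B / (2 * k - 1) := by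
        rw [le_div_iff₀ hk1]
        linarith
      calc _ ≤ |δ v| * |δ v'| * (B / (2 * k - 1)) := mul_le_mul_of_nonneg_left h8 hab
        _ = _ := by ring
  have hpair : ∀ a b : ℝ, |a| * |b| ≤ (a ^ 2 + b ^ 2) / 2 := fun a b => by
    have := sq_nonneg (|a| - |b|)
    rw [← sq_abs a, ← sq_abs b]
    linarith
  have h5 : ∑ v ∈ G, ∑ v' ∈ G, (if v = v' then |δ v| * |δ v'| else 0) = A := by
    rw [hA]
    refine Finset.sum_congr rfl fun v hv => ?_
    rw [Finset.sum_ite_eq, if_pos hv, ← sq, sq_abs]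
  -- A string has only one complement, so after splitting the product into two squares each square
  -- is counted at most once on each side.
  have h6 : ∑ v ∈ G, ∑ v' ∈ G, (if v = fun i => !v' i then |δ v| * |δ v'| else 0) ≤ A := by
    have hnot : ∀ v v' : Fin (2 * k) → Bool, (v = fun i => !v' i) ↔ (fun i => !v i) = v' :=
      fun v v' => ⟨fun e => by rw [e]; simp, fun e => by rw [← e]; simp⟩
    calc _ ≤ ∑ v ∈ G, ∑ v' ∈ G, ((if v = fun i => !v' i then δ v ^ 2 / 2 else 0) +
          if v = fun i => !v' i then δ v' ^ 2 / 2 else 0) := by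
          refine Finset.sum_le_sum fun v _ => Finset.sum_le_sum fun v' _ => ?_
          split_ifs
          · have := hpair (δ v) (δ v')
            linarith
          · simp
      _ = ∑ v ∈ G, ∑ v' ∈ G, (if v = fun i => !v' i then δ v ^ 2 / 2 else 0) +
          ∑ v' ∈ G, ∑ v ∈ G, if v = fun i => !v' i then δ v' ^ 2 / 2 else 0 := by
          simp only [Finset.sum_add_distrib]
          congr 1
          exact Finset.sum_comm
      _ ≤ ∑ v ∈ G, δ v ^ 2 / 2 + ∑ v ∈ G, δ v ^ 2 / 2 := by
          refine add_le_add (Finset.sum_le_sum fun v _ => ?_) (Finset.sum_le_sum fun v' _ => ?_)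
          · simp only [hnot]
            rw [Finset.sum_ite_eq]
            split_ifs
            · exact le_rfl
            · positivity
          · rw [Finset.sum_ite_eq']
            split_ifs
            · exact le_rfl
            · positivity
      _ = A := by
          rw [← Finset.sum_add_distrib, hA]
          exact Finset.sum_congr rfl fun v _ => by ring
  have h7 : ∑ v ∈ G, ∑ v' ∈ G, |δ v| * |δ v'| / (2 * k - 1 : ℝ) = S ^ 2 / (2 * k - 1) := by
    rw [sq, hS, Finset.sum_mul_sum, Finset.sum_div]
    exact Finset.sum_congr rfl fun v _ => by rw [Finset.sum_div]
  have h8 : (B * A) ^ 2 ≤ B * (B * (A + A + S ^ 2 / (2 * k - 1))) := by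
    refine h2.trans (mul_le_mul_of_nonneg_left ?_ hB0.le)
    rw [h3]
    calc _ ≤ ∑ v ∈ G, ∑ v' ∈ G, B * ((if v = v' then |δ v| * |δ v'| else 0) +
          (if v = fun i => !v' i then |δ v| * |δ v'| else 0) + |δ v| * |δ v'| / (2 * k - 1)) :=
          Finset.sum_le_sum fun v _ => Finset.sum_le_sum fun v' _ => h4 v v'
      _ = B * (∑ v ∈ G, ∑ v' ∈ G, (if v = v' then |δ v| * |δ v'| else 0) +
          ∑ v ∈ G, ∑ v' ∈ G, (if v = fun i => !v' i then |δ v| * |δ v'| else 0) +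
            ∑ v ∈ G, ∑ v' ∈ G, |δ v| * |δ v'| / (2 * k - 1)) := by
          simp only [← Finset.mul_sum, Finset.sum_add_distrib]
      _ ≤ _ := by
          rw [h5, h7]
          exact mul_le_mul_of_nonneg_left (by linarith) hB0.le
  have h9 : A ^ 2 ≤ A + A + S ^ 2 / (2 * k - 1) := by
    have : (B * B) * A ^ 2 ≤ (B * B) * (A + A + S ^ 2 / (2 * k - 1)) := by linarith
    exact le_of_mul_le_mul_left this (by positivity)
  -- Large correlations give `τ * S ≤ A`. The off-diagonal part is thus absorbed in `A ^ 2`, and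
  -- there remains `A ^ 2 / 2 ≤ 2 * A`.
  have h10 : S ^ 2 / (2 * k - 1) ≤ A ^ 2 / 2 := by
    rw [div_le_div_iff₀ hk1 (by norm_num)]
    have h11 : (τ * S) ^ 2 ≤ A ^ 2 := pow_le_pow_left₀ (by positivity) hSA 2
    have h12 := mul_le_mul_of_nonneg_right h (sq_nonneg S)
    have h13 := mul_le_mul_of_nonneg_left h11 hk1.le
    linarith
  by_contra hcon
  have : 4 < A := not_le.1 hcon
  nlinarith

/-- The fraction of the strings that are in the middle slice. -/
noncomputable def middle (k : ℕ) : ℝ := k.centralBinom / 4 ^ k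

theorem middle_succ (k : ℕ) : (2 * k + 2) * middle (k + 1) = (2 * k + 1) * middle k := by
  have h : ((k + 1) * (k + 1).centralBinom : ℝ) = 2 * (2 * k + 1) * k.centralBinom := by
    exact_mod_cast Nat.succ_mul_centralBinom_succ k
  rw [middle, middle, pow_succ]
  field_simp
  linarith

/-- The induction step is (2k + 1)(2k + 3) ≤ (2k + 2)². -/
theorem middle_sq_le (k : ℕ) : (2 * k + 1) * middle k ^ 2 ≤ 1 := by
  induction k with
  | zero => simp [middle]
  | succ k ih =>
    have h := congrArg (· ^ 2) (middle_succ k)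
    simp only [mul_pow] at h
    have hk : (0 : ℝ) ≤ k := by positivity
    have h2 := sq_nonneg (middle (k + 1))
    have h3 := mul_le_mul_of_nonneg_left ih (show (0 : ℝ) ≤ 2 * k + 1 by positivity)
    have h4 : (2 * k + 1 : ℝ) * ((2 * k + 3) * middle (k + 1) ^ 2) ≤ (2 * k + 1) * 1 := by
      nlinarith
    have := le_of_mul_le_mul_left h4 (by positivity)
    push_cast
    linarith

/-- The induction step is 4k(k + 1) ≤ (2k + 1)². With `middle_sq_le`, the density of the slice is of
order 1/√k. -/
theorem le_middle_sq {k : ℕ} (hk : 0 < k) : 1 ≤ 4 * k * middle k ^ 2 := by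
  induction k, hk using Nat.le_induction with
  | base => norm_num [middle, Nat.centralBinom, Nat.choose]
  | succ k hk ih =>
    have h := congrArg (· ^ 2) (middle_succ k)
    simp only [mul_pow] at h
    have hk : (0 : ℝ) ≤ k := by positivity
    have h2 := sq_nonneg (middle k)
    have h3 : (k + 1 : ℝ) * (4 * k * middle k ^ 2) ≤ (k + 1) * (4 * (k + 1) * middle (k + 1) ^ 2) := by
      nlinarith
    have := le_of_mul_le_mul_left h3 (by positivity)
    push_cast
    linarith

end Ram

/-! ### The rate of success -/

namespace Ram

open MeasureTheory

variable {k M : ℕ}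

theorem length_members_eq_sum (q : ℕ → Bool) (i : ℕ) :
    (members q i).length = ∑ j ∈ Finset.range i, (q j).toNat := by
  induction i with
  | zero => rfl
  | succ i ih =>
    rw [members_succ, List.length_append, ih, Finset.sum_range_succ]
    cases q i <;> rfl

theorem length_members_ext (r : Fin M → Bool) : (members (ext r) M).length = wt r := by
  rw [length_members_eq_sum, Finset.sum_range, wt, Finset.card_filter]
  refine Finset.sum_congr rfl fun i _ => ?_
  cases h : r i <;> simp [ext, h]

theorem coeff_ext {F : (ℕ → Bool) → ℤ} (hF : DependsOn F (Finset.range M : Finset ℕ))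
    (v : Fin M → Bool) :
    coeff F M (ext v) = (2 ^ M)⁻¹ * ∑ r : Fin M → Bool, (F (ext r) * chr v r : ℝ) := by
  rw [← coin_integral_block 0 M, coeff]
  congr 1
  funext ω
  have h1 : F ω = F (ext fun i : Fin M => ω (0 + i)) := hF fun i hi => by
    have : i < M := by simpa using hi
    simp [ext, this]
  have h2 : chi M (ext v) ω = chr v fun i : Fin M => ω (0 + i) := by
    rw [chi, Finset.prod_range, chr]
    simp [ext]
  rw [h1, h2]

/-- The functions on the middle slice to which the search is applied. -/
structure MiddleSign (k : ℕ) (F : (ℕ → Bool) → ℤ) : Prop where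
  dependsOn : DependsOn F (Finset.range (2 * k) : Finset ℕ)
  abs_le : ∀ q, |F q| ≤ 1
  sq_eq : ∀ r : Fin (2 * k) → Bool, wt r = k → F (ext r) * F (ext r) = 1
  eq_zero : ∀ r : Fin (2 * k) → Bool, wt r ≠ k → F (ext r) = 0

/-- The correlation of `F` with a character on the middle slice. -/
noncomputable def correlation (k : ℕ) (F : (ℕ → Bool) → ℤ) (v : Fin (2 * k) → Bool) : ℝ :=
  (∑ r ∈ slice k (2 * k), (F (ext r) * chr v r : ℝ)) / k.centralBinom

/-- `F` lives on the middle slice only, so its Fourier coefficient is the correlation there times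
the density of the slice. This is where a factor of order 1/k is lost. -/
theorem weight_ext {F : (ℕ → Bool) → ℤ} (hF : MiddleSign k F) (v : Fin (2 * k) → Bool) :
    weight F (2 * k) (2 * k) (ext v) = middle k ^ 2 * correlation k F v ^ 2 := by
  have hC : (k.centralBinom : ℝ) ≠ 0 := by exact_mod_cast k.centralBinom_ne_zero
  have h : ∑ r : Fin (2 * k) → Bool, (F (ext r) * chr v r : ℝ) =
      ∑ r ∈ slice k (2 * k), (F (ext r) * chr v r : ℝ) := by
    refine (Finset.sum_subset (Finset.subset_univ _) fun r _ hr => ?_).symm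
    rw [hF.eq_zero r fun h => hr (by simpa [slice] using h)]
    simp
  rw [weight_top hF.dependsOn, coeff_ext hF.dependsOn, h, ← mul_pow, middle, correlation,
    pow_mul]
  norm_num
  field_simp

theorem sum_correlation_sq_le {F : (ℕ → Bool) → ℤ} (hF : MiddleSign k F) (hk : 0 < k)
    {G : Finset (Fin (2 * k) → Bool)} {τ : ℝ} (hτ : 0 < τ) (hG : ∀ v ∈ G, τ ≤ |correlation k F v|)
    (h : 2 ≤ (2 * k - 1) * τ ^ 2) : ∑ v ∈ G, correlation k F v ^ 2 ≤ 4 := by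
  have hC : (k.centralBinom : ℝ) ≠ 0 := by exact_mod_cast k.centralBinom_ne_zero
  -- Off the slice the value 1 is arbitrary; it only makes every square equal to one.
  refine sum_sq_le (σ := fun r => if wt r = k then (F (ext r) : ℝ) else 1) (fun r => ?_) hk
    (fun v => ?_) hτ hG h
  · split_ifs with hr
    · rw [sq]
      exact_mod_cast hF.sq_eq r hr
    · simp
  · rw [correlation, ← Nat.centralBinom_eq_two_mul_choose, mul_div_cancel₀ _ hC]
    refine Finset.sum_congr rfl fun r hr => ?_
    rw [if_pos (by simpa [slice] using hr)]

theorem two_pow_clog_lt {x : ℕ} (hx : 0 < x) : 2 ^ Nat.clog 2 x < 2 * x := by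
  rcases Nat.lt_or_ge 1 x with h | h
  · have h1 := Nat.pow_pred_clog_lt_self (b := 2) one_lt_two h
    have h2 : 0 < Nat.clog 2 x := Nat.clog_pos one_lt_two h
    obtain ⟨j, hj⟩ : ∃ j, Nat.clog 2 x = j + 1 := ⟨_, (Nat.succ_pred_eq_of_pos h2).symm⟩
    rw [hj] at h1 ⊢
    rw [pow_succ]
    simp only [Nat.pred_eq_sub_one, Nat.add_sub_cancel] at h1
    omega
  · obtain rfl : x = 1 := by omega
    simp

/-- The parameters of the search: powers of two `K` and `E` that approximate `k` and `1 / ε`, the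
number `N` of samples, the accuracy `η` of the estimates and the threshold `θ`. -/
structure Setting (k : ℕ) (ε K E N η θ : ℝ) : Prop where
  one_le_k : 1 ≤ (k : ℝ)
  ε_pos : 0 < ε
  k_le : (k : ℝ) ≤ K
  K_le : K ≤ 2 * k
  one_le_K : 1 ≤ K
  one_le_E : 1 ≤ E
  one_le_mul : 1 ≤ ε * E
  mul_le : ε * E ≤ 4
  N_eq : N = 2 ^ 22 * E ^ 6 * K ^ 6
  η_eq : η = (128 * E ^ 2 * K ^ 2)⁻¹
  θ_eq : θ = 2 ^ 19 * E ^ 4 * K ^ 5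

theorem setting {k e : ℕ} {ε : ℝ} (hk : 0 < k) (hε : 0 < ε) (he : 1 / ε ≤ e) (he' : e ≤ 2 / ε) :
    ∃ K E η, Setting k ε K E ((2 ^ logSamples k e : ℕ) : ℝ) η (threshold k e) := by
  have he0 : 0 < e := by
    have : (0 : ℝ) < e := lt_of_lt_of_le (by positivity) he
    exact_mod_cast this
  obtain ⟨K, hK⟩ : ∃ K : ℝ, K = 2 ^ Nat.clog 2 k := ⟨_, rfl⟩
  obtain ⟨E, hE⟩ : ∃ E : ℝ, E = 2 ^ Nat.clog 2 e := ⟨_, rfl⟩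
  have hk' : (1 : ℝ) ≤ k := by exact_mod_cast hk
  have hkK : (k : ℝ) ≤ K := by
    rw [hK]; exact_mod_cast Nat.le_pow_clog one_lt_two k
  have heE : (e : ℝ) ≤ E := by
    rw [hE]; exact_mod_cast Nat.le_pow_clog one_lt_two e
  have hEe : E ≤ 2 * e := by
    rw [hE]; exact_mod_cast (two_pow_clog_lt he0).le
  refine ⟨K, E, _, hk', hε, hkK, ?_, hk'.trans hkK, le_trans (by exact_mod_cast he0) heE, ?_, ?_,
    ?_, rfl, ?_⟩
  · rw [hK]; exact_mod_cast (two_pow_clog_lt hk).le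
  · have := he.trans heE
    rwa [div_le_iff₀ hε, mul_comm] at this
  · rw [le_div_iff₀ hε] at he'
    nlinarith
  · rw [logSamples, hK, hE, ← pow_mul, ← pow_mul]
    push_cast
    rw [pow_add, pow_add, mul_comm 6, mul_comm 6]
    ring
  · rw [threshold, hK, hE, ← pow_mul, ← pow_mul]
    push_cast
    rw [pow_add, pow_add, mul_comm 5, mul_comm 4]
    ring

/-! ### Arithmetic of the parameters -/

namespace Setting

variable {ε K E N η θ : ℝ}

theorem K_pos (h : Setting k ε K E N η θ) : 0 < K := one_pos.trans_le h.one_le_K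

theorem E_pos (h : Setting k ε K E N η θ) : 0 < E := one_pos.trans_le h.one_le_E

theorem η_pos (h : Setting k ε K E N η θ) : 0 < η := by
  have := h.K_pos
  have := h.E_pos
  rw [h.η_eq]
  positivity

theorem N_pos (h : Setting k ε K E N η θ) : 0 < N := by
  have := h.K_pos
  have := h.E_pos
  rw [h.N_eq]
  positivity

theorem inv_N_mul_sq (h : Setting k ε K E N η θ) : (N * η ^ 2)⁻¹ = (2 ^ 8 * E ^ 2 * K ^ 2)⁻¹ := by
  have := h.K_pos
  have := h.E_pos
  rw [h.N_eq, h.η_eq]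
  field_simp
  norm_num

theorem η_mul_N (h : Setting k ε K E N η θ) : η * N = 2 ^ 15 * E ^ 4 * K ^ 4 := by
  have := h.K_pos
  have := h.E_pos
  rw [h.N_eq, h.η_eq]
  field_simp
  norm_num

/-- Small enough that a union bound over the 2k + 1 estimates of an attempt costs at most 3/256. -/
theorem inv_le (h : Setting k ε K E N η θ) : (N * η ^ 2)⁻¹ ≤ (256 * k : ℝ)⁻¹ := by
  have hk := h.one_le_k
  have h1 : (1 : ℝ) ≤ E ^ 2 := one_le_pow₀ h.one_le_E
  have h2 : (k : ℝ) ≤ K ^ 2 := by nlinarith [h.k_le, h.one_le_K]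
  rw [h.inv_N_mul_sq]
  refine inv_anti₀ (by positivity) ?_
  calc (256 : ℝ) * k = 2 ^ 8 * 1 * k := by norm_num
    _ ≤ _ := by gcongr

theorem one_le_E_K (h : Setting k ε K E N η θ) : 1 ≤ E ^ 4 * K ^ 4 :=
  one_le_mul_of_one_le_of_one_le (one_le_pow₀ h.one_le_E) (one_le_pow₀ h.one_le_K)

theorem E_K_le (h : Setting k ε K E N η θ) : E ^ 4 * K ^ 4 ≤ E ^ 4 * K ^ 5 := by
  have := h.E_pos
  have := h.one_le_K
  gcongr
  norm_num

/-- The errors of all 2k + 1 estimates together are at most 3/32 of the value that `le_weight`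
guarantees for a correlated string. -/
theorem mul_η_mul_N_le (h : Setting k ε K E N η θ) :
    (2 * k + 1 : ℝ) * (η * N) ≤ 3 * 2 ^ 15 * (E ^ 4 * K ^ 5) := by
  have := h.E_pos
  have := h.K_pos
  have h1 : (2 * k + 1 : ℝ) ≤ 3 * K := by linarith [h.k_le, h.one_le_K]
  rw [h.η_mul_N]
  calc (2 * k + 1 : ℝ) * (2 ^ 15 * E ^ 4 * K ^ 4) ≤ (3 * K) * (2 ^ 15 * E ^ 4 * K ^ 4) := by
        gcongr
    _ = _ := by ring

end Setting

variable {ε K E N η : ℝ} {L θ : ℕ} {F : (ℕ → Bool) → ℤ} {v : Fin (2 * k) → Bool}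

/-- From 4kμ² ≥ 1 the weight is at least δ²/(4k), hence at least 1/(4KE²). Times `N` this is twice
the threshold. -/
theorem le_weight (h : Setting k ε K E N η θ) (hF : MiddleSign k F)
    (hv : ε ≤ correlation k F v) :
    correlation k F v ^ 2 ≤ 4 * k * weight F (2 * k) (2 * k) (ext v) ∧
      2 ^ 20 * (E ^ 4 * K ^ 5) ≤ N * weight F (2 * k) (2 * k) (ext v) := by
  have hE := h.E_pos
  have hK := h.K_pos
  have hk : 0 < k := by
    have := h.one_le_k
    exact_mod_cast this
  have hW := weight_ext hF v
  set W := weight F (2 * k) (2 * k) (ext v)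
  set δ := correlation k F v
  have h1 : δ ^ 2 ≤ 4 * k * W := by
    rw [hW]
    have := mul_le_mul_of_nonneg_right (le_middle_sq hk) (sq_nonneg δ)
    linarith
  refine ⟨h1, ?_⟩
  have hδ0 : 0 < δ := h.ε_pos.trans_le hv
  have h2 : 1 ≤ δ ^ 2 * E ^ 2 := by
    rw [← mul_pow]
    refine one_le_pow₀ (h.one_le_mul.trans ?_)
    gcongr
  have hW0 : 0 ≤ W := by rw [hW]; positivity
  have h3 : 1 ≤ 4 * K * E ^ 2 * W := by
    calc (1 : ℝ) ≤ δ ^ 2 * E ^ 2 := h2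
      _ ≤ (4 * k * W) * E ^ 2 := by gcongr
      _ ≤ (4 * K * W) * E ^ 2 := by
        have := h.k_le
        gcongr
      _ = _ := by ring
  have := mul_le_mul_of_nonneg_left h3 (show 0 ≤ 2 ^ 20 * E ^ 4 * K ^ 5 by positivity)
  rw [h.N_eq]
  linarith

/-- An attempt finds every string that is correlated with `F`. -/
theorem le_coin_attempt_of_correlation (h : Setting k ε K E ((2 ^ L : ℕ) : ℝ) η θ)
    (hF : MiddleSign k F) (hv : ε ≤ correlation k F v) (c : ℕ) :
    correlation k F v ^ 2 / (8 * k) ≤ coinMeasure.real {ω |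
      attempt (estim F (2 * k) (2 ^ L) ω) ω (2 * k) (2 * (2 * k) * 2 ^ L) L θ c =
        some (ext v)} := by
  obtain ⟨hWδ, hNW⟩ := le_weight h hF hv
  have key := fun d h1 h2 => le_coin_attempt (F := F) (L := L) (θ := θ) (z := ext v) hF.dependsOn
    hF.abs_le h.η_pos (d := d) h1 h2 c
  simp only [pre_ext] at key
  set W := weight F (2 * k) (2 * k) (ext v)
  set δ := correlation k F v
  have h2L : ((2 ^ L : ℕ) : ℝ) = 2 ^ L := by push_cast; rfl
  generalize hN : ((2 ^ L : ℕ) : ℝ) = N at h hNW key h2L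
  have hk := h.one_le_k
  have hbig := h.one_le_E_K
  have hbig' := h.E_K_le
  have hM := h.mul_η_mul_N_le
  -- The largest length of interval permitted by `le_coin_attempt`. The errors and the rounding take
  -- less than a quarter of `N * W`.
  obtain ⟨d, hd⟩ : ∃ d, d = ⌊N * W - (2 * k + 1) * (η * N)⌋₊ := ⟨_, rfl⟩
  have hd0 : 0 ≤ N * W - (2 * k + 1) * (η * N) := by linarith
  have hd1 : (d : ℝ) ≤ N * W - (2 * k + 1) * (η * N) := by
    rw [hd]; exact Nat.floor_le hd0
  have hd2 : N * W - (2 * k + 1) * (η * N) - 1 < d := by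
    rw [hd]
    have := Nat.lt_floor_add_one (N * W - (2 * k + 1) * (η * N))
    linarith
  have hdW : N * W * (3 / 4) ≤ d := by linarith
  refine le_trans ?_ (key d (by push_cast; linarith) (by
    rw [h.θ_eq, h.η_mul_N]
    linarith))
  have hN0 := h.N_pos
  have hP : 3 / 4 ≤ 1 - ((2 * k : ℕ) + 1 : ℝ) * (N * η ^ 2)⁻¹ := by
    have h3 : (2 * k + 1 : ℝ) * (N * η ^ 2)⁻¹ ≤ (3 * k) * (256 * k : ℝ)⁻¹ := by
      refine mul_le_mul (by linarith) h.inv_le ?_ (by linarith)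
      positivity
    have e : (3 * k : ℝ) * (256 * k : ℝ)⁻¹ = 3 / 256 := by field_simp
    push_cast
    linarith
  have hW0 : 0 ≤ W := by
    by_contra hcon
    nlinarith [sq_nonneg δ]
  rw [← h2L]
  calc δ ^ 2 / (8 * k) ≤ W / 2 := by
        rw [div_le_iff₀ (by positivity)]
        linarith
    _ ≤ N⁻¹ * ((N * W * (3 / 4)) * (3 / 4)) := by
        have : N⁻¹ * ((N * W * (3 / 4)) * (3 / 4)) = W * (9 / 16) := by
          field_simp
          ring
        rw [this]
        linarith
    _ ≤ _ := by gcongr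

/-- If `ε` is not too small, then an attempt rarely accepts. -/
theorem coin_attempt_ne_none_le (h : Setting k ε K E ((2 ^ L : ℕ) : ℝ) η θ)
    (hF : MiddleSign k F) (hε : 512 ≤ k * ε ^ 2) (c : ℕ) :
    coinMeasure.real {ω | attempt (estim F (2 * k) (2 ^ L) ω) ω (2 * k) (2 * (2 * k) * 2 ^ L) L θ c
      ≠ none} ≤ 5 / k := by
  classical
  have hk := h.one_le_k
  have hk0 : 0 < k := by exact_mod_cast hk
  have hE := h.E_pos
  have hK := h.K_pos
  have hμ1 := middle_sq_le k
  have hε0 := h.ε_pos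
  -- The cutoff is a quarter of the weight that correlation ε guarantees. `N` times it is half of
  -- the threshold, and an error of `η * N` does not bridge the gap.
  obtain ⟨G, hG⟩ : ∃ G : Finset (Fin (2 * k) → Bool), G = Finset.univ.filter fun v =>
    (16 * E ^ 2 * K)⁻¹ ≤ weight F (2 * k) (2 * k) (ext v) := ⟨_, rfl⟩
  have hGv : ∀ v ∈ G, (16 * E ^ 2 * K)⁻¹ ≤ weight F (2 * k) (2 * k) (ext v) := fun v hv => by
    rw [hG] at hv
    exact (Finset.mem_filter.1 hv).2
  have key := fun hG => coin_attempt_le (F := F) (L := L) (θ := θ) (G := G) hF.dependsOn hF.abs_le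
    h.η_pos hG c
  generalize hN : ((2 ^ L : ℕ) : ℝ) = N at h key
  have h0 : ∀ v ∉ G, N * weight F (2 * k) (2 * k) (ext v) + η * N ≤ θ := by
    intro v hv
    have h1 : weight F (2 * k) (2 * k) (ext v) ≤ (16 * E ^ 2 * K)⁻¹ := by
      rw [hG] at hv
      simp only [Finset.mem_filter, Finset.mem_univ, true_and, not_le] at hv
      exact hv.le
    have h2 : N * (16 * E ^ 2 * K)⁻¹ = 2 ^ 18 * (E ^ 4 * K ^ 5) := by
      rw [h.N_eq]
      field_simp
      norm_num
    have h3 := mul_le_mul_of_nonneg_left h1 h.N_pos.le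
    have := h.E_K_le
    have : 0 ≤ E ^ 4 * K ^ 5 := by positivity
    rw [h.η_mul_N, h.θ_eq]
    linarith
  refine (key h0).trans ?_
  have h1 : ∀ v ∈ G, weight F (2 * k) (2 * k) (ext v) + η + (N * η ^ 2)⁻¹ ≤
      2 * (middle k ^ 2 * correlation k F v ^ 2) := by
    intro v hv
    rw [← weight_ext hF]
    have h2 := hGv v hv
    have h3 : η + (N * η ^ 2)⁻¹ ≤ (16 * E ^ 2 * K)⁻¹ := by
      rw [h.inv_N_mul_sq, h.η_eq]
      have h4 : (128 * E ^ 2 * K ^ 2)⁻¹ = (16 * E ^ 2 * K)⁻¹ * K⁻¹ / 8 := by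
        field_simp
        norm_num
      have h5 : (2 ^ 8 * E ^ 2 * K ^ 2)⁻¹ = (16 * E ^ 2 * K)⁻¹ * K⁻¹ / 16 := by
        field_simp
        norm_num
      have h6 : K⁻¹ ≤ 1 := inv_le_one_of_one_le₀ h.one_le_K
      have h7 : 0 ≤ (16 * E ^ 2 * K)⁻¹ := by positivity
      have h8 := mul_le_mul_of_nonneg_left h6 h7
      rw [h4, h5]
      linarith
    linarith
  have h2 : ∑ v ∈ G, correlation k F v ^ 2 ≤ 4 := by
    -- A weight above the cutoff forces a correlation of at least ε/16, by μ² ≤ 1/(2k) and ε * E ≤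
    -- 4. For this τ the hypothesis on kε² is what near-orthogonality requires.
    refine sum_correlation_sq_le hF hk0 (τ := ε / 16) (by positivity) (fun v hv => ?_) ?_
    · have h3 := hGv v hv
      set δ := correlation k F v with hδ
      have h5 : 2 * k * middle k ^ 2 ≤ 1 := by nlinarith [sq_nonneg (middle k)]
      have h6 : (ε * E) ^ 2 ≤ 4 ^ 2 :=
        pow_le_pow_left₀ (by positivity) h.mul_le 2
      have h7 : ε ^ 2 ≤ 256 * δ ^ 2 := by
        rw [weight_ext hF, inv_le_iff_one_le_mul₀ (by positivity)] at h3
        have h4 : 1 ≤ middle k ^ 2 * δ ^ 2 * (16 * E ^ 2 * (2 * k)) := by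
          refine h3.trans ?_
          have := h.K_le
          gcongr
        calc ε ^ 2 ≤ ε ^ 2 * (middle k ^ 2 * δ ^ 2 * (16 * E ^ 2 * (2 * k))) :=
              le_mul_of_one_le_right (sq_nonneg _) h4
          _ = 16 * (ε * E) ^ 2 * (2 * k * middle k ^ 2) * δ ^ 2 := by ring
          _ ≤ 16 * 4 ^ 2 * 1 * δ ^ 2 := by gcongr
          _ = _ := by norm_num
      refine abs_le_of_sq_le_sq ?_ (abs_nonneg _) |> (le_abs_self _).trans
      rw [sq_abs]
      linarith
    · have : (k : ℝ) ≤ 2 * k - 1 := by linarith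
      have := mul_le_mul_of_nonneg_right this (sq_nonneg ε)
      have e : (2 * k - 1 : ℝ) * (ε / 16) ^ 2 = (2 * k - 1 : ℝ) * ε ^ 2 / 256 := by ring
      rw [e]
      linarith
  have h3 : (256 * k : ℝ)⁻¹ * k = 1 / 256 := by field_simp
  have h4 : 2 * k * middle k ^ 2 ≤ 1 := by nlinarith [sq_nonneg (middle k)]
  calc ∑ v ∈ G, (weight F (2 * k) (2 * k) (ext v) + η + (N * η ^ 2)⁻¹) + (N * η ^ 2)⁻¹
      ≤ ∑ v ∈ G, 2 * (middle k ^ 2 * correlation k F v ^ 2) + (256 * k : ℝ)⁻¹ :=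
        add_le_add (Finset.sum_le_sum h1) h.inv_le
    _ = 2 * middle k ^ 2 * ∑ v ∈ G, correlation k F v ^ 2 + (256 * k : ℝ)⁻¹ := by
        rw [Finset.mul_sum]
        congr 1
        exact Finset.sum_congr rfl fun v _ => by ring
    _ ≤ 2 * middle k ^ 2 * 4 + (256 * k : ℝ)⁻¹ := by gcongr
    _ ≤ 5 / k := by
        rw [le_div_iff₀ (by positivity), add_mul, h3]
        linarith

/-- The natural bound is quadratic in the correlation δ and holds for δ ≥ ε only. It is weakened to
a multiple of ε(δ - ε), which is trivial for δ < ε and, being linear, can be averaged. -/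
theorem le_coin_search_of_correlation (h : Setting k ε K E ((2 ^ L : ℕ) : ℝ) η θ)
    (hF : MiddleSign k F) {x Q : ℝ} (hx : 0 ≤ x) (hxk : x ≤ k) (hxQ : x * Q ≤ 1)
    (hQ : ∀ c, coinMeasure.real {ω | attempt (estim F (2 * k) (2 ^ L) ω) ω (2 * k)
      (2 * (2 * k) * 2 ^ L) L θ c ≠ none} ≤ Q) :
    x / (16 * k) * (ε * (correlation k F v - ε)) ≤ coinMeasure.real {ω | search (estim F (2 * k)
      (2 ^ L) ω) ω (2 * k) (2 * (2 * k) * 2 ^ L) L θ k 0 = some (ext v)} := by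
  have hε := h.ε_pos
  rcases lt_or_ge (correlation k F v) ε with hv | hv
  · refine le_trans ?_ measureReal_nonneg
    refine mul_nonpos_of_nonneg_of_nonpos (by positivity) ?_
    exact mul_nonpos_of_nonneg_of_nonpos hε.le (by linarith)
  · refine le_trans ?_ (le_coin_search (N := 2 ^ L) (L := L) (θ := θ) hF.dependsOn rfl
      (le_coin_attempt_of_correlation h hF hv) hQ (by positivity) hx hxQ k 0)
    rw [min_eq_right hxk]
    calc x / (16 * k) * (ε * (correlation k F v - ε)) ≤
          x / (16 * k) * correlation k F v ^ 2 := by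
          refine mul_le_mul_of_nonneg_left ?_ (by positivity)
          nlinarith
      _ = _ := by ring

/-- The probability that the search finds a string that is correlated with `F`. -/
theorem exists_rate {k e : ℕ} {ε : ℝ} (hk : 0 < k) (hε : 0 < ε) (he : 1 / ε ≤ e)
    (he' : e ≤ 2 / ε) :
    ∃ κ : ℝ, 0 ≤ κ ∧ (ε ^ 2 / k + ε ^ 4) / 10000 ≤ κ * ε ^ 2 ∧
      ∀ (F : (ℕ → Bool) → ℤ), MiddleSign k F → ∀ v : Fin (2 * k) → Bool,
        κ * (ε * (correlation k F v - ε)) ≤ coinMeasure.real {ω |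
          search (estim F (2 * k) (2 ^ logSamples k e) ω) ω (2 * k)
            (2 * (2 * k) * 2 ^ logSamples k e) (logSamples k e) (threshold k e) k 0 =
              some (ext v)} := by
  obtain ⟨K, E, η, h⟩ := setting hk hε he he'
  have hk' := h.one_le_k
  have hr : 0 ≤ ε ^ 2 / k := by positivity
  -- If acceptances are rare, `x = k / 5` attempts count and the rate is constant. Otherwise `Q = 1`
  -- and `x = 1`: the first attempt suffices.
  by_cases hreg : 512 ≤ k * ε ^ 2
  · refine ⟨(k / 5) / (16 * k), by positivity, ?_, fun F hF v => ?_⟩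
    · have e1 : (k / 5 : ℝ) / (16 * k) = 1 / 80 := by field_simp; norm_num
      have h1 : ε ^ 2 / k ≤ ε ^ 2 := div_le_self (by positivity) hk'
      have h2 : ε ≤ 4 := by
        have := h.mul_le
        have := h.one_le_E
        nlinarith
      have h3 : ε ^ 2 ≤ 4 ^ 2 := pow_le_pow_left₀ hε.le h2 2
      have h4 : ε ^ 4 ≤ 4 ^ 2 * ε ^ 2 := by
        have := mul_le_mul_of_nonneg_right h3 (sq_nonneg ε)
        linarith
      rw [e1]
      linarith
    · exact le_coin_search_of_correlation h hF (Q := 5 / k) (by positivity) (by linarith)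
        (le_of_eq (by field_simp)) (coin_attempt_ne_none_le h hF hreg)
  · refine ⟨1 / (16 * k), by positivity, ?_, fun F hF v => ?_⟩
    · have h1 : ε ^ 4 ≤ 512 * (ε ^ 2 / k) := by
        rw [mul_div_assoc', le_div_iff₀ (by positivity)]
        have := mul_le_mul_of_nonneg_right (not_le.1 hreg).le (sq_nonneg ε)
        linarith
      have h2 : 1 / (16 * k) * ε ^ 2 = (ε ^ 2 / k) / 16 := by field_simp
      rw [h2]
      linarith
    · exact le_coin_search_of_correlation h hF (Q := 1) (by norm_num) hk' (by norm_num)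
        fun c => measureReal_le_one

end Ram

/-! ### Direct products from xors -/

namespace Ram

open MeasureTheory

variable {n k m t : ℕ}

theorem tape_mul_add (x : Fin m → Fin n → Bool) (i : Fin m) (j : Fin n) :
    Prog.tape x (n * i + j) = x i j := by
  have h : n * i + j < m * n := by
    calc n * i + j < n * i + n := by omega
      _ = n * (i + 1) := by ring
      _ ≤ n * m := Nat.mul_le_mul_left _ i.2
      _ = m * n := Nat.mul_comm _ _
  have e : finProdFinEquiv (i, j) = ⟨n * i + j, h⟩ := Fin.ext (by simp [Nat.add_comm])
  rw [Prog.tape, dif_pos h, ← e, Equiv.symm_apply_apply]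

theorem lt_of_mem_members {q : ℕ → Bool} {i j : ℕ} (h : j ∈ members q i) : j < i :=
  List.mem_range.1 (List.mem_filter.1 h).1

/-- The elements of a subset in ascending order. -/
def chosen {q : ℕ → Bool} (h : (members q m).length = k) (j : Fin k) : Fin m :=
  ⟨(members q m)[j]'(h ▸ j.2), lt_of_mem_members (List.getElem_mem _)⟩

theorem chosen_injective {q : ℕ → Bool} (h : (members q m).length = k) :
    Function.Injective (chosen h) := by
  intro i j hij
  have hn : (members q m).Nodup := List.nodup_range.filter _
  have := (hn.getElem_inj_iff (hi := h ▸ i.2) (hj := h ▸ j.2)).1 (congrArg Fin.val hij)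
  exact Fin.ext this

/-- The simulated program sees the tape of a genuine k-tuple, so what is assumed of it on such
tuples applies to every query. -/
theorem select_tape (x : Fin m → Fin n → Bool) {q : ℕ → Bool} (h : (members q m).length = k) :
    select (Prog.tape x) n k m q = Prog.tape fun j => x (chosen h j) := by
  funext p
  by_cases hp : p < n * k
  · have hn : 0 < n := Nat.pos_of_mul_pos_right (Nat.zero_lt_of_lt hp)
    have h1 : p / n < k := Nat.div_lt_of_lt_mul hp
    have h2 : p % n < n := Nat.mod_lt _ hn
    have h3 := tape_mul_add x (chosen h ⟨p / n, h1⟩) ⟨p % n, h2⟩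
    have h4 := tape_mul_add (fun j => x (chosen h j)) ⟨p / n, h1⟩ ⟨p % n, h2⟩
    simp only [Nat.div_add_mod] at h4
    rw [h4, ← h3, select, if_pos hp]
    simp only [chosen]
    rw [List.getD_eq_getElem _ _ (h ▸ h1)]
    rfl
  · rw [select, if_neg hp, Prog.tape, dif_neg (by rwa [Nat.mul_comm])]

/-- By induction only finitely many configurations are possible after `T` steps, and the next step
reads at most one toss in each of them. -/
theorem exists_dependsOn_run (P : Prog) (inp : ℕ → Bool) (s₀ : Config) (T : ℕ) :
    ∃ s : Finset ℕ, DependsOn (fun ω => (P.step inp ω)^[T] s₀) s := by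
  classical
  induction T with
  | zero => exact ⟨∅, fun _ _ _ => rfl⟩
  | succ T ih =>
    obtain ⟨s, hs⟩ := ih
    refine ⟨s ∪ (finite_range_of_dependsOn hs).toFinset.biUnion fun c =>
      match P[c.pc]? with
      | some (.coin _ a) => {c.mem a}
      | _ => ∅, fun x y h => ?_⟩
    have h1 := hs fun i hi => h i (Finset.mem_coe.2 (Finset.mem_union_left _ (Finset.mem_coe.1 hi)))
    have hr : (P.step inp y)^[T] s₀ ∈ (finite_range_of_dependsOn hs).toFinset := by simp
    simp only [Function.iterate_succ_apply'] at h1 ⊢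
    rw [h1]
    generalize (P.step inp y)^[T] s₀ = c at hr
    have h2 : ∀ d a, P[c.pc]? = some (.coin d a) → x (c.mem a) = y (c.mem a) := fun d a hc =>
      h _ (Finset.mem_coe.2 (Finset.mem_union_right _ (Finset.mem_biUnion.2 ⟨c, hr, by simp [hc]⟩)))
    simp only [Prog.step]
    cases hc : P[c.pc]? with
    | none => rfl
    | some i =>
      cases i with
      | coin d a => simp only [Instr.exec, h2 d a hc]
      | _ => rfl

theorem run_eq_of_halted {P : Prog} {x : Fin m → Fin n → Bool} {ω : ℕ → Bool} {T T' : ℕ}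
    (h : P.Halted (P.run x ω T)) (hT : T ≤ T') : P.run x ω T' = P.run x ω T := by
  obtain ⟨d, rfl⟩ := Nat.exists_eq_add_of_le hT
  rw [Prog.run, Nat.add_comm, Function.iterate_add_apply]
  refine Function.iterate_fixed ?_ d
  have : P[(P.run x ω T).pc]? = none := List.getElem?_eq_none h
  change P.step _ _ (P.run x ω T) = P.run x ω T
  rw [Prog.step, this]

theorem out_eq_of_returns {P : Prog} {x : Fin m → Fin n → Bool} {ω : ℕ → Bool} {y : List Bool}
    (h : P.Halted (P.run x ω t)) (hy : P.Returns x ω y) : (P.run x ω t).out = y := by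
  obtain ⟨T, hT, rfl⟩ := hy
  rcases le_total T t with hle | hle
  · rw [run_eq_of_halted hT hle]
  · rw [run_eq_of_halted h hle]

/-- The sign of the answer of `C`, with coin tosses `ω`, for a subset of size `k`. -/
def signOf (C : Prog) (t : ℕ) (inp ω : ℕ → Bool) (n k : ℕ) (q : ℕ → Bool) : ℤ :=
  if (members q (2 * k)).length = k then
    sign (((C.step (select inp n k (2 * k) q) ω)^[t] (Prog.init n k)).out.getLast?.getD false)
  else 0

theorem middleSign_signOf (C : Prog) (t : ℕ) (inp ω : ℕ → Bool) (n k : ℕ) :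
    MiddleSign k (signOf C t inp ω n k) where
  dependsOn x y h := by
    have : members x (2 * k) = members y (2 * k) :=
      List.filter_congr fun i hi => h i (by simpa using hi)
    have h2 : select inp n k (2 * k) x = select inp n k (2 * k) y := by
      funext p
      rw [select, select, this]
    rw [signOf, signOf, this, h2]
  abs_le q := by
    rw [signOf]
    split_ifs
    · rw [abs_sign]
    · simp
  sq_eq r hr := by
    rw [signOf, if_pos ((length_members_ext r).trans hr), sign_mul_self]
  eq_zero r hr := by
    rw [signOf, if_neg fun h => hr ((length_members_ext r).symm.trans h)]

theorem sign_xor (a b : Bool) : sign (xor a b) = sign a * sign b := by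
  cases a <;> cases b <;> rfl

theorem own_interleave (ω ω' : ℕ → Bool) : own (interleave ω ω') = ω' := by
  funext c
  simp [own]

theorem corr_interleave (C : Prog) (t : ℕ) (inp ω ω' : ℕ → Bool) (n k : ℕ) (z q : ℕ → Bool) :
    corr C t inp (interleave ω ω') n k (2 * k) z q = signOf C t inp ω n k q * chi (2 * k) z q := by
  have h : (if xor (xorSum (fun i => q i && z i) (2 * k))
      (answer C t inp (interleave ω ω') n k (2 * k) q) then -1 else 1) =
      sign (xor (xorSum (fun i => q i && z i) (2 * k))
        (answer C t inp (interleave ω ω') n k (2 * k) q)) := rfl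
  rw [corr, signOf, h, sign_xor, sign_xorSum, answer]
  simp only [interleave_even]
  split_ifs
  · rw [mul_comm]
    rfl
  · simp

/-- Links the machine to the analysis: for fixed even tosses, the estimates are those of one
function `F` sampled with the odd tosses. -/
theorem est_interleave (C : Prog) (t : ℕ) (inp ω ω' : ℕ → Bool) (n k N : ℕ) :
    est C t inp (interleave ω ω') n k (2 * k) N = estim (signOf C t inp ω n k) (2 * k) N ω' := by
  funext l z c
  simp only [est, estim, sampleVal, corr_interleave, own_interleave, smp]
  rfl

theorem prod_members (q : ℕ → Bool) (g : ℕ → ℤ) (i : ℕ) :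
    ((members q i).map g).prod = ∏ j ∈ Finset.range i, if q j then g j else 1 := by
  induction i with
  | zero => rfl
  | succ i ih =>
    rw [members_succ, List.map_append, List.prod_append, ih, Finset.prod_range_succ]
    cases q i <;> simp

theorem sign_foldr (l : List Bool) : sign (l.foldr xor false) = (l.map sign).prod := by
  induction l with
  | nil => rfl
  | cons b l ih => rw [List.foldr_cons, sign_xor, ih, List.map_cons, List.prod_cons]

/-- The character at the values of `f` is the sign of their xor. -/
theorem chr_eq (f : (Fin n → Bool) → Bool) (x : Fin m → Fin n → Bool) (r : Fin m → Bool)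
    (h : (members (ext r) m).length = k) : chr (fun i => f (x i)) r =
      sign ((directProduct f k fun j => x (chosen h j)).foldr xor false) := by
  have e : directProduct f k (fun j => x (chosen h j)) =
      (members (ext r) m).map (ext fun i => f (x i)) := by
    refine List.ext_getElem (by simp [directProduct, h]) fun i h1 h2 => ?_
    have h3 : (members (ext r) m)[i]'(by simpa using h2) < m :=
      lt_of_mem_members (List.getElem_mem _)
    simp [directProduct, chosen, ext, h3]
  rw [sign_foldr, e, List.map_map, prod_members, Finset.prod_range, chr]
  refine Finset.prod_congr rfl fun i _ => ?_
  cases hr : r i <;> simp [ext, hr, sign]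

/-- The mean of a function of some of the components of a tuple. -/
theorem sum_comp_injective {ι κ X : Type*} [Fintype ι] [Fintype κ] [Fintype X] [DecidableEq ι]
    [DecidableEq κ] [Nonempty X] {e : ι → κ} (he : e.Injective) (a : (ι → X) → ℝ) :
    (∑ x : κ → X, a fun i => x (e i)) / (Fintype.card (κ → X) : ℝ) =
      (∑ y, a y) / (Fintype.card (ι → X) : ℝ) := by
  classical
  let E := Equiv.piEquivPiSubtypeProd (fun i => i ∈ Set.range e) fun _ => X
  let e' : ι ≃ {i // i ∈ Set.range e} := Equiv.ofInjective e he
  have h1 : ∑ x : κ → X, a (fun i => x (e i)) =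
      Fintype.card ({i // i ∉ Set.range e} → X) * ∑ y, a y := by
    rw [← E.symm.sum_comp, Fintype.sum_prod_type, ← (Equiv.arrowCongr e' (Equiv.refl X)).sum_comp,
      Finset.mul_sum]
    refine Finset.sum_congr rfl fun y _ => ?_
    rw [Finset.sum_congr rfl fun w _ => show _ = a y from ?_]
    · simp
    · congr 1
      funext i
      have : e i ∈ Set.range e := ⟨i, rfl⟩
      simp only [E, Equiv.piEquivPiSubtypeProd, Equiv.coe_fn_symm_mk, dif_pos this,
        Equiv.arrowCongr_apply, Function.comp, Equiv.refl_apply]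
      congr 1
      exact he (Equiv.apply_ofInjective_symm he ⟨e i, this⟩)
  have h2 : Fintype.card (κ → X) =
      Fintype.card (ι → X) * Fintype.card ({i // i ∉ Set.range e} → X) := by
    rw [Fintype.card_congr E, Fintype.card_prod,
      Fintype.card_congr (Equiv.arrowCongr e' (Equiv.refl X))]
  have h3 : (Fintype.card ({i // i ∉ Set.range e} → X) : ℝ) ≠ 0 := by
    exact_mod_cast Fintype.card_ne_zero
  have h4 : (Fintype.card (ι → X) : ℝ) ≠ 0 := by exact_mod_cast Fintype.card_ne_zero
  rw [h1, h2]
  push_cast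
  field_simp

end Ram

/-! ### The success probability -/

namespace Ram

open MeasureTheory

variable {n k t : ℕ}

/-- At most k attempts of 2k + 1 estimates, each with `N` pairs of simulations of t(10k + 15) steps,
give order k³Nt, and `N` is at most 2^40 k^6 / ε^6. The remaining terms are absorbed because `t` is
positive. -/
theorem runTime_le {e : ℕ} {ε : ℝ} (hk : 0 < k) (ht : 0 < t) (hε : 0 < ε) (he : 1 / ε ≤ e)
    (he' : e ≤ 2 / ε) : (runTime t k e : ℝ) ≤ 2 ^ 50 * k ^ 9 * (1 / ε) ^ 6 * t := by
  obtain ⟨K, E, η, h⟩ := setting hk hε he he'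
  have hN : ((2 ^ logSamples k e : ℕ) : ℝ) ≤ 2 ^ 40 * k ^ 6 * (1 / ε) ^ 6 := by
    have h1 : E ≤ 4 * (1 / ε) := by
      rw [mul_one_div, le_div_iff₀ hε, mul_comm]
      exact h.mul_le
    have h2 := h.one_le_E
    have h3 := h.one_le_K
    rw [h.N_eq]
    calc 2 ^ 22 * E ^ 6 * K ^ 6 ≤ 2 ^ 22 * (4 * (1 / ε)) ^ 6 * (2 * k) ^ 6 := by
          have := h.K_le
          gcongr
      _ = _ := by ring
  have hL : logSamples k e < 2 ^ logSamples k e := Nat.lt_two_pow_self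
  have hc : Nat.clog 2 k ≤ logSamples k e ∧ Nat.clog 2 e ≤ logSamples k e := by
    rw [logSamples]; omega
  have key : runTime t k e ≤ 2 ^ 10 * (k ^ 3 * 2 ^ logSamples k e * t) := by
    rw [runTime]
    generalize 2 ^ logSamples k e = N at hL
    generalize logSamples k e = L at hL hc
    obtain ⟨h1, h2⟩ := hc
    have hk2 : k ≤ k ^ 2 := Nat.le_self_pow two_ne_zero k
    have b1 : t * (10 * k + 15) + 23 * (2 * k) + 21 ≤ 92 * (k * t) := by
      have : k ≤ k * t := Nat.le_mul_of_pos_right _ ht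
      have : t ≤ k * t := Nat.le_mul_of_pos_left _ hk
      nlinarith
    have hkt : 0 < k * t := Nat.mul_pos hk ht
    have b2 : N * (2 * (t * (10 * k + 15) + 23 * (2 * k) + 21) + 20) + 5 + 17 ≤
        226 * (N * (k * t)) := by
      have : N * (2 * (t * (10 * k + 15) + 23 * (2 * k) + 21) + 20) ≤ N * (204 * (k * t)) :=
        Nat.mul_le_mul_left _ (by omega)
      have : 0 < N * (k * t) := Nat.mul_pos (by omega) hkt
      nlinarith
    have hNk : N ≤ N * (k * t) := Nat.le_mul_of_pos_right _ hkt
    have hN1 : 0 < N * (k * t) := by omega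
    have b3 : (2 * k + 1) * (N * (2 * (t * (10 * k + 15) + 23 * (2 * k) + 21) + 20) + 5 + 17) ≤
        678 * (k * (N * (k * t))) :=
      (Nat.mul_le_mul (show 2 * k + 1 ≤ 3 * k by omega) b2).trans_eq (by ring)
    have hk3 : N * (k * t) ≤ k * (N * (k * t)) := Nat.le_mul_of_pos_left _ hk
    have b4 : k * ((2 * k + 1) * (N * (2 * (t * (10 * k + 15) + 23 * (2 * k) + 21) + 20) + 5 + 17) +
        L * 9 + 11) ≤ k * (698 * (k * (N * (k * t)))) := Nat.mul_le_mul_left _ (by omega)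
    have hk4 : k * (N * (k * t)) ≤ k * (k * (N * (k * t))) := Nat.le_mul_of_pos_left _ hk
    have hk5 : k ≤ k * (k * (N * (k * t))) := Nat.le_mul_of_pos_right _ (by omega)
    have e1 : k ^ 3 * N * t = k * (k * (N * (k * t))) := by ring
    rw [e1]
    have b5 : k * (698 * (k * (N * (k * t)))) = 698 * (k * (k * (N * (k * t)))) := by ring
    omega
  calc (runTime t k e : ℝ) ≤ ((2 ^ 10 * (k ^ 3 * 2 ^ logSamples k e * t) : ℕ) : ℝ) := by
        exact_mod_cast key
    _ = 2 ^ 10 * (k ^ 3 * ((2 ^ logSamples k e : ℕ) : ℝ) * t) := by push_cast; ring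
    _ ≤ 2 ^ 10 * (k ^ 3 * (2 ^ 40 * k ^ 6 * (1 / ε) ^ 6) * t) := by gcongr
    _ = _ := by ring

theorem signOf_mul_chr {C : Prog} {α : ℕ → Bool} (x : Fin (2 * k) → Fin n → Bool)
    (f : (Fin n → Bool) → Bool) (r : Fin (2 * k) → Bool)
    (h : (members (ext r) (2 * k)).length = k) :
    signOf C t (Prog.tape x) α n k (ext r) * chr (fun i => f (x i)) r =
      sign (xor ((C.run (fun j => x (chosen h j)) α t).out.getLast?.getD false)
        ((directProduct f k fun j => x (chosen h j)).foldr xor false)) := by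
  rw [signOf, if_pos h, select_tape x h, chr_eq f x r h, sign_xor]
  rfl

theorem dependsOn_signOf (C : Prog) (t : ℕ) (inp : ℕ → Bool) (n k : ℕ) (q : ℕ → Bool) :
    ∃ s : Finset ℕ, DependsOn (fun α => signOf C t inp α n k q) s := by
  obtain ⟨s, hs⟩ := exists_dependsOn_run C (select inp n k (2 * k) q) (Prog.init n k) t
  refine ⟨s, fun α β hαβ => ?_⟩
  have h1 := hs hαβ
  simp only at h1
  simp only [signOf, h1]

/-- The sign is 1 whenever the output is exactly the xor, and at least -1 otherwise. Equality may
fail, since a wrong output can still end with the right bit. -/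
theorem le_integral_signOf {C : Prog} (hC : C.RunsInTime n k t) (x : Fin (2 * k) → Fin n → Bool)
    (f : (Fin n → Bool) → Bool) (r : Fin (2 * k) → Bool)
    (h : (members (ext r) (2 * k)).length = k) :
    2 * coinMeasure.real {α | C.Returns (fun j => x (chosen h j)) α
      (xorProduct f k fun j => x (chosen h j))} - 1 ≤
      ∫ α, (signOf C t (Prog.tape x) α n k (ext r) * chr (fun i => f (x i)) r : ℝ)
        ∂coinMeasure := by
  classical
  obtain ⟨y, hy⟩ : ∃ y, y = fun j => x (chosen h j) := ⟨_, rfl⟩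
  rw [← hy]
  have e : {α | C.Returns y α (xorProduct f k y)} =
      {α | (C.run y α t).out = xorProduct f k y} :=
    Set.ext fun α => ⟨out_eq_of_returns (hC y α), fun h => ⟨t, hC y α, h⟩⟩
  obtain ⟨s, hs⟩ := exists_dependsOn_run C (Prog.tape y) (Prog.init n k) t
  have hp : DependsOn (fun α => (C.run y α t).out = xorProduct f k y) s := fun α β hαβ => by
    have h1 := hs hαβ
    simp only at h1
    simp only [Prog.run, h1]
  obtain ⟨s', hs'⟩ := dependsOn_signOf C t (Prog.tape x) n k (ext r)
  have hi : Integrable (fun α => (signOf C t (Prog.tape x) α n k (ext r) *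
      chr (fun i => f (x i)) r : ℝ)) coinMeasure :=
    integrable_of_dependsOn (s := s') fun α β hαβ => by
      have h1 := hs' hαβ
      simp only at h1
      simp only [h1]
  rw [e, ← integral_ite hp, ← integral_const_mul]
  have h1 : ∫ _, (1 : ℝ) ∂coinMeasure = 1 := by simp
  refine (congrArg _ h1.symm).trans_le ?_
  rw [← integral_sub ((integrable_ite hp).const_mul 2) (integrable_const _)]
  refine integral_mono (((integrable_ite hp).const_mul 2).sub (integrable_const _)) hi fun α => ?_
  simp only
  have h2 := signOf_mul_chr (C := C) (t := t) (α := α) x f r h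
  rw [← hy] at h2
  rw [← Int.cast_mul, h2]
  split_ifs with hα
  · rw [hα, xorProduct]
    simp [sign]
    norm_num
  · generalize xor _ _ = b
    cases b <;> norm_num [sign]

theorem integrable_correlation (C : Prog) (t : ℕ) (inp : ℕ → Bool) (n k : ℕ)
    (v : Fin (2 * k) → Bool) :
    Integrable (fun α => correlation k (signOf C t inp α n k) v) coinMeasure ∧
    ∫ α, correlation k (signOf C t inp α n k) v ∂coinMeasure =
      (∑ r ∈ slice k (2 * k), ∫ α, (signOf C t inp α n k (ext r) * chr v r : ℝ) ∂coinMeasure) /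
        k.centralBinom := by
  have hi : ∀ r ∈ slice k (2 * k), Integrable
      (fun α => (signOf C t inp α n k (ext r) * chr v r : ℝ)) coinMeasure := fun r _ => by
    obtain ⟨s, hs⟩ := dependsOn_signOf C t inp n k (ext r)
    refine integrable_of_dependsOn (s := s) fun α β hαβ => ?_
    have h1 := hs hαβ
    simp only at h1
    simp only [h1]
  constructor
  · simp only [correlation]
    exact (integrable_finsetSum _ hi).div_const _
  · simp only [correlation]
    rw [integral_div, integral_finsetSum _ hi]

/-- The blocks selected by a fixed subset of a uniform 2k-tuple form a uniform k-tuple. So every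
subset in the slice contributes at least twice the success fraction minus one. -/
theorem le_mean_correlation {C : Prog} (hC : C.RunsInTime n k t) (f : (Fin n → Bool) → Bool) :
    2 * C.successFraction (xorProduct f k) - 1 ≤
      (∑ x : Fin (2 * k) → Fin n → Bool, ∫ α,
        correlation k (signOf C t (Prog.tape x) α n k) (fun i => f (x i)) ∂coinMeasure) /
          (Fintype.card (Fin (2 * k) → Fin n → Bool) : ℝ) := by
  have hX : (0 : ℝ) < Fintype.card (Fin (2 * k) → Fin n → Bool) := by
    exact_mod_cast Fintype.card_pos
  have hB : (0 : ℝ) < k.centralBinom := by exact_mod_cast k.centralBinom_pos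
  have hcard : ((slice k (2 * k)).card : ℝ) = k.centralBinom := by
    rw [Nat.centralBinom_eq_two_mul_choose]
    exact_mod_cast card_slice k (2 * k)
  simp only [(integrable_correlation _ _ _ _ _ _).2]
  rw [← Finset.sum_div, Finset.sum_comm, div_div, mul_comm (k.centralBinom : ℝ), ← div_div,
    le_div_iff₀ hB, ← hcard, mul_comm, ← nsmul_eq_mul, Finset.sum_div]
  refine Finset.card_nsmul_le_sum _ _ _ fun r hr => ?_
  have h : (members (ext r) (2 * k)).length = k :=
    (length_members_ext r).trans (by simpa [slice] using hr)
  have h1 := sum_comp_injective (chosen_injective h) fun y : Fin k → Fin n → Bool =>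
    coinMeasure.real {α | C.Returns y α (xorProduct f k y)}
  rw [Prog.successFraction, ← h1, le_div_iff₀ hX, sub_mul, mul_assoc, div_mul_cancel₀ _ hX.ne',
    Finset.mul_sum, one_mul]
  calc _ = ∑ x : Fin (2 * k) → Fin n → Bool, (2 * coinMeasure.real {α | C.Returns
        (fun j => x (chosen h j)) α (xorProduct f k fun j => x (chosen h j))} - 1) := by
        rw [Finset.sum_sub_distrib]
        simp
    _ ≤ _ := Finset.sum_le_sum fun x _ => le_integral_signOf hC x f r h

/-- The program that computes the direct product from a program `C` for the xor. -/
def mainProg (C : Prog) (e : ℕ) : Prog := mainCode C e 0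

theorem exec_mainCode {C : Prog} (hC : C.RunsInTime n k t) (e : ℕ)
    (x : Fin (2 * k) → Fin n → Bool) (ω : ℕ → Bool) :
    (mainProg C e).Halted ((mainProg C e).run x ω (runTime t k e)) ∧
      ((mainProg C e).run x ω (runTime t k e)).out =
        ((search (est C t (Prog.tape x) ω n k (2 * k) (2 ^ logSamples k e)) (own ω) (2 * k)
          (2 * (2 * k) * 2 ^ logSamples k e) (logSamples k e) (threshold k e) k 0).map fun z =>
            (List.range (2 * k)).map z).getD [] := by
  have h := (exec_main (inp := Prog.tape x) (ω := ω) (C := C) (n := n) (k := k) (t := t) (e := e)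
    fun q hq => by
      rw [select_tape x hq]
      exact hC _ _).halts le_rfl
  obtain ⟨h1, m, h2⟩ := h
  exact ⟨h1, h2⟩

/-- For fixed even tosses the search decodes a fixed function, and `hκ` applies. Its bound is linear
in the correlation, so integration over the even tosses gives the mean correlation. -/
theorem le_coin_returns {C : Prog} (hC : C.RunsInTime n k t) (f : (Fin n → Bool) → Bool) {e : ℕ}
    {ε κ : ℝ} (hκ : ∀ (F : (ℕ → Bool) → ℤ), MiddleSign k F → ∀ v : Fin (2 * k) → Bool,
      κ * (ε * (correlation k F v - ε)) ≤ coinMeasure.real {ω |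
        search (estim F (2 * k) (2 ^ logSamples k e) ω) ω (2 * k)
          (2 * (2 * k) * 2 ^ logSamples k e) (logSamples k e) (threshold k e) k 0 =
            some (ext v)}) (x : Fin (2 * k) → Fin n → Bool) :
    κ * (ε * (∫ α, correlation k (signOf C t (Prog.tape x) α n k) (fun i => f (x i)) ∂coinMeasure -
      ε)) ≤ coinMeasure.real {ω | (mainProg C e).Returns x ω (directProduct f (2 * k) x)} := by
  -- The output at a fixed time depends on finitely many tosses, as the averaging over the even
  -- tosses requires; `Returns` follows from it.
  obtain ⟨p, hp⟩ : ∃ p : (ℕ → Bool) → Prop, p = fun ω =>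
    ((mainProg C e).run x ω (runTime t k e)).out = directProduct f (2 * k) x := ⟨_, rfl⟩
  obtain ⟨s, hs⟩ := exists_dependsOn_run (mainProg C e) (Prog.tape x) (Prog.init n (2 * k))
    (runTime t k e)
  have hd : DependsOn p s := fun α β hαβ => by
    have h1 := hs hαβ
    simp only at h1
    simp only [hp, Prog.run, h1]
  have h1 : coinMeasure.real {ω | p ω} ≤
      coinMeasure.real {ω | (mainProg C e).Returns x ω (directProduct f (2 * k) x)} :=
    measureReal_mono fun ω hω => ⟨_, (exec_mainCode hC e x ω).1, by
      rw [hp] at hω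
      exact hω⟩
  refine le_trans ?_ h1
  obtain ⟨hi, he⟩ := integral_real_interleave hd
  have hc := (integrable_correlation C t (Prog.tape x) n k fun i => f (x i)).1
  have h2 : κ * (ε * (∫ α, correlation k (signOf C t (Prog.tape x) α n k) (fun i => f (x i))
      ∂coinMeasure - ε)) = ∫ α, κ * (ε * (correlation k (signOf C t (Prog.tape x) α n k)
        (fun i => f (x i)) - ε)) ∂coinMeasure := by
    rw [integral_const_mul, integral_const_mul, integral_sub hc (integrable_const _)]
    simp
  rw [h2, ← he]
  refine integral_mono (((hc.sub (integrable_const _)).const_mul _).const_mul _) hi fun α => ?_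
  refine (hκ _ (middleSign_signOf C t (Prog.tape x) α n k) _).trans
    (measureReal_mono fun β hβ => ?_)
  rw [Set.mem_ofPred_eq] at hβ ⊢
  rw [hp]
  simp only
  rw [(exec_mainCode hC e x _).2, own_interleave]
  have h3 := est_interleave C t (Prog.tape x) α β n k (2 ^ logSamples k e)
  rw [h3, hβ, Option.map_some, Option.getD_some, directProduct]
  refine List.ext_getElem (by simp) fun i hi1 hi2 => ?_
  have : i < 2 * k := by simpa using hi1
  simp [ext, this]

/-- The mean correlation is at least 2ε, so the linear bound averages to at least κε(2ε - ε) = κε².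
-/
theorem le_successFraction_mainCode {C : Prog} (hC : C.RunsInTime n k t)
    (f : (Fin n → Bool) → Bool) {e : ℕ} {ε : ℝ} (hk : 0 < k) (hε : 0 < ε) (he : 1 / ε ≤ e)
    (he' : e ≤ 2 / ε) (h : 1 / 2 + ε ≤ C.successFraction (xorProduct f k)) :
    (ε ^ 2 / k + ε ^ 4) / 10000 ≤ (mainProg C e).successFraction (directProduct f (2 * k)) := by
  obtain ⟨κ, hκ0, hκ1, hκ⟩ := exists_rate hk hε he he'
  have hX : (0 : ℝ) < Fintype.card (Fin (2 * k) → Fin n → Bool) := by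
    exact_mod_cast Fintype.card_pos
  have h1 := (le_mean_correlation hC f)
  rw [le_div_iff₀ hX] at h1
  refine hκ1.trans ?_
  rw [Prog.successFraction, le_div_iff₀ hX]
  refine le_trans ?_ (Finset.sum_le_sum fun x _ => le_coin_returns hC f hκ x)
  rw [← Finset.mul_sum, ← Finset.mul_sum, Finset.sum_sub_distrib, sq, mul_assoc, mul_assoc]
  refine mul_le_mul_of_nonneg_left (mul_le_mul_of_nonneg_left ?_ hε.le) hκ0
  rw [Finset.sum_const, Finset.card_univ, nsmul_eq_mul]
  nlinarith

/-- A program that outputs something does not halt immediately. -/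
theorem pos_of_successFraction_pos {C : Prog} (hC : C.RunsInTime n k t)
    {f : (Fin n → Bool) → Bool} (h : 0 < C.successFraction (xorProduct f k)) : 0 < t := by
  by_contra! ht
  obtain rfl : t = 0 := by omega
  refine h.ne' ?_
  rw [Prog.successFraction, Finset.sum_eq_zero, zero_div]
  intro x _
  have : {ω | C.Returns x ω (xorProduct f k x)} = ∅ := by
    refine Set.eq_empty_of_forall_notMem fun ω hω => ?_
    have := out_eq_of_returns (hC x ω) hω
    simp [Prog.run, Prog.init, xorProduct] at this
  rw [this, measureReal_empty]

end Ram

open Ram in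
theorem theorem3 :
    ∃ (A : Prog × ℕ → Prog) (p : MvPolynomial (Fin 2) ℕ) (c : ℝ),
      Computable A ∧ 0 < c ∧
      ∀ (k : ℕ) (ε : ℝ), 0 < ε → ε < 1 → (2 : ℝ)⁻¹ ^ k < ε →
      ∀ (n t : ℕ) (f : (Fin n → Bool) → Bool) (C' : Prog),
        C'.RunsInTime n k t →
        1 / 2 + ε ≤ C'.successFraction (xorProduct f k) →
        ∃ t' : ℕ,
          (t' : ℝ) ≤ MvPolynomial.aeval ![(k : ℝ), 1 / ε] p * (t : ℝ) ∧
          (A (C', ⌈1 / ε⌉₊)).RunsInTime n (2 * k) t' ∧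
          c * (ε ^ 2 / k + ε ^ 4) ≤
            (A (C', ⌈1 / ε⌉₊)).successFraction (directProduct f (2 * k)) := by
  refine ⟨fun a => mainProg a.1 a.2, MvPolynomial.C (2 ^ 50) * MvPolynomial.X 0 ^ 9 * MvPolynomial.X 1 ^ 6, 1 / 10000,
    computable_main, by norm_num, fun k ε hε hε1 hkε n t f C hC h => ?_⟩
  -- For `k = 0` the hypothesis on ε would say 1 < ε.
  have hk : 0 < k := Nat.pos_of_ne_zero fun hk => by
    rw [hk, pow_zero] at hkε
    linarith
  -- A bound that is a multiple of `t` needs `t > 0`, since the parameters and the loops take time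
  -- of their own.
  have ht := pos_of_successFraction_pos hC (lt_of_lt_of_le (by positivity) h)
  have he : 1 / ε ≤ ⌈1 / ε⌉₊ := Nat.le_ceil _
  have he' : (⌈1 / ε⌉₊ : ℝ) ≤ 2 / ε := by
    have h1 := (Nat.ceil_lt_add_one (a := 1 / ε) (by positivity)).le
    -- As 1/ε ≥ 1, rounding up at most doubles it.
    have h2 : 1 ≤ 1 / ε := (one_le_div hε).2 hε1.le
    have h3 : 2 / ε = 1 / ε + 1 / ε := by ring
    linarith
  refine ⟨runTime t k ⌈1 / ε⌉₊, ?_, fun x ω => (exec_mainCode hC _ x ω).1, ?_⟩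
  · refine (runTime_le hk ht hε he he').trans_eq ?_
    simp only [map_mul, map_pow, MvPolynomial.aeval_X, MvPolynomial.aeval_C]
    simp
  · refine (le_of_eq ?_).trans (le_successFraction_mainCode hC f hk hε he he' h)
    ring
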